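/- **Setting.** Let $N,d\ge1$ and $L\ge2$. Data: $X\in\mathbb R^{N\times d}$ with entries bounded by $C_x$ (row $n$ is the sample $x^n$), labels $y^1,\dots,y^N\in\mathcal Y$. Functions $h_1,h_2:\mathbb R\to\mathbb R$ and $\phi:\mathbb R\times\mathcal Y\to\mathbb R$ (differentiable in its first argument, with derivative $\phi_1'$) satisfy $|h_i|\le L_1$, $|h_i'|\le L_2$, $h_i'$ is $L_3$-Lipschitz ($i=1,2$), $|\phi_1'|\le L_4$, and $\phi_1'(\cdot,y)$ is $L_5$-Lipschitz for all $y$. Scalar functions act entrywise on vectors, $\cdot$ is the entrywise product of vectors, and norms are sup norms. **Discrete Res-Net and scaled gradient descent.** With $m_0=d$, $m_\ell=m$ ($1\le\ell\le L$), $m_{L+1}=1$ and weights $\hat v_{\ell,i,j}$ (from unit $i$ of layer $\ell-1$ to unit $j$ of layer $\ell$), put $\hat\beta_{1,j}(n)=\frac1d\sum_i\hat v_{1,i,j}x^n(i)$; for $2\le\ell\le L$, $\hat\alpha_{\ell,j}=\frac1m\sum_i\hat v_{\ell,i,j}h_1(\hat\beta_{\ell-1,i})$ and $\hat\beta_{\ell,j}=h_2(\hat\alpha_{\ell,j})+\hat\beta_{\ell-1,j}$;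 and $\hat\beta_{L+1,1}=\frac1m\sum_i\hat v_{L+1,i,1}h_1(\hat\beta_{L,i})$. The loss is $\hat{\mathcal L}=\frac1N\sum_n\phi(\hat\beta_{L+1,1}(n),y^n)$, and $$\hat v^{k+1}_{\ell,i,j}=\hat v^k_{\ell,i,j}-\eta\,m_{\ell-1}m_\ell\,\frac{\partial\hat{\mathcal L}}{\partial\hat v_{\ell,i,j}}(\hat v^k).$$ A superscript $k$ denotes quantities of the network with weights $\hat v^k$. **Continuous Res-Net.** Let $p$ be a probability measure on paths $\Theta=(v_1,\alpha_2,\dots,\alpha_L)\in\mathbb R^{d+N(L-1)}$, $v_\ell:\mathrm{supp}(p)^2\to\mathbb R$ ($2\le\ell\le L$; first argument source, second argument target), $v_{L+1}:\mathrm{supp}(p)\to\mathbb R$, and $\beta_\ell(\Theta)=\frac1dXv_1+\sum_{i=2}^\ell h_2(\alpha_i)$, such that $\alpha_\ell=\int v_\ell(\bar\Theta,\Theta)\,h_1(\beta_{\ell-1}(\bar\Theta))\,dp(\bar\Theta)$ for all $\Theta\in\mathrm{supp}(p)$ and $2\le\ell\le L$. Assume that $p$ is $\sigma$-sub-gaussian,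 i.e. $\mathbb E_p\exp((u^\top\Theta)^2/\sigma^2)\le e$ for all Euclidean unit vectors $u$; that on $\mathrm{supp}(p)$, for $2\le\ell\le L$, $|v_\ell(\Theta,\bar\Theta)|\le C_5(1+\|\bar\Theta\|_\infty)$ and $|v_\ell(\Theta_1,\Theta_2)-v_\ell(\tilde\Theta_1,\tilde\Theta_2)|\le C_6(1+\|\Theta_2\|_\infty)(\|\Theta_1-\tilde\Theta_1\|_\infty+\|\Theta_2-\tilde\Theta_2\|_\infty)$ whenever $\|\Theta_i-\tilde\Theta_i\|_\infty<1$; and that $|v_{L+1}|\le C_7$ and $v_{L+1}$ is $C_8$-Lipschitz in the sup norm on $\mathrm{supp}(p)$. **Neural feature flow on $[0,T]$.** This is a collection $\Phi$ of functions $\Phi^{v}_1(\Theta)(t)\in\mathbb R^d$, $\Phi^v_\ell(\Theta,\bar\Theta)(t)\in\mathbb R$ ($2\le\ell\le L$), $\Phi^v_{L+1}(\Theta)(t)\in\mathbb R$, $\Phi^\alpha_\ell(\Theta)(t)\in\mathbb R^N$ ($2\le\ell\le L$), $\Phi^\beta_\ell(\Theta)(t)\in\mathbb R^N$ ($1\le\ell\le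 L$), continuous in $t\in[0,T]$ and measurable in the paths in $\mathrm{supp}(p)$, such that for every component $\Psi$ of $\Phi$, all paths in $\mathrm{supp}(p)$ and all $t\in[0,T]$, $\Psi(t)=\Psi(0)-\int_0^t G(s)\,ds$. The initial values are $v_1$, $v_\ell(\Theta,\bar\Theta)$, $v_{L+1}(\Theta)$, $\alpha_\ell$, $\beta_\ell(\Theta)$ respectively. The drifts $G$ are given, at time $t$ (suppressed), by $\beta_{L+1}=\int\Phi^v_{L+1}(\Theta)h_1(\Phi^\beta_L(\Theta))\,dp(\Theta)$, $D_{L+1}(n)=\phi_1'(\beta_{L+1}(n),y^n)$, $D^\beta_L(\Theta)=\Phi^v_{L+1}(\Theta)\,D_{L+1}\cdot h_1'(\Phi^\beta_L(\Theta))$, and for $2\le\ell\le L$, $$D^\alpha_\ell(\Theta)=D^\beta_\ell(\Theta)\cdot h_2'(\Phi^\alpha_\ell(\Theta)),\qquad D^\beta_{\ell-1}(\Theta)=D^\beta_\ell(\Theta)+\Big[\int\Phi^v_\ell(\Theta,\bar\Theta)D^\alpha_\ell(\bar\Theta)\,dp(\bar\Theta)\Big]\cdot h_1'(\Phi^\beta_{\ell-1}(\Theta)),$$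 $$G^v_{L+1}(\Theta)=\tfrac1ND_{L+1}^\top h_1(\Phi^\beta_L(\Theta)),\quad G^v_\ell(\Theta,\bar\Theta)=\tfrac1ND^\alpha_\ell(\bar\Theta)^\top h_1(\Phi^\beta_{\ell-1}(\Theta)),\quad G^v_1(\Theta)=\tfrac1NX^\top D^\beta_1(\Theta),$$ $$G^\beta_1=\tfrac1dXG^v_1,\qquad G^\beta_\ell(\Theta)=G^\beta_{\ell-1}(\Theta)+G^\alpha_\ell(\Theta)\cdot h_2'(\Phi^\alpha_\ell(\Theta)),$$ $$G^\alpha_\ell(\Theta)=\int\Phi^v_\ell(\bar\Theta,\Theta)\,h_1'(\Phi^\beta_{\ell-1}(\bar\Theta))\cdot G^\beta_{\ell-1}(\bar\Theta)\,dp(\bar\Theta)+\int h_1(\Phi^\beta_{\ell-1}(\bar\Theta))\,G^v_\ell(\bar\Theta,\Theta)\,dp(\bar\Theta).$$ The loss of the flow is $\mathcal L^t=\frac1N\sum_n\phi(\beta_{L+1}(t)(n),y^n)$. **$\varepsilon_1$-independent initialization.** Random initial weights $\hat v^0$ are $\varepsilon_1$-independent with respect to $(v,p)$ if there are i.i.d.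 $\bar\Theta_1,\dots,\bar\Theta_m\sim p$, $\bar\Theta_i=(\bar v_{1,i},\bar\alpha_{2,i},\dots,\bar\alpha_{L,i})$, on the same probability space such that almost surely, for all $i,j\in[m]$ and $2\le\ell\le L$: $\|\hat v^0_{1,i}-\bar v_{1,i}\|_\infty\le(1+\|\bar\Theta_i\|_\infty)\varepsilon_1$ (where $\hat v_{1,i}\in\mathbb R^d$ is the vector of weights into unit $i$ of layer 1), $|\hat v^0_{\ell,i,j}-v_\ell(\bar\Theta_i,\bar\Theta_j)|\le(1+\|\bar\Theta_i\|_\infty+\|\bar\Theta_j\|_\infty)\varepsilon_1$, and $|\hat v^0_{L+1,i,1}-v_{L+1}(\bar\Theta_i)|\le(1+\|\bar\Theta_i\|_\infty)\varepsilon_1$. **Theorem.** For all $N,d,L$, $T>0$, $\sigma>0$, $L_1,\dots,L_5,C_5,\dots,C_8,C_x$ there are constants $C>0$, $\varepsilon_0\in(0,1]$, $q\in\mathbb N$, depending only on these parameters, such that the following holds for all data, functions $h_1,h_2,\phi$, continuous Res-Nets $(v,p)$ as above and every neural feature flow $\Phi$ of $(v,p)$ on $[0,T]$. Let $0<\varepsilon_1\le\varepsilon_0$,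 $0<\delta\le1$, $0<\eta\le\varepsilon_1/C$ and $$m\ \ge\ C\,\varepsilon_1^{-2}\Big(1+\log\tfrac1{\varepsilon_1\delta}\Big)^q,$$ and run scaled gradient descent with step size $\eta$ from an $\varepsilon_1$-independent initialization with paths $\bar\Theta_i$. Then with probability at least $1-\delta$, simultaneously for all integers $k\ge0$ with $k\eta\le T$: each of the quantities $$\|\hat v^k_{1,i}-\Phi^v_1(\bar\Theta_i)(k\eta)\|_\infty,\quad|\hat v^k_{\ell,i,j}-\Phi^v_\ell(\bar\Theta_i,\bar\Theta_j)(k\eta)|,\quad|\hat v^k_{L+1,i,1}-\Phi^v_{L+1}(\bar\Theta_i)(k\eta)|,$$ $$\|\hat\alpha^k_{\ell,i}-\Phi^\alpha_\ell(\bar\Theta_i)(k\eta)\|_\infty\ (2\le\ell\le L),\quad\|\hat\beta^k_{\ell,i}-\Phi^\beta_\ell(\bar\Theta_i)(k\eta)\|_\infty\ (1\le\ell\le L)$$ for $i,j\in[m]$ is at most $C\,\varepsilon_1\big(1+\log\tfrac{m}{\varepsilon_1\delta}\big)^q$, and $|\hat{\mathcal L}^k-\mathcal L^{k\eta}|\le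 C\,\varepsilon_1$. -/

import Mathlib

open MeasureTheory ProbabilityTheory

noncomputable section

namespace ResNet

/-! Indexing. A Res-Net has `L = B + 1` hidden layers, each with `m` units.  The feature layer
`ℓ ∈ [1 : L]` is the index `ℓ - 1 : Fin (B + 1)`; the residual layer `ℓ ∈ [2 : L]` is the index
`b = ℓ - 2 : Fin B`.  Residual layer `b` reads the features `b.castSucc` (layer `ℓ - 1`) and
produces the features `b.succ` (layer `ℓ`).  All norms on function types are sup norms. -/

/-- The training data `X` (row `n` is the sample `x ^ n`), the labels `y`, the two activation
functions and the loss function. -/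
structure Model (N d : ℕ) (Y : Type*) where
  X : Fin N → Fin d → ℝ
  y : Fin N → Y
  h₁ : ℝ → ℝ
  h₂ : ℝ → ℝ
  φ : ℝ → Y → ℝ

/-- Derivative of the loss in its first argument, at the `n`-th label. -/
def Model.dφ {N d : ℕ} {Y : Type*} (M : Model N d Y) (n : Fin N) (x : ℝ) : ℝ :=
  deriv (fun z => M.φ z (M.y n)) x

/-- Training loss `(1 / N) ∑ₙ φ (out n, yₙ)` of an output vector. -/
def Model.risk {N d : ℕ} {Y : Type*} (M : Model N d Y) (out : Fin N → ℝ) : ℝ :=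
  (1 / (N : ℝ)) * ∑ n, M.φ (out n) (M.y n)

/-- Boundedness and smoothness of the activation functions and of the loss. -/
structure Model.Regular {N d : ℕ} {Y : Type*} (M : Model N d Y) (L₁ L₂ L₃ L₄ L₅ : ℝ) : Prop where
  diff_h₁ : Differentiable ℝ M.h₁
  diff_h₂ : Differentiable ℝ M.h₂
  bound_h₁ : ∀ x, |M.h₁ x| ≤ L₁
  bound_h₂ : ∀ x, |M.h₂ x| ≤ L₁
  bound_deriv_h₁ : ∀ x, |deriv M.h₁ x| ≤ L₂
  bound_deriv_h₂ : ∀ x, |deriv M.h₂ x| ≤ L₂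
  lip_deriv_h₁ : ∀ x z, |deriv M.h₁ x - deriv M.h₁ z| ≤ L₃ * |x - z|
  lip_deriv_h₂ : ∀ x z, |deriv M.h₂ x - deriv M.h₂ z| ≤ L₃ * |x - z|
  diff_φ : ∀ y, Differentiable ℝ (fun x => M.φ x y)
  bound_deriv_φ : ∀ y x, |deriv (fun z => M.φ z y) x| ≤ L₄
  lip_deriv_φ : ∀ y x₁ x₂,
    |deriv (fun z => M.φ z y) x₁ - deriv (fun z => M.φ z y) x₂| ≤ L₅ * |x₁ - x₂|

/-! ### Discrete Res-Net and scaled gradient descent -/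

/-- The connections of a discrete Res-Net; `i` is the source unit and `j` the target unit. -/
inductive Edge (d m B : ℕ) where
  | first (i : Fin d) (j : Fin m)
  | hidden (b : Fin B) (i j : Fin m)
  | last (i : Fin m)

/-- The weights of a discrete Res-Net. -/
abbrev Weights (d m B : ℕ) := Edge d m B → ℝ

/-- The product `m_{ℓ-1} * m_ℓ` of the widths of the two layers that an edge connects. -/
def Edge.scale {d m B : ℕ} : Edge d m B → ℝ
  | .first _ _ => (d : ℝ) * m
  | .hidden _ _ _ => (m : ℝ) * m
  | .last _ => (m : ℝ) * 1

section Discrete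

variable {N d m B : ℕ} {Y : Type*} (M : Model N d Y) (w : Weights d m B)

/-- Residuals of layer `b`, computed from the features `β` of the layer below. -/
def residualFrom (b : Fin B) (β : Fin m → Fin N → ℝ) (j : Fin m) (n : Fin N) : ℝ :=
  (1 / (m : ℝ)) * ∑ i, w (.hidden b i j) * M.h₁ (β i n)

/-- Forward propagation of the features. -/
def feature : Fin (B + 1) → Fin m → Fin N → ℝ :=
  Fin.induction (motive := fun _ => Fin m → Fin N → ℝ)
    (fun j n => (1 / (d : ℝ)) * ∑ i, w (.first i j) * M.X n i)
    (fun b β j n => M.h₂ (residualFrom M w b β j n) + β j n)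

/-- The residuals. -/
def residual (b : Fin B) : Fin m → Fin N → ℝ :=
  residualFrom M w b (feature M w b.castSucc)

/-- The output of the network on the `n`-th sample. -/
def output (n : Fin N) : ℝ :=
  (1 / (m : ℝ)) * ∑ i, w (.last i) * M.h₁ (feature M w (Fin.last B) i n)

/-- The training loss as a function of the weights. -/
def loss : ℝ := M.risk (output M w)

open Classical in
/-- Partial derivative of the training loss with respect to the weight of the edge `e`. -/
def gradient (e : Edge d m B) : ℝ :=
  deriv (fun x => loss M (Function.update w e x)) (w e)

/-- One step of scaled gradient descent with step size `η`. -/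
def gdStep (η : ℝ) : Weights d m B :=
  fun e => w e - η * e.scale * gradient M w e

/-- The weights after `k` steps of scaled gradient descent started from `w`. -/
def gd (η : ℝ) (k : ℕ) : Weights d m B :=
  (fun u => gdStep M u η)^[k] w

end Discrete

/-! ### Continuous Res-Net -/

/-- Skip-connected paths `Θ = (v₁, α₂, …, α_L)`; the norm is the max norm of all coordinates. -/
abbrev Path (d N B : ℕ) := (Fin d → ℝ) × (Fin B → Fin N → ℝ)

/-- Euclidean inner product of two paths. -/
def Path.dot {d N B : ℕ} (u Θ : Path d N B) : ℝ :=
  ∑ i, u.1 i * Θ.1 i + ∑ b, ∑ n, u.2 b n * Θ.2 b n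

/-- `p` is `σ`-sub-gaussian: `E exp ((u · Θ)² / σ²) ≤ e` for every Euclidean unit vector `u`. -/
def SubGaussian {d N B : ℕ} (p : Measure (Path d N B)) (σ : ℝ) : Prop :=
  ∀ u : Path d N B, u.dot u = 1 →
    ∫⁻ Θ, ENNReal.ofReal (Real.exp ((u.dot Θ) ^ 2 / σ ^ 2)) ∂p ≤ ENNReal.ofReal (Real.exp 1)

/-- The weights `v_ℓ (source, target)`, `ℓ ∈ [2 : L]`, and `v_{L+1}` of a continuous Res-Net. -/
structure ContWeights (d N B : ℕ) where
  hidden : Fin B → Path d N B → Path d N B → ℝ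
  last : Path d N B → ℝ

/-- The feature `β_ℓ (Θ) = X v₁ / d + ∑_{i = 2}^{ℓ} h₂ (α_i)`. -/
def pathFeature {N d B : ℕ} {Y : Type*} (M : Model N d Y) (l : Fin (B + 1)) (Θ : Path d N B)
    (n : Fin N) : ℝ :=
  (1 / (d : ℝ)) * ∑ i, M.X n i * Θ.1 i
    + ∑ b ∈ Finset.univ.filter (fun b : Fin B => b.succ ≤ l), M.h₂ (Θ.2 b n)

/-- `(v, p)` is a continuous Res-Net: the residual stored in a path of the support of `p` is the
one obtained from the layer below. -/
def IsContResNet {N d B : ℕ} {Y : Type*} (M : Model N d Y) (p : Measure (Path d N B))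
    (v : ContWeights d N B) : Prop :=
  ∀ Θ ∈ p.support, ∀ (b : Fin B) (n : Fin N),
    Θ.2 b n = ∫ Θ', v.hidden b Θ' Θ * M.h₁ (pathFeature M b.castSucc Θ' n) ∂p

/-- The conditions on the initial continuous Res-Net. -/
structure InitRegular {d N B : ℕ} (p : Measure (Path d N B)) (v : ContWeights d N B)
    (σ C₅ C₆ C₇ C₈ : ℝ) : Prop where
  subGaussian : SubGaussian p σ
  growth : ∀ b, ∀ Θ ∈ p.support, ∀ Θ' ∈ p.support, |v.hidden b Θ Θ'| ≤ C₅ * (1 + ‖Θ'‖)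
  local_lip : ∀ b, ∀ Θ₁ ∈ p.support, ∀ Θ₁' ∈ p.support ∩ Metric.ball Θ₁ 1,
    ∀ Θ₂ ∈ p.support, ∀ Θ₂' ∈ p.support ∩ Metric.ball Θ₂ 1,
      |v.hidden b Θ₁ Θ₂ - v.hidden b Θ₁' Θ₂'|
        ≤ C₆ * (1 + ‖Θ₂‖) * (‖Θ₁ - Θ₁'‖ + ‖Θ₂ - Θ₂'‖)
  last_bound : ∀ Θ ∈ p.support, |v.last Θ| ≤ C₇
  last_lip : ∀ Θ ∈ p.support, ∀ Θ' ∈ p.support, |v.last Θ - v.last Θ'| ≤ C₈ * ‖Θ - Θ'‖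

/-! ### Neural feature flow -/

/-- A trajectory of the weights, residuals and features; the last real argument is the time.  Only
the values at paths of the support of `p` and at times in `[0, T]` matter. -/
structure Trajectory (d N B : ℕ) where
  first : Path d N B → ℝ → Fin d → ℝ
  hidden : Fin B → Path d N B → Path d N B → ℝ → ℝ
  last : Path d N B → ℝ → ℝ
  α : Fin B → Path d N B → ℝ → Fin N → ℝ
  β : Fin (B + 1) → Path d N B → ℝ → Fin N → ℝ

section Flow

variable {N d B : ℕ} {Y : Type*} (M : Model N d Y) (p : Measure (Path d N B))
  (Φ : Trajectory d N B) (t : ℝ)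

/-- The output `β_{L+1} (Φ, t)`. -/
def flowOutput (n : Fin N) : ℝ :=
  ∫ Θ, Φ.last Θ t * M.h₁ (Φ.β (Fin.last B) Θ t n) ∂p

/-- The loss of the trajectory at time `t`. -/
def flowLoss : ℝ := M.risk (flowOutput M p Φ t)

/-- `D_{L+1}`. -/
def backOutput (n : Fin N) : ℝ := M.dφ n (flowOutput M p Φ t n)

/-- `D^β_ℓ`, by downward recursion on the layer. -/
def backβ : Fin (B + 1) → Path d N B → Fin N → ℝ :=
  Fin.reverseInduction (motive := fun _ => Path d N B → Fin N → ℝ)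
    (fun Θ n => Φ.last Θ t * backOutput M p Φ t n * deriv M.h₁ (Φ.β (Fin.last B) Θ t n))
    (fun b D Θ n => D Θ n
      + (∫ Θ', Φ.hidden b Θ Θ' t * (D Θ' n * deriv M.h₂ (Φ.α b Θ' t n)) ∂p)
        * deriv M.h₁ (Φ.β b.castSucc Θ t n))

/-- `D^α_ℓ`. -/
def backα (b : Fin B) (Θ : Path d N B) (n : Fin N) : ℝ :=
  backβ M p Φ t b.succ Θ n * deriv M.h₂ (Φ.α b Θ t n)

/-- Drift of the last-layer weights. -/
def driftLast (Θ : Path d N B) : ℝ :=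
  (1 / (N : ℝ)) * ∑ n, backOutput M p Φ t n * M.h₁ (Φ.β (Fin.last B) Θ t n)

/-- Drift of the weights from `Θ` to `Θ'`. -/
def driftHidden (b : Fin B) (Θ Θ' : Path d N B) : ℝ :=
  (1 / (N : ℝ)) * ∑ n, backα M p Φ t b Θ' n * M.h₁ (Φ.β b.castSucc Θ t n)

/-- Drift of the first-layer weights. -/
def driftFirst (Θ : Path d N B) (i : Fin d) : ℝ :=
  (1 / (N : ℝ)) * ∑ n, M.X n i * backβ M p Φ t 0 Θ n

/-- Drift of the residuals of layer `b`, given the drift `g` of the features of the layer below. -/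
def driftαFrom (b : Fin B) (g : Path d N B → Fin N → ℝ) (Θ : Path d N B) (n : Fin N) : ℝ :=
  (∫ Θ', Φ.hidden b Θ' Θ t * (deriv M.h₁ (Φ.β b.castSucc Θ' t n) * g Θ' n) ∂p)
    + ∫ Θ', M.h₁ (Φ.β b.castSucc Θ' t n) * driftHidden M p Φ t b Θ' Θ ∂p

/-- Drift of the features, by upward recursion on the layer. -/
def driftβ : Fin (B + 1) → Path d N B → Fin N → ℝ :=
  Fin.induction (motive := fun _ => Path d N B → Fin N → ℝ)
    (fun Θ n => (1 / (d : ℝ)) * ∑ i, M.X n i * driftFirst M p Φ t Θ i)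
    (fun b g Θ n => g Θ n + driftαFrom M p Φ t b g Θ n * deriv M.h₂ (Φ.α b Θ t n))

/-- Drift of the residuals. -/
def driftα (b : Fin B) : Path d N B → Fin N → ℝ :=
  driftαFrom M p Φ t b (driftβ M p Φ t b.castSucc)

end Flow

/-- `Φ` is a neural feature flow on `[0, T]` started from the continuous Res-Net `(v, p)`: every
component is continuous in time, measurable in the paths, and solves the integral equation. -/
structure IsNeuralFeatureFlow {N d B : ℕ} {Y : Type*} (M : Model N d Y)
    (p : Measure (Path d N B)) (v : ContWeights d N B) (T : ℝ) (Φ : Trajectory d N B) : Prop where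
  cont_first : ∀ Θ ∈ p.support, ContinuousOn (Φ.first Θ) (Set.Icc 0 T)
  cont_hidden : ∀ b, ∀ Θ ∈ p.support, ∀ Θ' ∈ p.support,
    ContinuousOn (Φ.hidden b Θ Θ') (Set.Icc 0 T)
  cont_last : ∀ Θ ∈ p.support, ContinuousOn (Φ.last Θ) (Set.Icc 0 T)
  cont_α : ∀ b, ∀ Θ ∈ p.support, ContinuousOn (Φ.α b Θ) (Set.Icc 0 T)
  cont_β : ∀ l, ∀ Θ ∈ p.support, ContinuousOn (Φ.β l Θ) (Set.Icc 0 T)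
  meas_first : ∀ t ∈ Set.Icc 0 T, Measurable (fun Θ : p.support => Φ.first Θ t)
  meas_hidden : ∀ t ∈ Set.Icc 0 T, ∀ b,
    Measurable (fun q : p.support × p.support => Φ.hidden b q.1 q.2 t)
  meas_last : ∀ t ∈ Set.Icc 0 T, Measurable (fun Θ : p.support => Φ.last Θ t)
  meas_α : ∀ t ∈ Set.Icc 0 T, ∀ b, Measurable (fun Θ : p.support => Φ.α b Θ t)
  meas_β : ∀ t ∈ Set.Icc 0 T, ∀ l, Measurable (fun Θ : p.support => Φ.β l Θ t)
  eq_β : ∀ t ∈ Set.Icc 0 T, ∀ l, ∀ Θ ∈ p.support, ∀ n,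
    Φ.β l Θ t n = pathFeature M l Θ n - ∫ s in (0 : ℝ)..t, driftβ M p Φ s l Θ n
  eq_α : ∀ t ∈ Set.Icc 0 T, ∀ b, ∀ Θ ∈ p.support, ∀ n,
    Φ.α b Θ t n = Θ.2 b n - ∫ s in (0 : ℝ)..t, driftα M p Φ s b Θ n
  eq_first : ∀ t ∈ Set.Icc 0 T, ∀ Θ ∈ p.support, ∀ i,
    Φ.first Θ t i = Θ.1 i - ∫ s in (0 : ℝ)..t, driftFirst M p Φ s Θ i
  eq_hidden : ∀ t ∈ Set.Icc 0 T, ∀ b, ∀ Θ ∈ p.support, ∀ Θ' ∈ p.support,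
    Φ.hidden b Θ Θ' t = v.hidden b Θ Θ' - ∫ s in (0 : ℝ)..t, driftHidden M p Φ s b Θ Θ'
  eq_last : ∀ t ∈ Set.Icc 0 T, ∀ Θ ∈ p.support,
    Φ.last Θ t = v.last Θ - ∫ s in (0 : ℝ)..t, driftLast M p Φ s Θ

/-! ### Initialization and comparison of the two processes -/

/-- The random initial weights `w` are `ε`-independent with respect to the continuous Res-Net
`(v, p)` and the random paths `Θ`: the paths are i.i.d. with law `p`, and `w` is `ε`-close to the
weights that `v` assigns to them. -/
structure IsIndependentInit {d N B m : ℕ} {Ω : Type*} [MeasurableSpace Ω] (P : Measure Ω)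
    (p : Measure (Path d N B)) (v : ContWeights d N B) (Θ : Fin m → Ω → Path d N B)
    (w : Ω → Weights d m B) (ε : ℝ) : Prop where
  meas : ∀ i, Measurable (Θ i)
  law : ∀ i, P.map (Θ i) = p
  indep : iIndepFun Θ P
  close_first : ∀ᵐ ω ∂P, ∀ j : Fin m,
    ‖(fun i : Fin d => w ω (.first i j)) - (Θ j ω).1‖ ≤ (1 + ‖Θ j ω‖) * ε
  close_hidden : ∀ᵐ ω ∂P, ∀ (b : Fin B) (i j : Fin m),
    |w ω (.hidden b i j) - v.hidden b (Θ i ω) (Θ j ω)| ≤ (1 + ‖Θ i ω‖ + ‖Θ j ω‖) * ε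
  close_last : ∀ᵐ ω ∂P, ∀ i : Fin m,
    |w ω (.last i) - v.last (Θ i ω)| ≤ (1 + ‖Θ i ω‖) * ε

/-- The weights, residuals and features of the discrete network `w` and of the ideal process along
the paths `θ` at time `t` differ by at most `r`. -/
structure ProcessesClose {N d m B : ℕ} {Y : Type*} (M : Model N d Y) (Φ : Trajectory d N B)
    (θ : Fin m → Path d N B) (w : Weights d m B) (t r : ℝ) : Prop where
  first : ∀ j : Fin m, ‖(fun i : Fin d => w (.first i j)) - Φ.first (θ j) t‖ ≤ r
  hidden : ∀ (b : Fin B) (i j : Fin m), |w (.hidden b i j) - Φ.hidden b (θ i) (θ j) t| ≤ r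
  last : ∀ i : Fin m, |w (.last i) - Φ.last (θ i) t| ≤ r
  residual : ∀ (b : Fin B) (i : Fin m), ‖residual M w b i - Φ.α b (θ i) t‖ ≤ r
  feature : ∀ (l : Fin (B + 1)) (i : Fin m), ‖feature M w l i - Φ.β l (θ i) t‖ ≤ r

end ResNet

end

/-! ### Uniform constants, layerwise recursions and weighted integrals -/

noncomputable section

namespace ResNet

open Set

/-! The scaled gradients are the backpropagation formulas in which every sum over units is an
average, so gradient descent is an explicit Euler scheme for an ODE whose integrals run over the
uniform measure on the `m` units. The neural feature flow is the same ODE with `p` in place of that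
measure. Both are therefore described by one notion, `State` over a measure space, and the theorem
follows from consistency, stability and a discrete Gronwall argument.

The paths are unbounded, so all errors are measured relative to a weight `s Θ = 1 + ‖Θ‖`.
Sub-Gaussianity of `p` gives `s` a Gaussian moment (`SubGaussian.expWeight`). The stability
estimates use only a second moment of `s`, under `p` and under the empirical measure alike.

A priori bounds come from the layered structure: the activations and the derivative of the loss are
bounded, so the drift of the weights of a layer is controlled by the backward signal above it, and a
downward induction closes without smallness of `T` (`Flow.abs_back_le`). The drifts of residuals and
features are the time derivatives of the forward equations, so a flow that starts at a state
satisfying these equations keeps satisfying them (`BddFlow.forward`). Hence only the weights have to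
be compared: features, outputs and gradients depend on them in a Lipschitz way
(`State.forward_stability`, `State.back_stability`, `State.grad_stability`).

Randomness enters at a single point. The flow is deterministic and the paths are i.i.d., so at a
fixed time the averages of the flow's own quantities over the sampled paths are sums of independent
variables, up to one diagonal term; the trained weights never enter the concentration argument. A
union bound over units, data and a time grid of mesh `ε` yields a good sample with high probability
(`BddFlow.measure_not_goodSample_le`), and Lipschitz continuity in time covers the remaining times.
On a good sample the comparison is deterministic: `compare_net` bounds the difference of the
gradients, `BddFlow.step_close` treats one step, and `BddFlow.gd_close` iterates it. The bound `s ^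
2 ≤ R` on the sampled paths, with `R` logarithmic, finally turns weighted errors into uniform ones.
-/

/-- All the bounds on the data, the activation functions and the loss, with one constant. -/
structure Model.Tame {N d : ℕ} {Y : Type*} (M : Model N d Y) (c : ℝ) : Prop where
  one_le : 1 ≤ c
  X_le : ∀ n i, |M.X n i| ≤ c
  diff_h₁ : Differentiable ℝ M.h₁
  diff_h₂ : Differentiable ℝ M.h₂
  diff_φ : ∀ y, Differentiable ℝ (fun x => M.φ x y)
  h₁_le : ∀ x, |M.h₁ x| ≤ c
  dh₁_le : ∀ x, |deriv M.h₁ x| ≤ c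
  dh₂_le : ∀ x, |deriv M.h₂ x| ≤ c
  dφ_le : ∀ n x, |M.dφ n x| ≤ c
  h₁_lip : ∀ x z, |M.h₁ x - M.h₁ z| ≤ c * |x - z|
  h₂_lip : ∀ x z, |M.h₂ x - M.h₂ z| ≤ c * |x - z|
  dh₁_lip : ∀ x z, |deriv M.h₁ x - deriv M.h₁ z| ≤ c * |x - z|
  dh₂_lip : ∀ x z, |deriv M.h₂ x - deriv M.h₂ z| ≤ c * |x - z|
  dφ_lip : ∀ n x z, |M.dφ n x - M.dφ n z| ≤ c * |x - z|
  φ_lip : ∀ y x z, |M.φ x y - M.φ z y| ≤ c * |x - z|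

theorem lipschitz_of_deriv_le {f : ℝ → ℝ} {c : ℝ} (hf : Differentiable ℝ f)
    (h : ∀ x, |deriv f x| ≤ c) (x z : ℝ) : |f x - f z| ≤ c * |x - z| := by
  have := Convex.norm_image_sub_le_of_norm_deriv_le (f := f) (s := univ) (C := c) (x := z) (y := x)
    (fun x _ => hf x) (fun x _ => h x) convex_univ (mem_univ _) (mem_univ _)
  simpa using this

section Tame

variable {N d : ℕ} {Y : Type*} {M : Model N d Y} {c c' : ℝ}

theorem Model.Regular.tame {L₁ L₂ L₃ L₄ L₅ Cx : ℝ} (h : M.Regular L₁ L₂ L₃ L₄ L₅)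
    (hX : ∀ n i, |M.X n i| ≤ Cx) (hc : 1 ≤ c) (h1 : L₁ ≤ c) (h2 : L₂ ≤ c) (h3 : L₃ ≤ c)
    (h4 : L₄ ≤ c) (h5 : L₅ ≤ c) (hx : Cx ≤ c) : M.Tame c where
  one_le := hc
  X_le n i := (hX n i).trans hx
  diff_h₁ := h.diff_h₁
  diff_h₂ := h.diff_h₂
  diff_φ := h.diff_φ
  h₁_le x := (h.bound_h₁ x).trans h1
  dh₁_le x := (h.bound_deriv_h₁ x).trans h2
  dh₂_le x := (h.bound_deriv_h₂ x).trans h2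
  dφ_le n x := (h.bound_deriv_φ _ x).trans h4
  h₁_lip := lipschitz_of_deriv_le h.diff_h₁ fun x => (h.bound_deriv_h₁ x).trans h2
  h₂_lip := lipschitz_of_deriv_le h.diff_h₂ fun x => (h.bound_deriv_h₂ x).trans h2
  dh₁_lip x z := (h.lip_deriv_h₁ x z).trans (by gcongr)
  dh₂_lip x z := (h.lip_deriv_h₂ x z).trans (by gcongr)
  dφ_lip n x z := (h.lip_deriv_φ _ x z).trans (by gcongr)
  φ_lip y := lipschitz_of_deriv_le (h.diff_φ y) fun x => (h.bound_deriv_φ y x).trans h4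

theorem Model.Tame.mono (h : M.Tame c) (hc : c ≤ c') : M.Tame c' where
  one_le := h.one_le.trans hc
  X_le n i := (h.X_le n i).trans hc
  diff_h₁ := h.diff_h₁
  diff_h₂ := h.diff_h₂
  diff_φ := h.diff_φ
  h₁_le x := (h.h₁_le x).trans hc
  dh₁_le x := (h.dh₁_le x).trans hc
  dh₂_le x := (h.dh₂_le x).trans hc
  dφ_le n x := (h.dφ_le n x).trans hc
  h₁_lip x z := (h.h₁_lip x z).trans (by gcongr)
  h₂_lip x z := (h.h₂_lip x z).trans (by gcongr)
  dh₁_lip x z := (h.dh₁_lip x z).trans (by gcongr)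
  dh₂_lip x z := (h.dh₂_lip x z).trans (by gcongr)
  dφ_lip n x z := (h.dφ_lip n x z).trans (by gcongr)
  φ_lip n x z := (h.φ_lip n x z).trans (by gcongr)

theorem Model.Tame.continuous_h₁ (h : M.Tame c) : Continuous M.h₁ := h.diff_h₁.continuous

theorem Model.Tame.continuous_h₂ (h : M.Tame c) : Continuous M.h₂ := h.diff_h₂.continuous

theorem continuous_of_lipschitz {f : ℝ → ℝ} (h : ∀ x z, |f x - f z| ≤ c * |x - z|) :
    Continuous f := by
  have : LipschitzWith (Real.toNNReal |c|) f := LipschitzWith.of_dist_le_mul fun x z => by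
    rw [Real.coe_toNNReal _ (abs_nonneg c)]
    exact (h x z).trans (by gcongr; exacts [le_abs_self c, le_refl _])
  exact this.continuous

theorem Model.Tame.continuous_dh₁ (h : M.Tame c) : Continuous (deriv M.h₁) :=
  continuous_of_lipschitz h.dh₁_lip

theorem Model.Tame.continuous_dh₂ (h : M.Tame c) : Continuous (deriv M.h₂) :=
  continuous_of_lipschitz h.dh₂_lip

theorem Model.Tame.continuous_dφ (h : M.Tame c) (n : Fin N) : Continuous (M.dφ n) :=
  continuous_of_lipschitz (h.dφ_lip n)

end Tame

/-! ### Averages and layerwise recursions -/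

theorem abs_mean_le {N : ℕ} {f : Fin N → ℝ} {k : ℝ} (hk : 0 ≤ k) (h : ∀ n, |f n| ≤ k) :
    |1 / (N : ℝ) * ∑ n, f n| ≤ k := by
  rcases Nat.eq_zero_or_pos N with rfl | hN
  · simpa using hk
  have hN' : (0 : ℝ) < N := by exact_mod_cast hN
  rw [abs_mul, abs_of_pos (by positivity : (0 : ℝ) < 1 / N)]
  calc 1 / (N : ℝ) * |∑ n, f n| ≤ 1 / (N : ℝ) * ∑ n : Fin N, k := by
        gcongr
        exact (Finset.abs_sum_le_sum_abs _ _).trans (Finset.sum_le_sum fun n _ => h n)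
    _ = k := by simp; field_simp

theorem abs_mean_sub_le {N : ℕ} {f g : Fin N → ℝ} {k : ℝ} (hk : 0 ≤ k)
    (h : ∀ n, |f n - g n| ≤ k) :
    |1 / (N : ℝ) * ∑ n, f n - 1 / (N : ℝ) * ∑ n, g n| ≤ k := by
  rw [← mul_sub, ← Finset.sum_sub_distrib]
  exact abs_mean_le hk h

theorem le_iterate {F : ℝ → ℝ} (hF : ∀ c, 1 ≤ c → c ≤ F c) {a : ℝ} (ha : 1 ≤ a) (k : ℕ) :
    1 ≤ F^[k] a := by
  induction k with
  | zero => simpa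
  | succ k ih =>
    rw [Function.iterate_succ_apply']
    exact ih.trans (hF _ ih)

theorem iterate_mono {F : ℝ → ℝ} (hF : ∀ c, 1 ≤ c → c ≤ F c) {a : ℝ} (ha : 1 ≤ a) {j k : ℕ}
    (hjk : j ≤ k) : F^[j] a ≤ F^[k] a := by
  induction k, hjk using Nat.le_induction with
  | base => rfl
  | succ k _ ih =>
    rw [Function.iterate_succ_apply']
    exact ih.trans (hF _ (le_iterate hF ha k))

/-- Bounds propagate upwards through the layers. -/
theorem layer_induction {B : ℕ} {F : ℝ → ℝ} (hF : ∀ c, 1 ≤ c → c ≤ F c) {a : ℝ} (ha : 1 ≤ a)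
    {P : Fin (B + 1) → ℝ → Prop} (mono : ∀ l c c', c ≤ c' → P l c → P l c') (zero : P 0 a)
    (step : ∀ (b : Fin B) c, 1 ≤ c → P b.castSucc c → P b.succ (F c)) (l : Fin (B + 1)) :
    P l (F^[B] a) := by
  have key : ∀ l : Fin (B + 1), P l (F^[l.val] a) := by
    intro l
    induction l using Fin.induction with
    | zero => simpa
    | succ b ih =>
      have := step b _ (le_iterate hF ha _) ih
      rw [← Function.iterate_succ_apply' F] at this
      simpa using this
  exact mono l _ _ (iterate_mono hF ha (by omega)) (key l)

/-- Bounds propagate downwards through the layers. -/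
theorem layer_reverse_induction {B : ℕ} {F : ℝ → ℝ} (hF : ∀ c, 1 ≤ c → c ≤ F c) {a : ℝ}
    (ha : 1 ≤ a) {P : Fin (B + 1) → ℝ → Prop} (mono : ∀ l c c', c ≤ c' → P l c → P l c')
    (last : P (Fin.last B) a)
    (step : ∀ (b : Fin B) c, 1 ≤ c → P b.succ c → P b.castSucc (F c)) (l : Fin (B + 1)) :
    P l (F^[B] a) := by
  have key : ∀ l : Fin (B + 1), P l (F^[B - l.val] a) := by
    intro l
    induction l using Fin.reverseInduction with
    | last => simpa
    | cast b ih =>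
      have := step b _ (le_iterate hF ha _) ih
      rw [← Function.iterate_succ_apply' F] at this
      have e : (B - (b.succ : Fin (B + 1)).val).succ = B - (b.castSucc : Fin (B + 1)).val := by
        have := b.isLt
        simp
        omega
      rwa [e] at this
  exact mono l _ _ (iterate_mono hF ha (by omega)) (key l)

/-! ### Products -/

theorem abs_mul_le_mul {x y a b : ℝ} (hx : |x| ≤ a) (hy : |y| ≤ b) : |x * y| ≤ a * b := by
  rw [abs_mul]
  exact mul_le_mul hx hy (abs_nonneg _) ((abs_nonneg _).trans hx)

theorem abs_mul_sub_mul_le {x x' y y' a b a' b' : ℝ} (hx : |x - x'| ≤ a) (hy : |y| ≤ b)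
    (hx' : |x'| ≤ a') (hy' : |y - y'| ≤ b') : |x * y - x' * y'| ≤ a * b + a' * b' := by
  have : x * y - x' * y' = (x - x') * y + x' * (y - y') := by ring
  rw [this]
  exact (abs_add_le _ _).trans (add_le_add (abs_mul_le_mul hx hy) (abs_mul_le_mul hx' hy'))

/-! ### Weights -/

section Weight

variable {S : Type*} [MeasurableSpace S] {μ : Measure S} {s : S → ℝ} {c : ℝ}

/-- `s ≥ 1` is a weight function with second moment at most `c` under the probability `μ`. -/
structure IsWeight (μ : Measure S) (s : S → ℝ) (c : ℝ) : Prop where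
  meas : Measurable s
  one_le : ∀ x, 1 ≤ s x
  integrable_sq : Integrable (fun x => s x ^ 2) μ
  sq_le : ∫ x, s x ^ 2 ∂μ ≤ c

theorem IsWeight.mono (h : IsWeight μ s c) {c' : ℝ} (hc : c ≤ c') : IsWeight μ s c' :=
  { h with sq_le := h.sq_le.trans hc }

theorem IsWeight.pos (h : IsWeight μ s c) (x : S) : 0 < s x := zero_lt_one.trans_le (h.one_le x)

theorem IsWeight.le_sq (h : IsWeight μ s c) (x : S) : s x ≤ s x ^ 2 := by
  nlinarith [h.one_le x]

theorem IsWeight.one_le_sq (h : IsWeight μ s c) (x : S) : 1 ≤ s x ^ 2 := by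
  nlinarith [h.one_le x]

theorem IsWeight.integrable (h : IsWeight μ s c) {f : S → ℝ} {k : ℝ}
    (hf : AEStronglyMeasurable f μ) (hk : ∀ x, |f x| ≤ k * s x ^ 2) : Integrable f μ :=
  (h.integrable_sq.const_mul k).mono' hf (Filter.Eventually.of_forall hk)

theorem IsWeight.abs_integral_le (h : IsWeight μ s c) {f : S → ℝ} {k : ℝ} (k0 : 0 ≤ k)
    (hk : ∀ x, |f x| ≤ k * s x ^ 2) : |∫ x, f x ∂μ| ≤ k * c := by
  have := norm_integral_le_of_norm_le (f := f) (h.integrable_sq.const_mul k)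
    (Filter.Eventually.of_forall hk)
  rw [integral_const_mul] at this
  exact this.trans (by gcongr; exact h.sq_le)

/-- Integrability of `f` is recovered by adding `f'` to the difference. This is what lets the
stability estimates assume bounds on the reference state only. -/
theorem IsWeight.abs_integral_sub_le (h : IsWeight μ s c) {f f' : S → ℝ} {k k' : ℝ} (k0 : 0 ≤ k)
    (hf : AEStronglyMeasurable f μ) (hf' : AEStronglyMeasurable f' μ)
    (hk : ∀ x, |f x - f' x| ≤ k * s x ^ 2) (hk' : ∀ x, |f' x| ≤ k' * s x ^ 2) :
    |∫ x, f x ∂μ - ∫ x, f' x ∂μ| ≤ k * c := by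
  have i' := h.integrable hf' hk'
  have i : Integrable f μ := by
    have := (h.integrable (hf.sub hf') hk).add i'
    simpa using this
  rw [← integral_sub i i']
  exact h.abs_integral_le k0 hk

theorem IsWeight.continuousOn_integral (h : IsWeight μ s c) {F : ℝ → S → ℝ} {k : ℝ} {I : Set ℝ}
    (hF : ∀ t ∈ I, AEStronglyMeasurable (F t) μ) (hk : ∀ t ∈ I, ∀ x, |F t x| ≤ k * s x ^ 2)
    (hc : ∀ x, ContinuousOn (fun t => F t x) I) : ContinuousOn (fun t => ∫ x, F t x ∂μ) I :=
  continuousOn_of_dominated hF (fun t ht => Filter.Eventually.of_forall (hk t ht))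
    (h.integrable_sq.const_mul k) (Filter.Eventually.of_forall hc)

end Weight

end ResNet

end


/-! ### Forward and backward propagation over an arbitrary measure space of units -/

noncomputable section

namespace ResNet

open Set

/-- Weights, residuals and features of a Res-Net whose hidden units are labelled by `S`. -/
structure State (N d B : ℕ) (S : Type*) where
  first : S → Fin d → ℝ
  hidden : Fin B → S → S → ℝ
  last : S → ℝ
  α : Fin B → S → Fin N → ℝ
  β : Fin (B + 1) → S → Fin N → ℝ

namespace State

/-- The state obtained by relabelling the units. -/
def comap {N d B : ℕ} {S S' : Type*} (X : State N d B S) (θ : S' → S) : State N d B S' where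
  first i := X.first (θ i)
  hidden b i j := X.hidden b (θ i) (θ j)
  last i := X.last (θ i)
  α b i := X.α b (θ i)
  β l i := X.β l (θ i)

section Defs

variable {N d B : ℕ} {Y S : Type*} [MeasurableSpace S] (M : Model N d Y) (μ : Measure S)
  (X : State N d B S)

/-- The output of a state. -/
def out (n : Fin N) : ℝ := ∫ x, X.last x * M.h₁ (X.β (Fin.last B) x n) ∂μ

/-- Backward propagation to the features. -/
def back : Fin (B + 1) → S → Fin N → ℝ :=
  Fin.reverseInduction (motive := fun _ => S → Fin N → ℝ)
    (fun x n => X.last x * M.dφ n (X.out M μ n) * deriv M.h₁ (X.β (Fin.last B) x n))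
    (fun b D x n => D x n
      + (∫ y, X.hidden b x y * (D y n * deriv M.h₂ (X.α b y n)) ∂μ)
        * deriv M.h₁ (X.β b.castSucc x n))

/-- Backward propagation to the residuals. -/
def backα (b : Fin B) (x : S) (n : Fin N) : ℝ :=
  X.back M μ b.succ x n * deriv M.h₂ (X.α b x n)

/-- Scaled gradient with respect to the last-layer weights. -/
def gradLast (x : S) : ℝ :=
  (1 / (N : ℝ)) * ∑ n, M.dφ n (X.out M μ n) * M.h₁ (X.β (Fin.last B) x n)

/-- Scaled gradient with respect to the hidden weights. -/
def gradHidden (b : Fin B) (x y : S) : ℝ :=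
  (1 / (N : ℝ)) * ∑ n, X.backα M μ b y n * M.h₁ (X.β b.castSucc x n)

/-- Scaled gradient with respect to the first-layer weights. -/
def gradFirst (x : S) (i : Fin d) : ℝ :=
  (1 / (N : ℝ)) * ∑ n, M.X n i * X.back M μ 0 x n

/-- Drift of the residuals, given the drift `g` of the features of the layer below. -/
def driftαFrom (b : Fin B) (g : S → Fin N → ℝ) (x : S) (n : Fin N) : ℝ :=
  (∫ y, X.hidden b y x * (deriv M.h₁ (X.β b.castSucc y n) * g y n) ∂μ)
    + ∫ y, M.h₁ (X.β b.castSucc y n) * X.gradHidden M μ b y x ∂μ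

/-- Drift of the features. -/
def driftβ : Fin (B + 1) → S → Fin N → ℝ :=
  Fin.induction (motive := fun _ => S → Fin N → ℝ)
    (fun x n => (1 / (d : ℝ)) * ∑ i, M.X n i * X.gradFirst M μ x i)
    (fun b g x n => g x n + X.driftαFrom M μ b g x n * deriv M.h₂ (X.α b x n))

/-- Drift of the residuals. -/
def driftα (b : Fin B) : S → Fin N → ℝ := X.driftαFrom M μ b (X.driftβ M μ b.castSucc)

theorem back_last (x : S) (n : Fin N) : X.back M μ (Fin.last B) x n
    = X.last x * M.dφ n (X.out M μ n) * deriv M.h₁ (X.β (Fin.last B) x n) := by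
  simp [back]

theorem back_castSucc (b : Fin B) (x : S) (n : Fin N) : X.back M μ b.castSucc x n
    = X.back M μ b.succ x n + (∫ y, X.hidden b x y * X.backα M μ b y n ∂μ)
        * deriv M.h₁ (X.β b.castSucc x n) := by
  simp [back, backα]

theorem driftβ_zero (x : S) (n : Fin N) : X.driftβ M μ 0 x n
    = (1 / (d : ℝ)) * ∑ i, M.X n i * X.gradFirst M μ x i := by
  simp [driftβ]

theorem driftβ_succ (b : Fin B) (x : S) (n : Fin N) : X.driftβ M μ b.succ x n
    = X.driftβ M μ b.castSucc x n + X.driftα M μ b x n * deriv M.h₂ (X.α b x n) := by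
  simp [driftβ, driftα]

end Defs

/-! ### Measurability -/

/-- All components of the state are measurable. -/
structure Meas {N d B : ℕ} {S : Type*} [MeasurableSpace S] (X : State N d B S) : Prop where
  first : ∀ i, Measurable fun x => X.first x i
  hidden : ∀ b, Measurable fun q : S × S => X.hidden b q.1 q.2
  last : Measurable X.last
  α : ∀ b n, Measurable fun x => X.α b x n
  β : ∀ l n, Measurable fun x => X.β l x n

section Meas

variable {N d B : ℕ} {Y S : Type*} [MeasurableSpace S] {M : Model N d Y} {μ : Measure S}
  {X : State N d B S} {c : ℝ}

theorem Meas.h₁ (hX : X.Meas) (hM : M.Tame c) (l : Fin (B + 1)) (n : Fin N) :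
    Measurable fun x => M.h₁ (X.β l x n) := hM.continuous_h₁.measurable.comp (hX.β l n)

theorem Meas.dh₁ (hX : X.Meas) (hM : M.Tame c) (l : Fin (B + 1)) (n : Fin N) :
    Measurable fun x => deriv M.h₁ (X.β l x n) := hM.continuous_dh₁.measurable.comp (hX.β l n)

theorem Meas.dh₂ (hX : X.Meas) (hM : M.Tame c) (b : Fin B) (n : Fin N) :
    Measurable fun x => deriv M.h₂ (X.α b x n) := hM.continuous_dh₂.measurable.comp (hX.α b n)

theorem Meas.hidden_left (hX : X.Meas) (b : Fin B) (x : S) : Measurable fun y => X.hidden b x y :=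
  (hX.hidden b).comp measurable_prodMk_left

theorem Meas.hidden_right (hX : X.Meas) (b : Fin B) (x : S) : Measurable fun y => X.hidden b y x :=
  (hX.hidden b).comp measurable_prodMk_right

theorem measurable_integral_mul [SFinite μ] {k : S → S → ℝ} {g : S → ℝ}
    (hk : Measurable fun q : S × S => k q.1 q.2) (hg : Measurable g) :
    Measurable fun x => ∫ y, k x y * g y ∂μ :=
  (StronglyMeasurable.integral_prod_right (ν := μ) (f := fun x y => k x y * g y)
    (hk.mul (hg.comp measurable_snd)).stronglyMeasurable).measurable

theorem Meas.back [SFinite μ] (hX : X.Meas) (hM : M.Tame c) (l : Fin (B + 1)) (n : Fin N) :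
    Measurable fun x => X.back M μ l x n := by
  induction l using Fin.reverseInduction with
  | last =>
    simp only [back_last]
    exact (hX.last.mul_const _).mul (hX.dh₁ hM _ _)
  | cast b ih =>
    simp only [back_castSucc]
    exact ih.add ((measurable_integral_mul (hX.hidden b) (ih.mul (hX.dh₂ hM b n))).mul
      (hX.dh₁ hM _ _))

theorem Meas.backα [SFinite μ] (hX : X.Meas) (hM : M.Tame c) (b : Fin B) (n : Fin N) :
    Measurable fun x => X.backα M μ b x n := (hX.back hM _ n).mul (hX.dh₂ hM b n)

theorem Meas.gradHidden [SFinite μ] (hX : X.Meas) (hM : M.Tame c) (b : Fin B) :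
    Measurable fun q : S × S => X.gradHidden M μ b q.1 q.2 := by
  unfold State.gradHidden
  refine Measurable.const_mul (Finset.measurable_fun_sum _ fun n _ => ?_) _
  exact ((hX.backα hM b n).comp measurable_snd).mul ((hX.h₁ hM _ n).comp measurable_fst)

theorem Meas.gradFirst [SFinite μ] (hX : X.Meas) (hM : M.Tame c) (i : Fin d) :
    Measurable fun x => X.gradFirst M μ x i :=
  (Finset.measurable_fun_sum _ fun n _ => (hX.back hM 0 n).const_mul _).const_mul _

theorem Meas.driftαFrom [SFinite μ] (hX : X.Meas) (hM : M.Tame c) (b : Fin B)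
    {g : S → Fin N → ℝ} (n : Fin N) (hg : Measurable fun x => g x n) :
    Measurable fun x => X.driftαFrom M μ b g x n := by
  refine Measurable.add ?_ ?_
  · exact measurable_integral_mul (k := fun x y => X.hidden b y x)
      ((hX.hidden b).comp measurable_swap) ((hX.dh₁ hM _ n).mul hg)
  · have := measurable_integral_mul (μ := μ) (k := fun x y => X.gradHidden M μ b y x)
      ((hX.gradHidden hM b).comp measurable_swap) (hX.h₁ hM b.castSucc n)
    simpa only [mul_comm] using this

theorem Meas.driftβ [SFinite μ] (hX : X.Meas) (hM : M.Tame c) (l : Fin (B + 1)) (n : Fin N) :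
    Measurable fun x => X.driftβ M μ l x n := by
  induction l using Fin.induction with
  | zero =>
    simp only [driftβ_zero]
    exact (Finset.measurable_fun_sum _ fun i _ => (hX.gradFirst hM i).const_mul _).const_mul _
  | succ b ih =>
    simp only [driftβ_succ]
    exact ih.add ((hX.driftαFrom hM b n ih).mul (hX.dh₂ hM b n))

end Meas

/-! ### Stability of forward and backward propagation -/

/-- The weights of two states differ by at most `e`, relative to the weight function `s`. -/
structure WeightsClose {N d B : ℕ} {S : Type*} (s : S → ℝ) (e : ℝ) (X X' : State N d B S) :
    Prop where
  first : ∀ x i, |X.first x i - X'.first x i| ≤ e * s x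
  hidden : ∀ b x y, |X.hidden b x y - X'.hidden b x y| ≤ e * (s x + s y)
  last : ∀ x, |X.last x - X'.last x| ≤ e * s x

/-- The residuals and features of two states differ by at most `e`, relative to `s`. -/
structure FeaturesClose {N d B : ℕ} {S : Type*} (s : S → ℝ) (e : ℝ) (X X' : State N d B S) :
    Prop where
  α : ∀ b x n, |X.α b x n - X'.α b x n| ≤ e * s x
  β : ∀ l x n, |X.β l x n - X'.β l x n| ≤ e * s x

theorem WeightsClose.mono {N d B : ℕ} {S : Type*} {s : S → ℝ} {e e' : ℝ} {X X' : State N d B S}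
    (h : WeightsClose s e X X') (hs : ∀ x, 0 ≤ s x) (he : e ≤ e') : WeightsClose s e' X X' where
  first x i := (h.first x i).trans (mul_le_mul_of_nonneg_right he (hs x))
  hidden b x y := (h.hidden b x y).trans
    (mul_le_mul_of_nonneg_right he (add_nonneg (hs x) (hs y)))
  last x := (h.last x).trans (mul_le_mul_of_nonneg_right he (hs x))

theorem FeaturesClose.mono {N d B : ℕ} {S : Type*} {s : S → ℝ} {e e' : ℝ} {X X' : State N d B S}
    (h : FeaturesClose s e X X') (hs : ∀ x, 0 ≤ s x) (he : e ≤ e') : FeaturesClose s e' X X' where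
  α b x n := (h.α b x n).trans (mul_le_mul_of_nonneg_right he (hs x))
  β l x n := (h.β l x n).trans (mul_le_mul_of_nonneg_right he (hs x))

theorem WeightsClose.trans {N d B : ℕ} {S : Type*} {s : S → ℝ} {e e' : ℝ}
    {X X' X'' : State N d B S} (h : WeightsClose s e X X') (h' : WeightsClose s e' X' X'') :
    WeightsClose s (e + e') X X'' where
  first x i := (abs_sub_le _ _ _).trans
    ((add_le_add (h.first x i) (h'.first x i)).trans_eq (by ring))
  hidden b x y := (abs_sub_le _ _ _).trans
    ((add_le_add (h.hidden b x y) (h'.hidden b x y)).trans_eq (by ring))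
  last x := (abs_sub_le _ _ _).trans ((add_le_add (h.last x) (h'.last x)).trans_eq (by ring))

theorem FeaturesClose.trans {N d B : ℕ} {S : Type*} {s : S → ℝ} {e e' : ℝ}
    {X X' X'' : State N d B S} (h : FeaturesClose s e X X') (h' : FeaturesClose s e' X' X'') :
    FeaturesClose s (e + e') X X'' where
  α b x n := (abs_sub_le _ _ _).trans
    ((add_le_add (h.α b x n) (h'.α b x n)).trans_eq (by ring))
  β l x n := (abs_sub_le _ _ _).trans
    ((add_le_add (h.β l x n) (h'.β l x n)).trans_eq (by ring))

/-- The output-layer and hidden weights are bounded by `c`, relative to the weight of the target. -/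
structure Bdd {N d B : ℕ} {S : Type*} (X : State N d B S) (s : S → ℝ) (c : ℝ) : Prop where
  last : ∀ x, |X.last x| ≤ c
  hidden : ∀ b x y, |X.hidden b x y| ≤ c * s y

section Stability

variable {N d B : ℕ} {Y S : Type*} [MeasurableSpace S] {M : Model N d Y} {μ : Measure S}
  {X X' : State N d B S} {s : S → ℝ} {c e : ℝ}

/-- Splitting the difference of products so that the unperturbed factor is `X'.last` or the bounded
activation makes any bound on `X` itself superfluous. In the comparison `X` is the trained network,
for which no bound is known beforehand. -/
theorem out_stability (hM : M.Tame c) (hs : IsWeight μ s c) (he : 0 ≤ e)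
    (hX : X.Meas) (hX' : X'.Meas) (hb : X'.Bdd s c)
    (hw : ∀ x, |X.last x - X'.last x| ≤ e * s x)
    (hf : ∀ x n, |X.β (Fin.last B) x n - X'.β (Fin.last B) x n| ≤ e * s x) (n : Fin N) :
    |X.out M μ n - X'.out M μ n| ≤ 2 * c ^ 3 * e := by
  have c1 := hM.one_le
  have key := hs.abs_integral_sub_le (k := 2 * c ^ 2 * e) (k' := c * c) (by positivity)
    (hX.last.mul (hX.h₁ hM (Fin.last B) n)).aestronglyMeasurable
    (hX'.last.mul (hX'.h₁ hM (Fin.last B) n)).aestronglyMeasurable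
    (fun x => by
      have h1 := abs_mul_sub_mul_le (hw x) (hM.h₁_le (X.β (Fin.last B) x n)) (hb.last x)
        ((hM.h₁_lip (X.β (Fin.last B) x n) (X'.β (Fin.last B) x n)).trans
          (mul_le_mul_of_nonneg_left (hf x n) (by positivity)))
      refine h1.trans ?_
      have h2 := hs.le_sq x
      have h3 := hs.pos x
      calc e * s x * c + c * (c * (e * s x)) = (c + c ^ 2) * e * s x := by ring
        _ ≤ (c ^ 2 + c ^ 2) * e * s x ^ 2 := by gcongr; nlinarith
        _ = _ := by ring)
    (fun x => by
      refine (abs_mul_le_mul (hb.last x) (hM.h₁_le _)).trans ?_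
      exact le_mul_of_one_le_right (by positivity) (hs.one_le_sq x))
  refine key.trans_eq ?_
  ring

/-- Forward propagation is stable: `X'` solves the forward equations up to the error `e`. -/
theorem forward_stability (hM : M.Tame c) (hs : IsWeight μ s c) (he : 0 ≤ e)
    (hX : X.Meas) (hX' : X'.Meas) (hb : X'.Bdd s c) (hw : WeightsClose s e X X')
    (zero : ∀ x n, X.β 0 x n = 1 / (d : ℝ) * ∑ i, M.X n i * X.first x i)
    (succ : ∀ (b : Fin B) x n, X.β b.succ x n = M.h₂ (X.α b x n) + X.β b.castSucc x n)
    (res : ∀ b x n, X.α b x n = ∫ y, X.hidden b y x * M.h₁ (X.β b.castSucc y n) ∂μ)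
    (zero' : ∀ x n, X'.β 0 x n = 1 / (d : ℝ) * ∑ i, M.X n i * X'.first x i)
    (succ' : ∀ (b : Fin B) x n, X'.β b.succ x n = M.h₂ (X'.α b x n) + X'.β b.castSucc x n)
    (res' : ∀ b x n,
      |X'.α b x n - ∫ y, X'.hidden b y x * M.h₁ (X'.β b.castSucc y n) ∂μ| ≤ e * s x) :
    FeaturesClose s ((fun k => 5 * c ^ 4 * k)^[B + 1] c * e) X X' := by
  have c1 := hM.one_le
  have c2 : c ≤ c ^ 4 := le_self_pow₀ c1 (by norm_num)
  have hF : ∀ k : ℝ, 1 ≤ k → k ≤ 5 * c ^ 4 * k := fun k hk => by nlinarith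
  -- Here `k` is the feature error in units of `e * s x`. The residual error is then `4 * c ^ 3 *
  -- k`, the activation costs another `c`, and the skip connection adds `k`: hence the factor `5 * c
  -- ^ 4` per layer.
  have resid : ∀ (b : Fin B) k, 1 ≤ k →
      (∀ x n, |X.β b.castSucc x n - X'.β b.castSucc x n| ≤ k * e * s x) →
      ∀ x n, |X.α b x n - X'.α b x n| ≤ 4 * c ^ 3 * k * e * s x := by
    intro b k hk ih x n
    have hsx := hs.pos x
    have key := hs.abs_integral_sub_le (k := 3 * c ^ 2 * k * e * s x) (k' := c * s x * c)
      (by positivity)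
      ((hX.hidden_right b x).mul (hX.h₁ hM b.castSucc n)).aestronglyMeasurable
      ((hX'.hidden_right b x).mul (hX'.h₁ hM b.castSucc n)).aestronglyMeasurable
      (fun y => by
        have h1 := abs_mul_sub_mul_le (hw.hidden b y x) (hM.h₁_le (X.β b.castSucc y n))
          (hb.hidden b y x) ((hM.h₁_lip (X.β b.castSucc y n) (X'.β b.castSucc y n)).trans
            (mul_le_mul_of_nonneg_left (ih y n) (by positivity)))
        refine h1.trans ?_
        have h2 := hs.le_sq y
        have h3 := hs.one_le y
        have h4 := hs.one_le x
        -- Both weights are at least one, so their sum is dominated by their product and `s x` can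
        -- be pulled out of the integral.
        have h5 : s y + s x ≤ 2 * (s x * s y) := by nlinarith
        calc e * (s y + s x) * c + c * s x * (c * (k * e * s y))
            ≤ e * (2 * (s x * s y)) * c + c * s x * (c * (k * e * s y)) := by gcongr
          _ = (2 * c + c ^ 2 * k) * e * s x * s y := by ring
          _ ≤ (2 * (c ^ 2 * k) + c ^ 2 * k) * e * s x * s y ^ 2 := by
            gcongr
            nlinarith [mul_le_mul c1 hk (by norm_num) (by positivity)]
          _ = _ := by ring)
      (fun y => by
        refine (abs_mul_le_mul (hb.hidden b y x) (hM.h₁_le _)).trans ?_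
        exact le_mul_of_one_le_right (by positivity) (hs.one_le_sq y))
    have h6 := abs_sub_le (X.α b x n)
      (∫ y, X'.hidden b y x * M.h₁ (X'.β b.castSucc y n) ∂μ) (X'.α b x n)
    have h7 := res' b x n
    rw [abs_sub_comm] at h7
    rw [res b x n] at h6 ⊢
    refine h6.trans ((add_le_add key h7).trans ?_)
    have : e * s x ≤ c ^ 3 * k * (e * s x) :=
      le_mul_of_one_le_left (by positivity) (one_le_mul_of_one_le_of_one_le (one_le_pow₀ c1) hk)
    nlinarith
  have feat : ∀ l x n,
      |X.β l x n - X'.β l x n| ≤ ((fun k => 5 * c ^ 4 * k)^[B] c * e) * s x := by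
    intro l
    refine layer_induction hF c1
      (P := fun l k => ∀ x n, |X.β l x n - X'.β l x n| ≤ k * e * s x) ?_ ?_ ?_ l
    · intro l k k' hk h x n
      have := hs.pos x
      exact (h x n).trans (by gcongr)
    · intro x n
      have hsx := hs.pos x
      rw [zero, zero']
      refine abs_mean_sub_le (by positivity) fun i => ?_
      rw [← mul_sub]
      exact (abs_mul_le_mul (hM.X_le n i) (hw.first x i)).trans_eq (by ring)
    · intro b k hk ih x n
      have hsx := hs.pos x
      rw [succ, succ']
      have h1 := (hM.h₂_lip (X.α b x n) (X'.α b x n)).trans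
        (mul_le_mul_of_nonneg_left (resid b k hk ih x n) (by positivity))
      have h2 := ih x n
      have h3 := abs_add_le (M.h₂ (X.α b x n) - M.h₂ (X'.α b x n))
        (X.β b.castSucc x n - X'.β b.castSucc x n)
      rw [add_sub_add_comm]
      have h4 : k * e * s x ≤ c ^ 4 * (k * e * s x) :=
        le_mul_of_one_le_left (by positivity) (one_le_pow₀ c1)
      nlinarith
  have K1 := le_iterate hF c1 B
  -- The features need only `B` iterates; the extra one absorbs the factor `4 * c ^ 3` for the
  -- residuals.
  have e1 : (fun k : ℝ => 5 * c ^ 4 * k)^[B + 1] c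
      = 5 * c ^ 4 * (fun k : ℝ => 5 * c ^ 4 * k)^[B] c :=
    Function.iterate_succ_apply' _ _ _
  refine ⟨fun b x n => ?_, fun l x n => ?_⟩
  · have hsx := hs.pos x
    refine (resid b _ K1 (fun x n => feat b.castSucc x n) x n).trans ?_
    rw [e1]
    gcongr <;> norm_num [c1]
  · have hsx := hs.pos x
    refine (feat l x n).trans ?_
    gcongr
    exact iterate_mono hF c1 (Nat.le_succ B)

/-- Backward propagation is stable: `D` solves the backward equations of `X'` up to the error
`e`. -/
theorem back_stability [SFinite μ] (hM : M.Tame c) (hs : IsWeight μ s c) (he : 0 ≤ e) (he1 : e ≤ 1)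
    (hX : X.Meas) (hX' : X'.Meas) (hb : X'.Bdd s c) (hw : WeightsClose s e X X')
    (hf : FeaturesClose s e X X') {o : Fin N → ℝ} (ho : ∀ n, |X.out M μ n - o n| ≤ e)
    {D : Fin (B + 1) → S → Fin N → ℝ} (hDm : ∀ l n, Measurable fun x => D l x n)
    (hDb : ∀ l x n, |D l x n| ≤ c)
    (last : ∀ x n, D (Fin.last B) x n
      = X'.last x * M.dφ n (o n) * deriv M.h₁ (X'.β (Fin.last B) x n))
    (step : ∀ (b : Fin B) x n, |D b.castSucc x n - (D b.succ x n
      + (∫ y, X'.hidden b x y * (D b.succ y n * deriv M.h₂ (X'.α b y n)) ∂μ)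
        * deriv M.h₁ (X'.β b.castSucc x n))| ≤ e * s x) (l : Fin (B + 1)) (x : S) (n : Fin N) :
    |X.back M μ l x n - D l x n| ≤ (fun k => 12 * c ^ 5 * k)^[B] (3 * c ^ 3) * e * s x := by
  have c1 := hM.one_le
  have cp : ∀ k : ℕ, 1 ≤ c ^ k := fun k => one_le_pow₀ c1
  have hF : ∀ k : ℝ, 1 ≤ k → k ≤ 12 * c ^ 5 * k := fun k hk => by nlinarith [cp 5]
  refine layer_reverse_induction hF (by nlinarith [cp 3] : (1 : ℝ) ≤ 3 * c ^ 3)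
    (P := fun l k => ∀ x n, |X.back M μ l x n - D l x n| ≤ k * e * s x) ?_ ?_ ?_ l x n
  · intro l k k' hk h x n
    have := hs.pos x
    exact (h x n).trans (by gcongr)
  · intro x n
    have hsx := hs.one_le x
    rw [back_last, last]
    have h1 := abs_mul_sub_mul_le (hw.last x) (hM.dφ_le n (X.out M μ n)) (hb.last x)
      ((hM.dφ_lip n (X.out M μ n) (o n)).trans (mul_le_mul_of_nonneg_left (ho n) (by positivity)))
    have h2 := abs_mul_sub_mul_le h1 (hM.dh₁_le (X.β (Fin.last B) x n))
      (abs_mul_le_mul (hb.last x) (hM.dφ_le n (o n)))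
      ((hM.dh₁_lip (X.β (Fin.last B) x n) (X'.β (Fin.last B) x n)).trans
          (mul_le_mul_of_nonneg_left (hf.β _ x n) (by positivity)))
    refine h2.trans ?_
    have h3 : e ≤ e * s x := le_mul_of_one_le_right he hsx
    calc (e * s x * c + c * (c * e)) * c + c * c * (c * (e * s x))
        ≤ (e * s x * (c * c) + c * (c * (e * s x))) * c + c * c * (c * (e * s x)) := by
          gcongr
          nlinarith
      _ = _ := by ring
  · intro b k hk ih x n
    have hsx := hs.one_le x
    have bA : ∀ y, |X.backα M μ b y n - D b.succ y n * deriv M.h₂ (X'.α b y n)|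
        ≤ (k * c + c * c) * e * s y := fun y => by
      refine (abs_mul_sub_mul_le (ih y n) (hM.dh₂_le (X.α b y n)) (hDb b.succ y n)
        ((hM.dh₂_lip (X.α b y n) (X'.α b y n)).trans
          (mul_le_mul_of_nonneg_left (hf.α _ y n) (by positivity)))).trans_eq ?_
      ring
    have bD : ∀ y, |D b.succ y n * deriv M.h₂ (X'.α b y n)| ≤ c * c := fun y =>
      abs_mul_le_mul (hDb b.succ y n) (hM.dh₂_le (X'.α b y n))
    -- No bound on the backward signal of `X` is assumed: it is bounded through `D` plus the error
    -- of the induction hypothesis, and `e ≤ 1` keeps that bound independent of `e`.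
    have bX : ∀ y, |X.backα M μ b y n| ≤ (2 * (c * c) + k * c) * s y := fun y => by
      have h1 := abs_sub_abs_le_abs_sub (X.backα M μ b y n)
        (D b.succ y n * deriv M.h₂ (X'.α b y n))
      have h2 := bA y
      have h3 := bD y
      have h4 : (k * c + c * c) * e * s y ≤ (k * c + c * c) * 1 * s y := by
        have := hs.pos y
        gcongr
      nlinarith [hs.one_le y, mul_nonneg (by positivity : 0 ≤ c * c) (sub_nonneg.2 (hs.one_le y))]
    have mD : Measurable fun y => D b.succ y n * deriv M.h₂ (X'.α b y n) :=
      (hDm _ n).mul (hX'.dh₂ hM b n)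
    have bI : ∀ y, |X'.hidden b x y * (D b.succ y n * deriv M.h₂ (X'.α b y n))|
        ≤ c ^ 3 * s y ^ 2 := fun y => by
      refine (abs_mul_le_mul (hb.hidden b x y) (bD y)).trans ?_
      nlinarith [mul_le_mul_of_nonneg_left (hs.le_sq y) (by positivity : 0 ≤ c ^ 3)]
    -- Both the hidden weights and the error of the backward signal grow linearly in `s y`, so the
    -- integrand is quadratic in `s y`. This is where a second moment of the weight is
    -- indispensable.
    have key := hs.abs_integral_sub_le (k := 9 * k * c ^ 3 * e * s x) (k' := c ^ 3)
      (by positivity)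
      ((hX.hidden_left b x).mul (hX.backα (μ := μ) hM b n)).aestronglyMeasurable
      ((hX'.hidden_left b x).mul mD).aestronglyMeasurable
      (fun y => by
        have hsy := hs.one_le y
        refine (abs_mul_sub_mul_le (hw.hidden b x y) (bX y) (hb.hidden b x y) (bA y)).trans ?_
        have h5 : s x + s y ≤ 2 * (s x * s y) := by nlinarith
        have h6 : c * c ≤ k * c ^ 3 := by nlinarith [mul_nonneg (sub_nonneg.2 hk) (by positivity : 0 ≤ c ^ 3), mul_le_mul_of_nonneg_left c1 (by positivity : 0 ≤ c * c)]
        have h7 : k * c ≤ k * c ^ 3 := by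
          gcongr
          exact le_self_pow₀ c1 (by norm_num)
        have h8 : c * (k * c + c * c) ≤ 3 * (k * c ^ 3) := by
          nlinarith [mul_le_mul_of_nonneg_left c1 (by positivity : 0 ≤ k * c ^ 2),
            mul_nonneg (sub_nonneg.2 hk) (by positivity : 0 ≤ c ^ 3)]
        calc e * (s x + s y) * ((2 * (c * c) + k * c) * s y)
              + c * s y * ((k * c + c * c) * e * s y)
            ≤ e * (2 * (s x * s y)) * ((3 * (k * c ^ 3)) * s y)
              + (c * (k * c + c * c)) * e * (1 * s y ^ 2) := by
              have : 2 * (c * c) + k * c ≤ 3 * (k * c ^ 3) := by linarith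
              have e9 : c * s y * ((k * c + c * c) * e * s y)
                = (c * (k * c + c * c)) * e * (1 * s y ^ 2) := by ring
              rw [e9]
              gcongr
          _ ≤ e * (2 * (s x * s y)) * ((3 * (k * c ^ 3)) * s y)
              + (3 * (k * c ^ 3)) * e * (s x * s y ^ 2) := by gcongr
          _ = _ := by ring)
      bI
    have hI := hs.abs_integral_le (f := fun y => X'.hidden b x y
      * (D b.succ y n * deriv M.h₂ (X'.α b y n))) (by positivity) bI
    have h10 := abs_mul_sub_mul_le key (hM.dh₁_le (X.β b.castSucc x n)) hI
      ((hM.dh₁_lip (X.β b.castSucc x n) (X'.β b.castSucc x n)).trans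
          (mul_le_mul_of_nonneg_left (hf.β _ x n) (by positivity)))
    have h11 := step b x n
    have h12 := ih x n
    rw [back_castSucc]
    rw [abs_sub_comm] at h11
    refine (abs_sub_le _ _ _).trans ((add_le_add ((congrArg abs (add_sub_add_comm _ _ _ _)).trans_le
      ((abs_add_le _ _).trans (add_le_add h12 h10))) h11).trans ?_)
    have h13 : e * s x ≤ k * c ^ 5 * (e * s x) :=
      le_mul_of_one_le_left (by positivity) (one_le_mul_of_one_le_of_one_le hk (cp 5))
    have h14 : k * (e * s x) ≤ c ^ 5 * (k * (e * s x)) :=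
      le_mul_of_one_le_left (by positivity) (cp 5)
    have h15 : c ^ 5 * (e * s x) ≤ k * (c ^ 5 * (e * s x)) :=
      le_mul_of_one_le_left (by positivity) hk
    nlinarith

end Stability

end State

end ResNet

end


/-! ### Stability of the gradients; flows and their a priori bounds -/

noncomputable section

namespace ResNet

open Set

namespace State

/-- The drift of all components. -/
def drift {N d B : ℕ} {Y S : Type*} [MeasurableSpace S] (M : Model N d Y) (μ : Measure S)
    (X : State N d B S) : State N d B S where
  first := X.gradFirst M μ
  hidden := X.gradHidden M μ
  last := X.gradLast M μ
  α := X.driftα M μ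
  β := X.driftβ M μ

section Gradient

variable {N d B : ℕ} {Y S : Type*} [MeasurableSpace S] {M : Model N d Y} {μ : Measure S}
  {X X' : State N d B S} {s : S → ℝ} {c e k : ℝ}

/-- The gradients are stable if the results of forward and backward propagation are. -/
theorem grad_stability (hM : M.Tame c) (hs : ∀ x, 1 ≤ s x) (he : 0 ≤ e) (hk : 1 ≤ k)
    (hf : FeaturesClose s e X X') {o : Fin N → ℝ} (ho : ∀ n, |X.out M μ n - o n| ≤ e)
    {D : Fin (B + 1) → S → Fin N → ℝ} (hDb : ∀ l x n, |D l x n| ≤ c)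
    (hD : ∀ l x n, |X.back M μ l x n - D l x n| ≤ k * e * s x) {G : State N d B S}
    (last : ∀ x, G.last x = 1 / (N : ℝ) * ∑ n, M.dφ n (o n) * M.h₁ (X'.β (Fin.last B) x n))
    (hidden : ∀ b x y, G.hidden b x y = 1 / (N : ℝ) * ∑ n,
      (D b.succ y n * deriv M.h₂ (X'.α b y n)) * M.h₁ (X'.β b.castSucc x n))
    (first : ∀ x i, G.first x i = 1 / (N : ℝ) * ∑ n, M.X n i * D 0 x n) :
    WeightsClose s (3 * c ^ 3 * k * e) (X.drift M μ) G := by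
  have c1 := hM.one_le
  have c2 : c ≤ c ^ 3 := le_self_pow₀ c1 (by norm_num)
  have c3 : c ^ 2 ≤ c ^ 3 := pow_le_pow_right₀ c1 (by norm_num)
  have q : c ^ 3 ≤ c ^ 3 * k := le_mul_of_one_le_right (by positivity) hk
  refine ⟨fun x i => ?_, fun b x y => ?_, fun x => ?_⟩
  · rw [first]
    have hsx := hs x
    refine abs_mean_sub_le (by positivity) fun n => ?_
    rw [← mul_sub]
    refine (abs_mul_le_mul (hM.X_le n i) (hD 0 x n)).trans ?_
    have : c * k ≤ 3 * c ^ 3 * k := by nlinarith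
    calc c * (k * e * s x) = c * k * e * s x := by ring
      _ ≤ _ := by gcongr
  · rw [hidden]
    have hsx := hs x
    have hsy := hs y
    refine abs_mean_sub_le (by positivity) fun n => ?_
    have h1 := abs_mul_sub_mul_le (hD b.succ y n) (hM.dh₂_le (X.α b y n)) (hDb b.succ y n)
        ((hM.dh₂_lip (X.α b y n) (X'.α b y n)).trans
          (mul_le_mul_of_nonneg_left (hf.α _ y n) (by positivity)))
    have h2 := abs_mul_sub_mul_le h1 (hM.h₁_le (X.β b.castSucc x n))
      (abs_mul_le_mul (hDb b.succ y n) (hM.dh₂_le (X'.α b y n)))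
        ((hM.h₁_lip (X.β b.castSucc x n) (X'.β b.castSucc x n)).trans
          (mul_le_mul_of_nonneg_left (hf.β _ x n) (by positivity)))
    refine h2.trans ?_
    have q2 : c ^ 2 * k ≤ c ^ 3 * k := by gcongr
    have a1 : 0 ≤ e * s x := by positivity
    have a2 : 0 ≤ e * s y := by positivity
    calc (k * e * s y * c + c * (c * (e * s y))) * c + c * c * (c * (e * s x))
        = (c ^ 2 * k + c ^ 3) * (e * s y) + c ^ 3 * (e * s x) := by ring
      _ ≤ (3 * (c ^ 3 * k)) * (e * s y) + (3 * (c ^ 3 * k)) * (e * s x) := by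
        have : 0 ≤ c ^ 3 * k := by positivity
        gcongr <;> linarith
      _ = _ := by ring
  · rw [last]
    have hsx := hs x
    refine abs_mean_sub_le (by positivity) fun n => ?_
    have h2 := abs_mul_sub_mul_le ((hM.dφ_lip n (X.out M μ n) (o n)).trans
        (mul_le_mul_of_nonneg_left (ho n) (by positivity)))
      (hM.h₁_le (X.β (Fin.last B) x n)) (hM.dφ_le n (o n))
        ((hM.h₁_lip (X.β (Fin.last B) x n) (X'.β (Fin.last B) x n)).trans
          (mul_le_mul_of_nonneg_left (hf.β _ x n) (by positivity)))
    refine h2.trans ?_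
    have a1 : e ≤ e * s x := le_mul_of_one_le_right he hsx
    have : 2 * c ^ 2 ≤ 3 * c ^ 3 * k := by nlinarith
    calc c * e * c + c * (c * (e * s x)) ≤ c * (e * s x) * c + c * (c * (e * s x)) := by gcongr
      _ = 2 * c ^ 2 * (e * s x) := by ring
      _ ≤ 3 * c ^ 3 * k * (e * s x) := by gcongr
      _ = _ := by ring

end Gradient

/-- The scalar components of a state. -/
inductive Comp (N d B : ℕ) (S : Type*) where
  | first (x : S) (i : Fin d)
  | hidden (b : Fin B) (x y : S)
  | last (x : S)
  | α (b : Fin B) (x : S) (n : Fin N)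
  | β (l : Fin (B + 1)) (x : S) (n : Fin N)

/-- The value of a scalar component. -/
def val {N d B : ℕ} {S : Type*} (X : State N d B S) : Comp N d B S → ℝ
  | .first x i => X.first x i
  | .hidden b x y => X.hidden b x y
  | .last x => X.last x
  | .α b x n => X.α b x n
  | .β l x n => X.β l x n

/-- The size of a scalar component in terms of the weight function. -/
def Comp.size {N d B : ℕ} {S : Type*} (s : S → ℝ) : Comp N d B S → ℝ
  | .first _ _ => 1
  | .hidden _ _ _ => 1
  | .last _ => 1
  | .α _ x _ => s x
  | .β _ x _ => s x

end State

open State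

/-- A measurable trajectory of states, driven by its drift. -/
structure Flow {N d B : ℕ} {Y S : Type*} [MeasurableSpace S] (M : Model N d Y) (μ : Measure S)
    (T : ℝ) (X : ℝ → State N d B S) : Prop where
  meas : ∀ t ∈ Icc 0 T, (X t).Meas
  cont : ∀ k, ContinuousOn (fun t => (X t).val k) (Icc 0 T)
  eq : ∀ k, ∀ t ∈ Icc 0 T, (X t).val k = (X 0).val k - ∫ r in (0 : ℝ)..t, ((X r).drift M μ).val k

section Flow

variable {N d B : ℕ} {Y S : Type*} [MeasurableSpace S] {M : Model N d Y} {μ : Measure S}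
  {T : ℝ} {X : ℝ → State N d B S} {s : S → ℝ} {c : ℝ}

theorem uIoc_subset_Icc {t : ℝ} (ht : t ∈ Icc 0 T) : uIoc 0 t ⊆ Icc 0 T := by
  intro r hr
  rw [uIoc_of_le ht.1] at hr
  exact ⟨hr.1.le, hr.2.trans ht.2⟩

theorem Flow.abs_val_le (h : Flow M μ T X) {k : Comp N d B S} {a : ℝ}
    (hk : ∀ r ∈ Icc 0 T, |((X r).drift M μ).val k| ≤ a) {t : ℝ} (ht : t ∈ Icc 0 T) :
    |(X t).val k| ≤ |(X 0).val k| + a * T := by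
  have a0 : 0 ≤ a := (abs_nonneg _).trans (hk t ht)
  rw [h.eq k t ht]
  refine (abs_sub _ _).trans ?_
  gcongr
  have := intervalIntegral.norm_integral_le_of_norm_le_const (a := 0) (b := t) (C := a)
    (f := fun r => ((X r).drift M μ).val k) fun r hr => hk r (uIoc_subset_Icc ht hr)
  refine this.trans ?_
  rw [sub_zero, abs_of_nonneg ht.1]
  gcongr
  exact ht.2

theorem State.abs_gradLast_le (hM : M.Tame c) (X : State N d B S) (x : S) :
    |X.gradLast M μ x| ≤ c * c :=
  abs_mean_le (mul_self_nonneg c) fun _ => abs_mul_le_mul (hM.dφ_le _ _) (hM.h₁_le _)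

theorem State.abs_gradHidden_le (hM : M.Tame c) (X : State N d B S) {k : ℝ} {b : Fin B} {y : S}
    (hk : ∀ n, |X.back M μ b.succ y n| ≤ k) (k0 : 0 ≤ k) (x : S) :
    |X.gradHidden M μ b x y| ≤ k * c * c := by
  have := hM.one_le
  exact abs_mean_le (by positivity) fun n =>
    abs_mul_le_mul (abs_mul_le_mul (hk n) (hM.dh₂_le _)) (hM.h₁_le _)

theorem State.abs_gradFirst_le (hM : M.Tame c) (X : State N d B S) {k : ℝ} {x : S}
    (hk : ∀ n, |X.back M μ 0 x n| ≤ k) (k0 : 0 ≤ k) (i : Fin d) :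
    |X.gradFirst M μ x i| ≤ c * k := by
  have := hM.one_le
  exact abs_mean_le (by positivity) fun n => abs_mul_le_mul (hM.X_le n i) (hk n)

/-- A bound for backward propagation along a flow. -/
def backBound (B : ℕ) (c : ℝ) : ℝ := (fun k => 3 * c ^ 6 * k ^ 2)^[B] (2 * c ^ 5)

theorem Flow.abs_last_le (h : Flow M μ T X) (hM : M.Tame c) (hT : T ≤ c)
    (h0 : (X 0).Bdd s c) {t : ℝ} (ht : t ∈ Icc 0 T) (x : S) : |(X t).last x| ≤ 2 * c ^ 3 := by
  have c1 := hM.one_le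
  have := h.abs_val_le (k := .last x) (fun r _ => (X r).abs_gradLast_le hM x) ht
  refine this.trans ?_
  have h1 : c * c * T ≤ c * c * c := by gcongr
  have h2 : c ≤ c ^ 3 := le_self_pow₀ c1 (by norm_num)
  have h3 := h0.last x
  change |(X 0).last x| + _ ≤ _
  nlinarith

theorem Flow.abs_hidden_le (h : Flow M μ T X) (hM : M.Tame c) (hT : T ≤ c) (hs : ∀ x, 1 ≤ s x)
    (h0 : (X 0).Bdd s c) {k : ℝ} (k1 : 1 ≤ k) {b : Fin B}
    (hk : ∀ t ∈ Icc 0 T, ∀ x n, |(X t).back M μ b.succ x n| ≤ k) {t : ℝ} (ht : t ∈ Icc 0 T)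
    (x y : S) : |(X t).hidden b x y| ≤ 2 * k * c ^ 3 * s y := by
  have c1 := hM.one_le
  have := h.abs_val_le (k := .hidden b x y)
    (fun r hr => (X r).abs_gradHidden_le hM (hk r hr y) (by linarith) x) ht
  refine this.trans ?_
  have h1 : k * c * c * T ≤ k * c * c * c := by gcongr
  have h3 := h0.hidden b x y
  have h4 : c ≤ k * c ^ 3 :=
    (le_self_pow₀ c1 (by norm_num)).trans (le_mul_of_one_le_left (by positivity) k1)
  have h5 : c * s y ≤ k * c ^ 3 * s y := by
    have := hs y
    gcongr
  have h6 : k * c ^ 3 ≤ k * c ^ 3 * s y := le_mul_of_one_le_right (by positivity) (hs y)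
  change |(X 0).hidden b x y| + _ ≤ _
  nlinarith

/-- The drift of the hidden weights of layer `b` involves the backward signal only at `b.succ`. A
bound `k` there, valid at all times, integrates over `T ≤ c` to a bound on these weights, and so
bounds the signal one layer down. The recursion is quadratic in `k` because `k` enters both through
the weights and as the signal that they transport. -/
theorem Flow.abs_back_le (h : Flow M μ T X) (hM : M.Tame c) (hT : T ≤ c) (hs : IsWeight μ s c)
    (h0 : (X 0).Bdd s c) (l : Fin (B + 1)) {t : ℝ} (ht : t ∈ Icc 0 T) (x : S) (n : Fin N) :
    |(X t).back M μ l x n| ≤ backBound B c := by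
  have c1 := hM.one_le
  have cp : ∀ k : ℕ, 1 ≤ c ^ k := fun k => one_le_pow₀ c1
  refine layer_reverse_induction (F := fun k => 3 * c ^ 6 * k ^ 2) ?_
    (by nlinarith [cp 5] : (1 : ℝ) ≤ 2 * c ^ 5)
    (P := fun l k => ∀ t ∈ Icc 0 T, ∀ x n, |(X t).back M μ l x n| ≤ k) ?_ ?_ ?_ l t ht x n
  · intro k hk
    have : k ≤ k ^ 2 := by nlinarith
    nlinarith [mul_le_mul_of_nonneg_right (cp 6) (by positivity : 0 ≤ k ^ 2)]
  · intro l k k' hk h t ht x n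
    exact (h t ht x n).trans hk
  · intro t ht x n
    rw [back_last]
    refine (abs_mul_le_mul (abs_mul_le_mul (h.abs_last_le hM hT h0 ht x) (hM.dφ_le n _))
      (hM.dh₁_le _)).trans_eq (by ring)
  · intro b k hk ih t ht x n
    rw [back_castSucc]
    have hI : |∫ y, (X t).hidden b x y * (X t).backα M μ b y n ∂μ| ≤ 2 * k ^ 2 * c ^ 4 * c := by
      refine hs.abs_integral_le (by positivity) fun y => ?_
      refine (abs_mul_le_mul (h.abs_hidden_le hM hT hs.one_le h0 hk ih ht x y)
        (abs_mul_le_mul (ih t ht y n) (hM.dh₂_le _))).trans ?_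
      calc 2 * k * c ^ 3 * s y * (k * c) = 2 * k ^ 2 * c ^ 4 * s y := by ring
        _ ≤ _ := by
          gcongr
          exact hs.le_sq y
    refine (abs_add_le _ _).trans ((add_le_add (ih t ht x n)
      (abs_mul_le_mul hI (hM.dh₁_le _))).trans ?_)
    have h1 : k ≤ k ^ 2 := by nlinarith
    nlinarith [mul_le_mul_of_nonneg_right (cp 6) (by positivity : 0 ≤ k ^ 2)]

/-- A bound for the drift of a flow. -/
def driftBound (B : ℕ) (c : ℝ) : ℝ := (fun k => 3 * c ^ 6 * k)^[B + 1] (c ^ 3)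

/-- A flow all of whose states are bounded. -/
structure BddFlow (M : Model N d Y) (μ : Measure S) (s : S → ℝ) (c T : ℝ)
    (X : ℝ → State N d B S) : Prop where
  flow : Flow M μ T X
  tame : M.Tame c
  weight : IsWeight μ s c
  bdd : ∀ t ∈ Icc 0 T, (X t).Bdd s c
  back_le : ∀ t ∈ Icc 0 T, ∀ l x n, |(X t).back M μ l x n| ≤ c

theorem one_le_backBound (B : ℕ) (c1 : 1 ≤ c) : 1 ≤ backBound B c := by
  have cp : ∀ k : ℕ, 1 ≤ c ^ k := fun k => one_le_pow₀ c1
  refine le_iterate (F := fun k => 3 * c ^ 6 * k ^ 2) (fun k hk => ?_) (by nlinarith [cp 5]) B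
  have : k ≤ k ^ 2 := by nlinarith
  nlinarith [mul_le_mul_of_nonneg_right (cp 6) (by positivity : 0 ≤ k ^ 2)]

/-- The new constant is the bound for the hidden weights along the flow, and it dominates all the
others. From here on a single constant serves for data, weights, backward signal and second moment.
-/
theorem Flow.bddFlow (h : Flow M μ T X) (hM : M.Tame c) (hT : T ≤ c) (hs : IsWeight μ s c)
    (h0 : (X 0).Bdd s c) : BddFlow M μ s (2 * backBound B c * c ^ 3) T X := by
  have c1 := hM.one_le
  have k1 := one_le_backBound B c1
  have h1 : backBound B c ≤ 2 * backBound B c * c ^ 3 := by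
    nlinarith [mul_le_mul_of_nonneg_left (one_le_pow₀ c1 : 1 ≤ c ^ 3)
      (by positivity : 0 ≤ backBound B c)]
  have h2 : c ^ 3 ≤ backBound B c * c ^ 3 := le_mul_of_one_le_left (by positivity) k1
  have h3 : c ≤ c ^ 3 := le_self_pow₀ c1 (by norm_num)
  have h4 : c ≤ 2 * backBound B c * c ^ 3 := by nlinarith
  refine ⟨h, hM.mono h4, hs.mono h4, fun t ht => ⟨fun x => ?_, fun b x y => ?_⟩,
    fun t ht l x n => (h.abs_back_le hM hT hs h0 l ht x n).trans h1⟩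
  · refine (h.abs_last_le hM hT h0 ht x).trans ?_
    nlinarith
  · exact h.abs_hidden_le hM hT hs.one_le h0 k1
      (fun t ht x n => h.abs_back_le hM hT hs h0 _ ht x n) ht x y

namespace BddFlow

variable (h : BddFlow M μ s c T X)
include h

theorem abs_driftαFrom_le {t : ℝ} (ht : t ∈ Icc 0 T) {b : Fin B} {g : S → Fin N → ℝ} {k : ℝ}
    (hk : 1 ≤ k) (hg : ∀ x n, |g x n| ≤ k * s x) (x : S) (n : Fin N) :
    |(X t).driftαFrom M μ b g x n| ≤ 2 * c ^ 5 * k * s x := by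
  have c1 := h.tame.one_le
  have hs := h.weight
  have hsx := hs.one_le x
  have h1 : |∫ y, (X t).hidden b y x * (deriv M.h₁ ((X t).β b.castSucc y n) * g y n) ∂μ|
      ≤ c ^ 2 * k * s x * c := by
    refine hs.abs_integral_le (by positivity) fun y => ?_
    refine (abs_mul_le_mul ((h.bdd t ht).hidden b y x)
      (abs_mul_le_mul (h.tame.dh₁_le _) (hg y n))).trans ?_
    calc c * s x * (c * (k * s y)) = c ^ 2 * k * s x * s y := by ring
      _ ≤ _ := by
        gcongr
        exact hs.le_sq y
  have h2 : |∫ y, M.h₁ ((X t).β b.castSucc y n) * (X t).gradHidden M μ b y x ∂μ|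
      ≤ c * (c * c * c) * c := by
    refine hs.abs_integral_le (by positivity) fun y => ?_
    refine (abs_mul_le_mul (h.tame.h₁_le _) ((X t).abs_gradHidden_le h.tame
      (fun n => h.back_le t ht _ _ _) (by positivity) y)).trans ?_
    exact le_mul_of_one_le_right (by positivity) (hs.one_le_sq y)
  refine (abs_add_le _ _).trans ((add_le_add h1 h2).trans ?_)
  have h3 : c ^ 3 * (k * s x) ≤ c ^ 5 * (k * s x) := by
    gcongr
    norm_num
  have h4 : c ^ 5 ≤ c ^ 5 * (k * s x) :=
    le_mul_of_one_le_right (by positivity) (one_le_mul_of_one_le_of_one_le hk hsx)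
  nlinarith

end BddFlow
end Flow
end ResNet
end


/-! ### Drift bounds and regularity of the flow in time -/

noncomputable section

namespace ResNet

open Set State

section Flow

variable {N d B : ℕ} {Y S : Type*} [MeasurableSpace S] {M : Model N d Y} {μ : Measure S}
  {T : ℝ} {X : ℝ → State N d B S} {s : S → ℝ} {c : ℝ}

theorem one_le_driftBound (B : ℕ) (c1 : 1 ≤ c) : 1 ≤ driftBound B c :=
  le_iterate (fun k hk => by nlinarith [one_le_pow₀ c1 (n := 6)]) (one_le_pow₀ c1) _

theorem cube_le_driftBound (B : ℕ) (c1 : 1 ≤ c) : c ^ 3 ≤ driftBound B c :=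
  iterate_mono (j := 0) (fun k hk => by nlinarith [one_le_pow₀ c1 (n := 6)]) (one_le_pow₀ c1)
    (Nat.zero_le _)

namespace BddFlow

variable (h : BddFlow M μ s c T X)
include h

theorem c_nonneg : 0 ≤ c := zero_le_one.trans h.tame.one_le

theorem abs_driftβ_le_iterate {t : ℝ} (ht : t ∈ Icc 0 T) (l : Fin (B + 1)) (x : S) (n : Fin N) :
    |(X t).driftβ M μ l x n| ≤ (fun k => 3 * c ^ 6 * k)^[B] (c ^ 3) * s x := by
  have c1 := h.tame.one_le
  have hs := h.weight
  refine layer_induction (F := fun k => 3 * c ^ 6 * k)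
    (fun k hk => by nlinarith [one_le_pow₀ c1 (n := 6)]) (one_le_pow₀ c1)
    (P := fun l k => ∀ x n, |(X t).driftβ M μ l x n| ≤ k * s x) ?_ ?_ ?_ l x n
  · intro l k k' hk ih x n
    have := hs.pos x
    exact (ih x n).trans (by gcongr)
  · intro x n
    have := hs.one_le x
    rw [driftβ_zero]
    have h1 : c * (c * c) ≤ c ^ 3 * s x := by
      nlinarith [mul_le_mul_of_nonneg_left this (by positivity : 0 ≤ c ^ 3)]
    exact (abs_mean_le (by positivity) fun i => abs_mul_le_mul (h.tame.X_le n i)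
      ((X t).abs_gradFirst_le h.tame (fun n => h.back_le t ht _ _ _) (by positivity) i)).trans h1
  · intro b k hk ih x n
    have hsx := hs.one_le x
    rw [driftβ_succ]
    refine (abs_add_le _ _).trans ((add_le_add (ih x n)
      (abs_mul_le_mul (h.abs_driftαFrom_le ht hk ih x n) (h.tame.dh₂_le _))).trans ?_)
    have : k * s x ≤ c ^ 6 * (k * s x) :=
      le_mul_of_one_le_left (by positivity) (one_le_pow₀ c1)
    nlinarith

theorem abs_driftβ_le {t : ℝ} (ht : t ∈ Icc 0 T) (l : Fin (B + 1)) (x : S) (n : Fin N) :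
    |(X t).driftβ M μ l x n| ≤ driftBound B c * s x := by
  have c1 := h.tame.one_le
  have hsx := h.weight.one_le x
  refine (h.abs_driftβ_le_iterate ht l x n).trans ?_
  gcongr
  exact iterate_mono (fun k hk => by nlinarith [one_le_pow₀ c1 (n := 6)]) (one_le_pow₀ c1)
    (Nat.le_succ B)

theorem abs_driftα_le {t : ℝ} (ht : t ∈ Icc 0 T) (b : Fin B) (x : S) (n : Fin N) :
    |(X t).driftα M μ b x n| ≤ driftBound B c * s x := by
  have c1 := h.tame.one_le
  have hsx := h.weight.one_le x
  have K1 : 1 ≤ (fun k : ℝ => 3 * c ^ 6 * k)^[B] (c ^ 3) :=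
    le_iterate (fun k hk => by nlinarith [one_le_pow₀ c1 (n := 6)]) (one_le_pow₀ c1) _
  -- The iterate beyond the `B` used for the features pays for the factor `2 * c ^ 5` of the
  -- residual drift.
  have e1 : driftBound B c = 3 * c ^ 6 * (fun k : ℝ => 3 * c ^ 6 * k)^[B] (c ^ 3) :=
    Function.iterate_succ_apply' _ _ _
  refine (h.abs_driftαFrom_le ht K1 (h.abs_driftβ_le_iterate ht _) x n).trans ?_
  rw [e1]
  gcongr <;> norm_num [c1]

theorem abs_drift_le {t : ℝ} (ht : t ∈ Icc 0 T) (k : Comp N d B S) :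
    |((X t).drift M μ).val k| ≤ driftBound B c * k.size s := by
  have c1 := h.tame.one_le
  have h3 := cube_le_driftBound B c1
  have c0 := h.c_nonneg
  cases k with
  | first x i =>
    refine ((X t).abs_gradFirst_le h.tame (fun n => h.back_le t ht _ x n) c0 i).trans ?_
    simp only [Comp.size]
    nlinarith
  | hidden b x y =>
    refine ((X t).abs_gradHidden_le h.tame (fun n => h.back_le t ht _ y n) c0 x).trans ?_
    simp only [Comp.size]
    nlinarith
  | last x =>
    refine ((X t).abs_gradLast_le h.tame x).trans ?_
    simp only [Comp.size]
    nlinarith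
  | α b x n => exact h.abs_driftα_le ht b x n
  | β l x n => exact h.abs_driftβ_le ht l x n

/-! Continuity in time. -/

omit h in
theorem _root_.ResNet.Flow.continuousOn_comp (h : Flow M μ T X) {f : ℝ → ℝ} (hf : Continuous f)
    (k : Comp N d B S) : ContinuousOn (fun t => f ((X t).val k)) (Icc 0 T) :=
  hf.comp_continuousOn (h.cont k)

theorem continuousOn_out (n : Fin N) : ContinuousOn (fun t => (X t).out M μ n) (Icc 0 T) := by
  have c0 := h.c_nonneg
  refine h.weight.continuousOn_integral (k := c * c)
    (fun t ht => (((h.flow.meas t ht).last.mul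
      ((h.flow.meas t ht).h₁ h.tame _ n)).aestronglyMeasurable))
    (fun t ht x => ?_) fun x => ?_
  · refine (abs_mul_le_mul ((h.bdd t ht).last x) (h.tame.h₁_le _)).trans ?_
    exact le_mul_of_one_le_right (by positivity) (h.weight.one_le_sq x)
  · exact (h.flow.cont (.last x)).mul
      (h.flow.continuousOn_comp h.tame.continuous_h₁ (.β (Fin.last B) x n))

theorem continuousOn_dφ_out (n : Fin N) :
    ContinuousOn (fun t => M.dφ n ((X t).out M μ n)) (Icc 0 T) :=
  (h.tame.continuous_dφ n).comp_continuousOn (h.continuousOn_out n)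

theorem abs_backα_le {t : ℝ} (ht : t ∈ Icc 0 T) (b : Fin B) (x : S) (n : Fin N) :
    |(X t).backα M μ b x n| ≤ c * c := abs_mul_le_mul (h.back_le t ht _ x n) (h.tame.dh₂_le _)

theorem abs_hidden_mul_backα_le {t : ℝ} (ht : t ∈ Icc 0 T) (b : Fin B) (x y : S) (n : Fin N) :
    |(X t).hidden b x y * (X t).backα M μ b y n| ≤ c ^ 3 * s y :=
  (abs_mul_le_mul ((h.bdd t ht).hidden b x y) (h.abs_backα_le ht b y n)).trans_eq (by ring)

theorem continuousOn_back [SFinite μ] (l : Fin (B + 1)) (x : S) (n : Fin N) :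
    ContinuousOn (fun t => (X t).back M μ l x n) (Icc 0 T) := by
  have c0 := h.c_nonneg
  induction l using Fin.reverseInduction generalizing x with
  | last =>
    simp only [back_last]
    exact ((h.flow.cont (.last x)).mul (h.continuousOn_dφ_out n)).mul
      (h.flow.continuousOn_comp h.tame.continuous_dh₁ (.β (Fin.last B) x n))
  | cast b ih =>
    simp only [back_castSucc]
    refine (ih x).add (ContinuousOn.mul ?_
      (h.flow.continuousOn_comp h.tame.continuous_dh₁ (.β b.castSucc x n)))
    refine h.weight.continuousOn_integral (k := c ^ 3)
      (fun t ht => (((h.flow.meas t ht).hidden_left b x).mul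
        ((h.flow.meas t ht).backα h.tame b n)).aestronglyMeasurable)
      (fun t ht y => (h.abs_hidden_mul_backα_le ht b x y n).trans ?_) fun y => ?_
    · gcongr
      exact h.weight.le_sq y
    · exact (h.flow.cont (.hidden b x y)).mul ((ih y).mul
        (h.flow.continuousOn_comp h.tame.continuous_dh₂ (.α b y n)))

theorem continuousOn_backα [SFinite μ] (b : Fin B) (x : S) (n : Fin N) :
    ContinuousOn (fun t => (X t).backα M μ b x n) (Icc 0 T) :=
  (h.continuousOn_back _ x n).mul (h.flow.continuousOn_comp h.tame.continuous_dh₂ (.α b x n))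

theorem continuousOn_gradHidden [SFinite μ] (b : Fin B) (x y : S) :
    ContinuousOn (fun t => (X t).gradHidden M μ b x y) (Icc 0 T) :=
  continuousOn_const.mul (continuousOn_finsetSum _ fun n _ => (h.continuousOn_backα b y n).mul
    (h.flow.continuousOn_comp h.tame.continuous_h₁ (.β b.castSucc x n)))

theorem continuousOn_gradLast (x : S) :
    ContinuousOn (fun t => (X t).gradLast M μ x) (Icc 0 T) :=
  continuousOn_const.mul (continuousOn_finsetSum _ fun n _ => (h.continuousOn_dφ_out n).mul
    (h.flow.continuousOn_comp h.tame.continuous_h₁ (.β (Fin.last B) x n)))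

theorem continuousOn_gradFirst [SFinite μ] (x : S) (i : Fin d) :
    ContinuousOn (fun t => (X t).gradFirst M μ x i) (Icc 0 T) :=
  continuousOn_const.mul (continuousOn_finsetSum _ fun n _ =>
    continuousOn_const.mul (h.continuousOn_back 0 x n))

theorem abs_hidden_mul_driftβ_le {t : ℝ} (ht : t ∈ Icc 0 T) (b : Fin B) (x y : S) (n : Fin N) :
    |(X t).hidden b y x * (deriv M.h₁ ((X t).β b.castSucc y n) * (X t).driftβ M μ b.castSucc y n)|
      ≤ c ^ 2 * driftBound B c * s x * s y ^ 2 := by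
  have c0 := h.c_nonneg
  have hsx := h.weight.pos x
  have K0 := one_le_driftBound B h.tame.one_le
  refine (abs_mul_le_mul ((h.bdd t ht).hidden b y x) (abs_mul_le_mul (h.tame.dh₁_le _)
    (h.abs_driftβ_le ht _ y n))).trans ?_
  calc c * s x * (c * (driftBound B c * s y)) = c ^ 2 * driftBound B c * s x * s y := by ring
    _ ≤ _ := by
      gcongr
      exact h.weight.le_sq y

theorem abs_h₁_mul_gradHidden_le {t : ℝ} (ht : t ∈ Icc 0 T) (b : Fin B) (x y : S) (n : Fin N) :
    |M.h₁ ((X t).β b.castSucc y n) * (X t).gradHidden M μ b y x| ≤ c ^ 4 * s y ^ 2 := by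
  have c0 := h.c_nonneg
  refine (abs_mul_le_mul (h.tame.h₁_le _) ((X t).abs_gradHidden_le h.tame
    (fun n => h.back_le t ht _ x n) c0 y)).trans ?_
  calc c * (c * c * c) = c ^ 4 * 1 := by ring
    _ ≤ _ := by
      gcongr
      exact h.weight.one_le_sq y

theorem measurable_hidden_mul_driftβ [SFinite μ] {t : ℝ} (ht : t ∈ Icc 0 T) (b : Fin B) (x : S)
    (n : Fin N) : Measurable fun y => (X t).hidden b y x
      * (deriv M.h₁ ((X t).β b.castSucc y n) * (X t).driftβ M μ b.castSucc y n) :=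
  ((h.flow.meas t ht).hidden_right b x).mul
    (((h.flow.meas t ht).dh₁ h.tame _ n).mul ((h.flow.meas t ht).driftβ h.tame _ n))

theorem measurable_h₁_mul_gradHidden [SFinite μ] {t : ℝ} (ht : t ∈ Icc 0 T) (b : Fin B) (x : S)
    (n : Fin N) :
    Measurable fun y => M.h₁ ((X t).β b.castSucc y n) * (X t).gradHidden M μ b y x := by
  have m : Measurable fun y => (X t).gradHidden M μ b y x :=
    ((h.flow.meas t ht).gradHidden (μ := μ) h.tame b).comp (measurable_prodMk_right (y := x))
  exact ((h.flow.meas t ht).h₁ h.tame _ n).mul m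

theorem continuousOn_driftαFrom [SFinite μ] (b : Fin B) (n : Fin N)
    (hβ : ∀ y, ContinuousOn (fun t => (X t).driftβ M μ b.castSucc y n) (Icc 0 T)) (x : S) :
    ContinuousOn (fun t => (X t).driftα M μ b x n) (Icc 0 T) := by
  refine ContinuousOn.add ?_ ?_
  · refine h.weight.continuousOn_integral
      (fun t ht => (h.measurable_hidden_mul_driftβ ht b x n).aestronglyMeasurable)
      (fun t ht y => h.abs_hidden_mul_driftβ_le ht b x y n) fun y => ?_
    exact (h.flow.cont (.hidden b y x)).mul
      ((h.flow.continuousOn_comp h.tame.continuous_dh₁ (.β b.castSucc y n)).mul (hβ y))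
  · refine h.weight.continuousOn_integral
      (fun t ht => (h.measurable_h₁_mul_gradHidden ht b x n).aestronglyMeasurable)
      (fun t ht y => h.abs_h₁_mul_gradHidden_le ht b x y n) fun y => ?_
    exact (h.flow.continuousOn_comp h.tame.continuous_h₁ (.β b.castSucc y n)).mul
      (h.continuousOn_gradHidden b y x)

theorem continuousOn_driftβ [SFinite μ] (l : Fin (B + 1)) (x : S) (n : Fin N) :
    ContinuousOn (fun t => (X t).driftβ M μ l x n) (Icc 0 T) := by
  induction l using Fin.induction generalizing x with
  | zero =>
    simp only [driftβ_zero]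
    exact continuousOn_const.mul (continuousOn_finsetSum _ fun i _ =>
      continuousOn_const.mul (h.continuousOn_gradFirst x i))
  | succ b ih =>
    simp only [driftβ_succ]
    exact (ih x).add ((h.continuousOn_driftαFrom b n ih x).mul
      (h.flow.continuousOn_comp h.tame.continuous_dh₂ (.α b x n)))

/-- A flow is assumed only to satisfy an integral equation, in which the integral carries no
information unless the drift is integrable. Continuity of the drift, from dominated convergence with
dominating function a multiple of `s ^ 2`, turns it into a differential equation and makes the
integrals additive in time. -/
theorem continuousOn_drift [SFinite μ] (k : Comp N d B S) :
    ContinuousOn (fun t => ((X t).drift M μ).val k) (Icc 0 T) := by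
  cases k with
  | first x i => exact h.continuousOn_gradFirst x i
  | hidden b x y => exact h.continuousOn_gradHidden b x y
  | last x => exact h.continuousOn_gradLast x
  | α b x n => exact h.continuousOn_driftαFrom b n (fun y => h.continuousOn_driftβ _ y n) x
  | β l x n => exact h.continuousOn_driftβ l x n

theorem intervalIntegrable_drift [SFinite μ] (k : Comp N d B S) {t t' : ℝ} (ht : t ∈ Icc 0 T)
    (ht' : t' ∈ Icc 0 T) :
    IntervalIntegrable (fun r => ((X r).drift M μ).val k) volume t t' :=
  ((h.continuousOn_drift k).mono (ordConnected_Icc.uIcc_subset ht ht')).intervalIntegrable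

theorem val_sub_val [SFinite μ] (k : Comp N d B S) {t t' : ℝ} (ht : t ∈ Icc 0 T)
    (ht' : t' ∈ Icc 0 T) :
    (X t').val k - (X t).val k = -∫ r in t..t', ((X r).drift M μ).val k := by
  have h0 : (0 : ℝ) ∈ Icc 0 T := ⟨le_rfl, ht.1.trans ht.2⟩
  rw [h.flow.eq k t' ht', h.flow.eq k t ht, ← intervalIntegral.integral_add_adjacent_intervals
    (h.intervalIntegrable_drift k h0 ht) (h.intervalIntegrable_drift k ht ht')]
  ring

theorem abs_val_sub_le [SFinite μ] (k : Comp N d B S) {t t' : ℝ} (ht : t ∈ Icc 0 T)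
    (ht' : t' ∈ Icc 0 T) :
    |(X t').val k - (X t).val k| ≤ driftBound B c * |t' - t| * k.size s := by
  rw [h.val_sub_val k ht ht', abs_neg]
  refine (intervalIntegral.norm_integral_le_of_norm_le_const (C := driftBound B c * k.size s)
    (f := fun r => ((X r).drift M μ).val k) fun r hr => h.abs_drift_le (ordConnected_Icc.uIcc_subset ht ht' (uIoc_subset_uIcc hr))
      k).trans_eq (by ring)

theorem hasDerivAt_val [SFinite μ] (k : Comp N d B S) {t : ℝ} (ht : t ∈ Ioo 0 T) :
    HasDerivAt (fun t => (X t).val k) (-((X t).drift M μ).val k) t := by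
  have ht' := Ioo_subset_Icc_self ht
  have h0 : (0 : ℝ) ∈ Icc 0 T := ⟨le_rfl, ht'.1.trans ht'.2⟩
  have hn : Icc 0 T ∈ nhds t := Icc_mem_nhds ht.1 ht.2
  have hd := intervalIntegral.integral_hasDerivAt_right (h.intervalIntegrable_drift k h0 ht')
    ((h.continuousOn_drift k).stronglyMeasurableAtFilter_nhdsWithin measurableSet_Icc t |>.filter_mono
      (le_inf le_rfl (Filter.le_principal_iff.2 hn)))
    ((h.continuousOn_drift k).continuousAt hn)
  have := (hasDerivAt_const t ((X 0).val k)).sub hd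
  rw [zero_sub] at this
  refine this.congr_of_eventuallyEq ?_
  filter_upwards [hn] with r hr
  exact h.flow.eq k r hr

theorem weightsClose_time [SFinite μ] {t t' : ℝ} (ht : t ∈ Icc 0 T) (ht' : t' ∈ Icc 0 T) :
    WeightsClose s (driftBound B c * |t' - t|) (X t') (X t) := by
  have K0 := one_le_driftBound B h.tame.one_le
  refine ⟨fun x i => (h.abs_val_sub_le (.first x i) ht ht').trans ?_,
    fun b x y => (h.abs_val_sub_le (.hidden b x y) ht ht').trans ?_,
    fun x => (h.abs_val_sub_le (.last x) ht ht').trans ?_⟩ <;> simp only [Comp.size] <;> gcongr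
  · exact h.weight.one_le x
  · linarith [h.weight.one_le x, h.weight.one_le y]
  · exact h.weight.one_le x

theorem featuresClose_time [SFinite μ] {t t' : ℝ} (ht : t ∈ Icc 0 T) (ht' : t' ∈ Icc 0 T) :
    FeaturesClose s (driftBound B c * |t' - t|) (X t') (X t) :=
  ⟨fun b x n => h.abs_val_sub_le (.α b x n) ht ht', fun l x n => h.abs_val_sub_le (.β l x n) ht ht'⟩

theorem abs_out_sub_le [SFinite μ] {t t' : ℝ} (ht : t ∈ Icc 0 T) (ht' : t' ∈ Icc 0 T)
    (n : Fin N) :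
    |(X t').out M μ n - (X t).out M μ n| ≤ 2 * c ^ 3 * driftBound B c * |t' - t| := by
  have K0 := one_le_driftBound B h.tame.one_le
  refine (out_stability h.tame h.weight (by positivity) (h.flow.meas t' ht') (h.flow.meas t ht)
    (h.bdd t ht) (h.weightsClose_time ht ht').last
    (fun x n => (h.featuresClose_time ht ht').β _ x n) n).trans_eq (by ring)

/-- The drift of the weights of a flow is Lipschitz in time. -/
theorem drift_time [SFinite μ] {t t' e : ℝ} (ht : t ∈ Icc 0 T) (ht' : t' ∈ Icc 0 T)
    (he : 2 * c ^ 3 * driftBound B c * |t' - t| ≤ e) (he1 : e ≤ 1) :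
    WeightsClose s (3 * c ^ 3 * (fun k => 12 * c ^ 5 * k)^[B] (3 * c ^ 3) * e)
      ((X t').drift M μ) ((X t).drift M μ) := by
  have c1 := h.tame.one_le
  have K0 := one_le_driftBound B c1
  have e0 : 0 ≤ e := le_trans (by positivity) he
  have he2 : driftBound B c * |t' - t| ≤ e := by
    refine le_trans (le_of_eq_of_le (one_mul _).symm ?_) he
    rw [mul_assoc (2 * c ^ 3)]
    gcongr
    nlinarith [one_le_pow₀ c1 (n := 3)]
  have hs0 : ∀ x, 0 ≤ s x := fun x => (h.weight.pos x).le
  have hw := (h.weightsClose_time ht ht').mono hs0 he2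
  have hf := (h.featuresClose_time ht ht').mono hs0 he2
  have ho := fun n => (h.abs_out_sub_le ht ht' n).trans he
  have K1 : 1 ≤ (fun k => 12 * c ^ 5 * k)^[B] (3 * c ^ 3) :=
    le_iterate (fun k hk => by nlinarith [one_le_pow₀ c1 (n := 5)])
      (by nlinarith [one_le_pow₀ c1 (n := 3)]) B
  -- The two states live over the same measure, and `D` is the backward signal of `X t` itself, so
  -- its equations hold without error; only the differences of weights and features contribute.
  refine grad_stability h.tame h.weight.one_le e0 K1 hf ho (h.back_le t ht)
    (back_stability h.tame h.weight e0 he1 (h.flow.meas t' ht') (h.flow.meas t ht) (h.bdd t ht)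
      hw hf ho (fun l n => (h.flow.meas t ht).back h.tame l n) (h.back_le t ht)
      (fun x n => back_last M μ (X t) x n) (fun b x n => ?_))
    (fun _ => rfl) (fun _ _ _ => rfl) (fun _ _ => rfl)
  have := h.weight.pos x
  have e2 := back_castSucc M μ (X t) b x n
  simp only [State.backα] at e2
  rw [e2, sub_self, abs_zero]
  positivity

end BddFlow
end Flow
end ResNet
end


/-! ### Conservation of the forward equations along the flow -/

noncomputable section

namespace ResNet

open Set State

/-- The residuals and features of a state are the ones obtained by forward propagation. -/
structure State.Forward {N d B : ℕ} {Y S : Type*} [MeasurableSpace S] (M : Model N d Y)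
    (μ : Measure S) (X : State N d B S) : Prop where
  zero : ∀ x n, X.β 0 x n = 1 / (d : ℝ) * ∑ i, M.X n i * X.first x i
  succ : ∀ (b : Fin B) x n, X.β b.succ x n = M.h₂ (X.α b x n) + X.β b.castSucc x n
  res : ∀ b x n, X.α b x n = ∫ y, X.hidden b y x * M.h₁ (X.β b.castSucc y n) ∂μ

theorem eqOn_of_hasDerivAt {f g f' : ℝ → ℝ} {T : ℝ} (hf : ContinuousOn f (Icc 0 T))
    (hg : ContinuousOn g (Icc 0 T)) (hf' : ∀ t ∈ Ioo 0 T, HasDerivAt f (f' t) t)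
    (hg' : ∀ t ∈ Ioo 0 T, HasDerivAt g (f' t) t) (h0 : f 0 = g 0) {t : ℝ} (ht : t ∈ Icc 0 T) :
    f t = g t := by
  have := intervalIntegral.integral_eq_sub_of_hasDerivAt_of_le (f := fun r => f r - g r)
    (f' := fun _ => 0) ht.1 ((hf.sub hg).mono (Icc_subset_Icc_right ht.2))
    (fun r hr => by
      have hr' : r ∈ Ioo 0 T := ⟨hr.1, hr.2.trans_le ht.2⟩
      exact ((hf' r hr').fun_sub (hg' r hr')).congr_deriv (sub_self _))
    intervalIntegrable_const
  simp only [intervalIntegral.integral_zero] at this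
  linarith

namespace BddFlow

variable {N d B : ℕ} {Y S : Type*} [MeasurableSpace S] {M : Model N d Y} {μ : Measure S}
  {T : ℝ} {X : ℝ → State N d B S} {s : S → ℝ} {c : ℝ}

variable (h : BddFlow M μ s c T X)
include h

/-- The forward integral of the residuals is continuous in time. -/
theorem continuousOn_residual (b : Fin B) (x : S) (n : Fin N) :
    ContinuousOn (fun t => ∫ y, (X t).hidden b y x * M.h₁ ((X t).β b.castSucc y n) ∂μ)
      (Icc 0 T) := by
  have c0 := h.c_nonneg
  have hsx := h.weight.pos x
  refine h.weight.continuousOn_integral (k := c * s x * c)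
    (fun t ht => (((h.flow.meas t ht).hidden_right b x).mul
      ((h.flow.meas t ht).h₁ h.tame _ n)).aestronglyMeasurable) (fun t ht y => ?_) fun y => ?_
  · refine (abs_mul_le_mul ((h.bdd t ht).hidden b y x) (h.tame.h₁_le _)).trans ?_
    exact le_mul_of_one_le_right (by positivity) (h.weight.one_le_sq y)
  · exact (h.flow.cont (.hidden b y x)).mul
      (h.flow.continuousOn_comp h.tame.continuous_h₁ (.β b.castSucc y n))

/-- Product and chain rule under the integral sign: the two integrals in the residual drift are the
contributions of the moving features and of the moving weights. Both are dominated by multiples of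
`s y ^ 2`, uniformly in time. -/
theorem hasDerivAt_residual [SFinite μ] (b : Fin B) (x : S) (n : Fin N) {t : ℝ} (ht : t ∈ Ioo 0 T) :
    HasDerivAt (fun t => ∫ y, (X t).hidden b y x * M.h₁ ((X t).β b.castSucc y n) ∂μ)
      (-(X t).driftα M μ b x n) t := by
  have c0 := h.c_nonneg
  have hsx := h.weight.pos x
  have ht' := Ioo_subset_Icc_self ht
  have m1 := h.measurable_hidden_mul_driftβ ht' b x n
  have m2 := h.measurable_h₁_mul_gradHidden ht' b x n
  have mF : ∀ r ∈ Icc 0 T, AEStronglyMeasurable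
      (fun y => (X r).hidden b y x * M.h₁ ((X r).β b.castSucc y n)) μ := fun r hr =>
    (((h.flow.meas r hr).hidden_right b x).mul
      ((h.flow.meas r hr).h₁ h.tame _ n)).aestronglyMeasurable
  have hn : Ioo 0 T ∈ nhds t := Ioo_mem_nhds ht.1 ht.2
  have key := hasDerivAt_integral_of_dominated_loc_of_deriv_le (μ := μ) (𝕜 := ℝ) (x₀ := t)
    (s := Ioo 0 T)
    (F := fun t y => (X t).hidden b y x * M.h₁ ((X t).β b.castSucc y n))
    (F' := fun t y => -((X t).hidden b y x
        * (deriv M.h₁ ((X t).β b.castSucc y n) * (X t).driftβ M μ b.castSucc y n)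
      + M.h₁ ((X t).β b.castSucc y n) * (X t).gradHidden M μ b y x))
    (bound := fun y => (c ^ 2 * driftBound B c * s x + c ^ 4) * s y ^ 2) hn
    (Filter.eventually_of_mem hn fun r hr => mF r (Ioo_subset_Icc_self hr))
    (h.weight.integrable (k := c * s x * c) (mF t ht') fun y => by
      refine (abs_mul_le_mul ((h.bdd t ht').hidden b y x) (h.tame.h₁_le _)).trans ?_
      exact le_mul_of_one_le_right (by positivity) (h.weight.one_le_sq y))
    (m1.add m2).neg.aestronglyMeasurable
    (Filter.Eventually.of_forall fun y r hr => by
      have hr' := Ioo_subset_Icc_self hr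
      rw [norm_neg, add_mul]
      exact (norm_add_le _ _).trans (add_le_add (h.abs_hidden_mul_driftβ_le hr' b x y n)
        (h.abs_h₁_mul_gradHidden_le hr' b x y n)))
    (h.weight.integrable_sq.const_mul _)
    (Filter.Eventually.of_forall fun y r hr => by
      have d1 := h.hasDerivAt_val (.hidden b y x) hr
      have d2 := h.hasDerivAt_val (.β b.castSucc y n) hr
      have d3 := (h.tame.diff_h₁ ((X r).β b.castSucc y n)).hasDerivAt.comp r d2
      refine (d1.mul d3).congr_deriv ?_
      simp only [State.val, State.drift, Function.comp_apply]
      ring)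
  refine key.2.congr_deriv ?_
  rw [integral_neg, integral_add]
  · rfl
  · exact h.weight.integrable m1.aestronglyMeasurable fun y =>
      h.abs_hidden_mul_driftβ_le ht' b x y n
  · exact h.weight.integrable m2.aestronglyMeasurable fun y =>
      h.abs_h₁_mul_gradHidden_le ht' b x y n

/-- The residuals and features of a flow remain the ones obtained by forward propagation. -/
theorem forward [SFinite μ] (h0 : (X 0).Forward M μ) {t : ℝ} (ht : t ∈ Icc 0 T) : (X t).Forward M μ where
  zero x n := by
    refine eqOn_of_hasDerivAt (f' := fun t => -(X t).driftβ M μ 0 x n) (h.flow.cont (.β 0 x n))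
      (g := fun t => 1 / (d : ℝ) * ∑ i, M.X n i * (X t).first x i)
      (continuousOn_const.mul (continuousOn_finsetSum _ fun i _ =>
        continuousOn_const.mul (h.flow.cont (.first x i))))
      (fun t ht => h.hasDerivAt_val (.β 0 x n) ht) (fun t ht => ?_) (h0.zero x n) ht
    have := (HasDerivAt.fun_sum fun i (_ : i ∈ Finset.univ) =>
      (h.hasDerivAt_val (.first x i) ht).const_mul (M.X n i)).const_mul (1 / (d : ℝ))
    refine this.congr_deriv ?_
    rw [driftβ_zero]
    simp [State.val, State.drift]
  succ b x n := by
    refine eqOn_of_hasDerivAt (f' := fun t => -(X t).driftβ M μ b.succ x n)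
      (h.flow.cont (.β b.succ x n))
      (g := fun t => M.h₂ ((X t).α b x n) + (X t).β b.castSucc x n)
      ((h.flow.continuousOn_comp h.tame.continuous_h₂ (.α b x n)).add
        (h.flow.cont (.β b.castSucc x n)))
      (fun t ht => h.hasDerivAt_val (.β b.succ x n) ht) (fun t ht => ?_) (h0.succ b x n) ht
    have d3 := (h.tame.diff_h₂ ((X t).α b x n)).hasDerivAt.comp t (h.hasDerivAt_val (.α b x n) ht)
    refine (d3.add (h.hasDerivAt_val (.β b.castSucc x n) ht)).congr_deriv ?_
    rw [driftβ_succ]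
    simp only [State.val, State.drift]
    ring
  res b x n :=
    eqOn_of_hasDerivAt (h.flow.cont (.α b x n)) (h.continuousOn_residual b x n)
      (fun t ht => h.hasDerivAt_val (.α b x n) ht) (fun t ht => h.hasDerivAt_residual b x n ht)
      (h0.res b x n) ht

end BddFlow

end ResNet
end


/-! ### The discrete network as a state, and backpropagation -/

noncomputable section

namespace ResNet

open Set State

/-- The uniform probability measure on `Fin m`. -/
def unif (m : ℕ) : Measure (Fin m) := (m : ENNReal)⁻¹ • Measure.count

/-- Finiteness is stated instead of total mass one in order to include `m = 0`, where an infinite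
scalar multiplies the zero measure. -/
instance (m : ℕ) : IsFiniteMeasure (unif m) := by
  refine ⟨?_⟩
  simp only [unif, Measure.smul_apply, smul_eq_mul, Measure.count_univ, ENat.card_eq_coe_fintype_card,
    Fintype.card_fin]
  rcases Nat.eq_zero_or_pos m with rfl | hm
  · simp
  · refine ENNReal.mul_lt_top ?_ ?_
    · simp [hm]
    · simp

theorem integral_unif {m : ℕ} (f : Fin m → ℝ) : ∫ i, f i ∂(unif m) = 1 / (m : ℝ) * ∑ i, f i := by
  simp [unif, integral_smul_measure, integral_count]

theorem Fin.sum_succ_sub_castSucc {B : ℕ} (f : Fin (B + 1) → ℝ) :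
    ∑ b : Fin B, (f b.succ - f b.castSucc) = f (Fin.last B) - f 0 := by
  induction B with
  | zero => simp
  | succ B ih =>
    rw [Fin.sum_univ_castSucc]
    have := ih (fun l => f l.castSucc)
    simp only [Fin.castSucc_zero] at this
    simp only [Fin.succ_castSucc, Fin.succ_last, this]
    ring

/-- The adjointness behind backpropagation: after exchanging source and target sums, the terms `g`
transported through the weights appear with both signs and cancel, leaving only the contribution `f`
of the varying weights. -/
theorem mean_sub_mean_swap {m : ℕ} (r : ℝ) (p : Fin m → ℝ) (f g : Fin m → Fin m → ℝ) :
    r * ∑ j, (p j + (r * ∑ i, f i j + r * ∑ i, g i j)) - r * ∑ i, (p i + r * ∑ j, g i j)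
      = r * r * ∑ i, ∑ j, f i j := by
  simp only [Finset.sum_add_distrib, ← Finset.mul_sum]
  rw [Finset.sum_comm (f := fun j i => f i j), Finset.sum_comm (f := fun j i => g i j)]
  ring

section Net

variable {N d m B : ℕ} {Y : Type*} (M : Model N d Y) (w : Weights d m B)

/-- A discrete network as a state over its units. -/
def netState : State N d B (Fin m) where
  first j i := w (.first i j)
  hidden b i j := w (.hidden b i j)
  last i := w (.last i)
  α := residual M w
  β := feature M w

theorem feature_zero (j : Fin m) (n : Fin N) :
    feature M w 0 j n = 1 / (d : ℝ) * ∑ i, w (.first i j) * M.X n i := by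
  simp [feature]

theorem feature_succ (b : Fin B) (j : Fin m) (n : Fin N) :
    feature M w b.succ j n = M.h₂ (residual M w b j n) + feature M w b.castSucc j n := by
  simp [feature, residual]

theorem netState_forward : (netState M w).Forward M (unif m) where
  zero j n := by
    refine (feature_zero M w j n).trans ?_
    simp only [mul_comm (w _)]
    rfl
  succ b j n := feature_succ M w b j n
  res b j n := by
    rw [integral_unif]
    rfl

theorem netState_meas : (netState M w).Meas where
  first _ := Measurable.of_discrete
  hidden _ := Measurable.of_discrete
  last := Measurable.of_discrete
  α _ _ := Measurable.of_discrete
  β _ _ := Measurable.of_discrete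

theorem netState_out : (netState M w).out M (unif m) = output M w := by
  ext n
  simp only [State.out, integral_unif]
  rfl

/-- Derivative of the features along a curve of weights with velocity `u`. -/
def dFeature (u : Weights d m B) : Fin (B + 1) → Fin m → Fin N → ℝ :=
  Fin.induction (motive := fun _ => Fin m → Fin N → ℝ)
    (fun j n => (1 / (d : ℝ)) * ∑ i, u (.first i j) * M.X n i)
    (fun b g j n => deriv M.h₂ (residual M w b j n) *
        ((1 / (m : ℝ)) * ∑ i, (u (.hidden b i j) * M.h₁ (feature M w b.castSucc i n)
          + w (.hidden b i j) * (deriv M.h₁ (feature M w b.castSucc i n) * g i n))) + g j n)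

theorem dFeature_zero (u : Weights d m B) (j : Fin m) (n : Fin N) :
    dFeature M w u 0 j n = 1 / (d : ℝ) * ∑ i, u (.first i j) * M.X n i := by
  simp [dFeature]

theorem dFeature_succ (u : Weights d m B) (b : Fin B) (j : Fin m) (n : Fin N) :
    dFeature M w u b.succ j n = deriv M.h₂ (residual M w b j n) *
        ((1 / (m : ℝ)) * ∑ i, (u (.hidden b i j) * M.h₁ (feature M w b.castSucc i n)
          + w (.hidden b i j) * (deriv M.h₁ (feature M w b.castSucc i n)
            * dFeature M w u b.castSucc i n))) + dFeature M w u b.castSucc j n := by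
  simp [dFeature]

variable {M}

theorem hasDerivAt_feature {c : ℝ} (hM : M.Tame c) {W : ℝ → Weights d m B} {u : Weights d m B}
    {x : ℝ} (hW : ∀ e, HasDerivAt (fun z => W z e) (u e) x) (l : Fin (B + 1)) (j : Fin m)
    (n : Fin N) : HasDerivAt (fun z => feature M (W z) l j n) (dFeature M (W x) u l j n) x := by
  induction l using Fin.induction generalizing j with
  | zero =>
    simp only [feature_zero, dFeature_zero]
    exact (HasDerivAt.fun_sum fun i _ => (hW (.first i j)).mul_const (M.X n i)).const_mul _
  | succ b ih =>
    simp only [feature_succ, dFeature_succ]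
    have h1 : HasDerivAt (fun z => residual M (W z) b j n) _ x :=
      (HasDerivAt.fun_sum fun i _ => (hW (.hidden b i j)).fun_mul
        ((hM.diff_h₁ (feature M (W x) b.castSucc i n)).hasDerivAt.comp x (ih i))).const_mul
          (1 / (m : ℝ))
    exact (((hM.diff_h₂ (residual M (W x) b j n)).hasDerivAt.comp x h1)).fun_add (ih j)

theorem hasDerivAt_loss {c : ℝ} (hM : M.Tame c) {W : ℝ → Weights d m B} {u : Weights d m B}
    {x : ℝ} (hW : ∀ e, HasDerivAt (fun z => W z e) (u e) x) :
    HasDerivAt (fun z => loss M (W z)) (1 / (N : ℝ) * ∑ n, M.dφ n (output M (W x) n)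
      * (1 / (m : ℝ) * ∑ i, (u (.last i) * M.h₁ (feature M (W x) (Fin.last B) i n)
        + W x (.last i) * (deriv M.h₁ (feature M (W x) (Fin.last B) i n)
          * dFeature M (W x) u (Fin.last B) i n)))) x := by
  refine (HasDerivAt.fun_sum fun n _ => ?_).const_mul _
  have h1 : HasDerivAt (fun z => output M (W z) n) _ x :=
    (HasDerivAt.fun_sum fun i _ => (hW (.last i)).fun_mul
      ((hM.diff_h₁ (feature M (W x) (Fin.last B) i n)).hasDerivAt.comp x
        (hasDerivAt_feature hM hW (Fin.last B) i n))).const_mul (1 / (m : ℝ))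
  exact (hM.diff_φ (M.y n) (output M (W x) n)).hasDerivAt.comp x h1

/-- The pairing of backward propagation with the derivative of the features of layer `l`. -/
def pairing (M : Model N d Y) (w u : Weights d m B) (l : Fin (B + 1)) : ℝ :=
  1 / (N : ℝ) * ∑ n, 1 / (m : ℝ) * ∑ i,
    (netState M w).back M (unif m) l i n * dFeature M w u l i n

/-- The backward recursion is the transpose of the linearised forward recursion. Passing one layer
down, the contributions through the features below agree on both sides, so the pairing changes
exactly by the contribution of the weights between the two layers. -/
theorem pairing_succ (u : Weights d m B) (b : Fin B) :
    pairing M w u b.succ - pairing M w u b.castSucc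
      = 1 / (m : ℝ) * (1 / (m : ℝ)) * ∑ i, ∑ j,
        (netState M w).gradHidden M (unif m) b i j * u (.hidden b i j) := by
  have key : ∀ n, 1 / (m : ℝ) * ∑ j, (netState M w).back M (unif m) b.succ j n
        * dFeature M w u b.succ j n
      - 1 / (m : ℝ) * ∑ i, (netState M w).back M (unif m) b.castSucc i n
        * dFeature M w u b.castSucc i n
      = 1 / (m : ℝ) * (1 / (m : ℝ)) * ∑ i, ∑ j, ((netState M w).backα M (unif m) b j n
        * M.h₁ (feature M w b.castSucc i n)) * u (.hidden b i j) := by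
    intro n
    have e1 : ∀ j, (netState M w).back M (unif m) b.succ j n * dFeature M w u b.succ j n
        = (netState M w).back M (unif m) b.succ j n * dFeature M w u b.castSucc j n
          + (1 / (m : ℝ) * ∑ i, (netState M w).backα M (unif m) b j n
              * M.h₁ (feature M w b.castSucc i n) * u (.hidden b i j)
            + 1 / (m : ℝ) * ∑ i, (netState M w).backα M (unif m) b j n * (w (.hidden b i j)
              * (deriv M.h₁ (feature M w b.castSucc i n) * dFeature M w u b.castSucc i n))) := by
      intro j
      rw [dFeature_succ, ← mul_add, ← Finset.sum_add_distrib]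
      have : ∀ i, (netState M w).backα M (unif m) b j n * M.h₁ (feature M w b.castSucc i n)
            * u (.hidden b i j) + (netState M w).backα M (unif m) b j n * (w (.hidden b i j)
              * (deriv M.h₁ (feature M w b.castSucc i n) * dFeature M w u b.castSucc i n))
          = (netState M w).backα M (unif m) b j n * (u (.hidden b i j)
            * M.h₁ (feature M w b.castSucc i n) + w (.hidden b i j)
              * (deriv M.h₁ (feature M w b.castSucc i n) * dFeature M w u b.castSucc i n)) := by
        intro i
        ring
      simp only [this, ← Finset.mul_sum]
      simp only [State.backα]
      change _ = _ + 1 / (m : ℝ) * (_ * deriv M.h₂ (residual M w b j n) * _)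
      ring
    have e2 : ∀ i, (netState M w).back M (unif m) b.castSucc i n * dFeature M w u b.castSucc i n
        = (netState M w).back M (unif m) b.succ i n * dFeature M w u b.castSucc i n
          + 1 / (m : ℝ) * ∑ j, (netState M w).backα M (unif m) b j n * (w (.hidden b i j)
              * (deriv M.h₁ (feature M w b.castSucc i n) * dFeature M w u b.castSucc i n)) := by
      intro i
      rw [back_castSucc, integral_unif]
      have : ∀ j, (netState M w).backα M (unif m) b j n * (w (.hidden b i j)
              * (deriv M.h₁ (feature M w b.castSucc i n) * dFeature M w u b.castSucc i n))
          = ((netState M w).hidden b i j * (netState M w).backα M (unif m) b j n)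
              * (deriv M.h₁ (feature M w b.castSucc i n) * dFeature M w u b.castSucc i n) := by
        intro j
        simp only [netState]
        ring
      simp only [this, ← Finset.sum_mul]
      change (_ + _ * deriv M.h₁ (feature M w b.castSucc i n)) * _ = _
      ring
    simp only [e1, e2]
    exact mean_sub_mean_swap _ _
      (fun i j => (netState M w).backα M (unif m) b j n
        * M.h₁ (feature M w b.castSucc i n) * u (.hidden b i j))
      (fun i j => (netState M w).backα M (unif m) b j n * (w (.hidden b i j)
        * (deriv M.h₁ (feature M w b.castSucc i n) * dFeature M w u b.castSucc i n)))
  unfold pairing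
  rw [← mul_sub, ← Finset.sum_sub_distrib]
  simp only [key, State.gradHidden]
  simp only [mul_assoc, Finset.sum_mul, ← Finset.mul_sum]
  rw [mul_left_comm, mul_left_comm (1 / (N : ℝ))]
  congr 3
  rw [Finset.sum_comm]
  refine Finset.sum_congr rfl fun i _ => ?_
  rw [Finset.sum_comm]
  rfl

theorem pairing_zero (u : Weights d m B) : pairing M w u 0
    = 1 / (m : ℝ) * (1 / (d : ℝ)) * ∑ j, ∑ i,
      (netState M w).gradFirst M (unif m) j i * u (.first i j) := by
  unfold pairing State.gradFirst
  simp only [dFeature_zero, Finset.sum_mul, Finset.mul_sum]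
  rw [Finset.sum_comm]
  refine Finset.sum_congr rfl fun j _ => ?_
  rw [Finset.sum_comm]
  refine Finset.sum_congr rfl fun i _ => Finset.sum_congr rfl fun n _ => ?_
  ring

/-- The derivative of the loss along a curve of weights is the pairing of its velocity with the
gradients found by backward propagation. -/
theorem loss_deriv_eq (u : Weights d m B) :
    1 / (N : ℝ) * ∑ n, M.dφ n (output M w n)
      * (1 / (m : ℝ) * ∑ i, (u (.last i) * M.h₁ (feature M w (Fin.last B) i n)
        + w (.last i) * (deriv M.h₁ (feature M w (Fin.last B) i n)
          * dFeature M w u (Fin.last B) i n)))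
    = 1 / (m : ℝ) * ∑ i, (netState M w).gradLast M (unif m) i * u (.last i)
      + ∑ b, 1 / (m : ℝ) * (1 / (m : ℝ)) * ∑ i, ∑ j,
        (netState M w).gradHidden M (unif m) b i j * u (.hidden b i j)
      + 1 / (m : ℝ) * (1 / (d : ℝ)) * ∑ j, ∑ i,
        (netState M w).gradFirst M (unif m) j i * u (.first i j) := by
  rw [← pairing_zero, add_assoc]
  simp only [← pairing_succ]
  -- The layer increments telescope. What remains is the pairing at the top layer, which is the
  -- derivative of the loss without the variation of the last weights.
  rw [Fin.sum_succ_sub_castSucc, sub_add_cancel]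
  unfold pairing State.gradLast
  simp only [back_last, netState_out, Finset.sum_mul, Finset.mul_sum, mul_add,
    Finset.sum_add_distrib]
  congr 1
  · rw [Finset.sum_comm]
    refine Finset.sum_congr rfl fun j _ => Finset.sum_congr rfl fun n _ => ?_
    simp only [netState]
    ring
  · refine Finset.sum_congr rfl fun j _ => Finset.sum_congr rfl fun n _ => ?_
    simp only [netState]
    ring

/-- The gradients found by backward propagation, as weights. -/
def backGradient (M : Model N d Y) (w : Weights d m B) : Weights d m B
  | .first i j => (netState M w).gradFirst M (unif m) j i
  | .hidden b i j => (netState M w).gradHidden M (unif m) b i j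
  | .last i => (netState M w).gradLast M (unif m) i

open Classical in
theorem hasDerivAt_update (e e' : Edge d m B) :
    HasDerivAt (fun z => Function.update w e z e') (if e' = e then 1 else 0) (w e) := by
  by_cases he : e' = e
  · subst he
    simpa using hasDerivAt_id' (w e')
  · simpa [he] using hasDerivAt_const (w e) (w e')

-- A partial derivative is the derivative along the curve that moves the single weight `e`; its
-- velocity is the indicator of `e`, and inserting it into `loss_deriv_eq` gives the formula.
open Classical in
theorem gradient_eq {c : ℝ} (hM : M.Tame c) (e : Edge d m B) :
    gradient M w e = 1 / (m : ℝ) * ∑ i, (netState M w).gradLast M (unif m) i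
        * (if .last i = e then 1 else 0)
      + ∑ b, 1 / (m : ℝ) * (1 / (m : ℝ)) * ∑ i, ∑ j,
        (netState M w).gradHidden M (unif m) b i j * (if .hidden b i j = e then 1 else 0)
      + 1 / (m : ℝ) * (1 / (d : ℝ)) * ∑ j, ∑ i,
        (netState M w).gradFirst M (unif m) j i * (if .first i j = e then 1 else 0) := by
  have h1 := (hasDerivAt_loss hM (W := fun z => Function.update w e z)
    (u := fun e' => if e' = e then 1 else 0) (hasDerivAt_update w e)).deriv
  simp only [Function.update_eq_self] at h1
  have h2 := loss_deriv_eq (M := M) w (fun e' => if e' = e then 1 else 0)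
  beta_reduce at h2
  rw [h2] at h1
  exact h1

/-- The indicator selects one term, and the product of the two widths undoes the two averages in
front of it. Scaled gradient descent is thereby the Euler scheme for the drift of the network
regarded as a state over `unif m`. -/
theorem scale_mul_gradient {c : ℝ} (hM : M.Tame c) (hd : 0 < d) (hm : 0 < m) (e : Edge d m B) :
    e.scale * gradient M w e = backGradient M w e := by
  classical
  have hd' : (d : ℝ) ≠ 0 := by positivity
  have hm' : (m : ℝ) ≠ 0 := by positivity
  rw [gradient_eq w hM]
  cases e with
  | first i j =>
    have : ∀ j' i', (netState M w).gradFirst M (unif m) j' i'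
          * (if (Edge.first i' j' : Edge d m B) = .first i j then 1 else 0)
        = if j' = j then if i' = i then (netState M w).gradFirst M (unif m) j' i' else 0 else 0 := by
      intro j' i'
      by_cases h1 : j' = j <;> by_cases h2 : i' = i <;> simp [h1, h2]
    simp only [this, Edge.scale, backGradient, reduceCtorEq, if_false, mul_zero,
      Finset.sum_const_zero, zero_add, Finset.sum_ite_irrel, Finset.sum_ite_eq', Finset.mem_univ,
      if_true]
    field_simp
  | hidden b i j =>
    have : ∀ b' i' j', (netState M w).gradHidden M (unif m) b' i' j'
          * (if (Edge.hidden b' i' j' : Edge d m B) = .hidden b i j then 1 else 0)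
        = if b' = b then if i' = i then if j' = j then
            (netState M w).gradHidden M (unif m) b' i' j' else 0 else 0 else 0 := by
      intro b' i' j'
      by_cases h1 : b' = b <;> by_cases h2 : i' = i <;> by_cases h3 : j' = j <;> simp [h1, h2, h3]
    simp only [this, Edge.scale, backGradient, reduceCtorEq, if_false, mul_zero,
      Finset.sum_const_zero, zero_add, add_zero, ← Finset.mul_sum, Finset.sum_ite_irrel,
      Finset.sum_ite_eq', Finset.mem_univ, if_true]
    field_simp
  | last i =>
    simp only [Edge.scale, backGradient, reduceCtorEq, if_false, mul_zero, Finset.sum_const_zero,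
      add_zero, Edge.last.injEq, mul_ite, mul_one, Finset.sum_ite_eq', Finset.mem_univ, if_true]
    field_simp

theorem gdStep_apply {c : ℝ} (hM : M.Tame c) (hd : 0 < d) (hm : 0 < m) (η : ℝ) (e : Edge d m B) :
    gdStep M w η e = w e - η * backGradient M w e := by
  rw [gdStep, mul_assoc, scale_mul_gradient w hM hd hm]

end Net

end ResNet
end


/-! ### Comparison of gradient descent with the flow on a fixed sample -/

noncomputable section

namespace ResNet

open Set State

/-- Stability constant of forward propagation. -/
def forwardConst (B : ℕ) (c : ℝ) : ℝ := (fun k => 5 * c ^ 4 * k)^[B + 1] c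

/-- Stability constant of backward propagation. -/
def backConst (B : ℕ) (c : ℝ) : ℝ := (fun k => 12 * c ^ 5 * k)^[B] (3 * c ^ 3)

/-- Stability constant of the output. -/
def outConst (B : ℕ) (c : ℝ) : ℝ := 3 * c ^ 3 * forwardConst B c

/-- Stability constant of the gradient. -/
def gradConst (B : ℕ) (c : ℝ) : ℝ := 3 * c ^ 3 * backConst B c * outConst B c

theorem le_forwardConst (B : ℕ) {c : ℝ} (c1 : 1 ≤ c) : c ≤ forwardConst B c :=
  iterate_mono (j := 0) (fun k hk => by nlinarith [one_le_pow₀ c1 (n := 4)]) c1 (Nat.zero_le _)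

theorem one_le_backConst (B : ℕ) {c : ℝ} (c1 : 1 ≤ c) : 1 ≤ backConst B c :=
  le_iterate (fun k hk => by nlinarith [one_le_pow₀ c1 (n := 5)])
    (by nlinarith [one_le_pow₀ c1 (n := 3)]) B

/-- The averages over the sample `θ` in forward and backward propagation are close to the
integrals. -/
structure Concentrated {N d B m : ℕ} {Y S : Type*} [MeasurableSpace S] (M : Model N d Y)
    (μ : Measure S) (X : State N d B S) (s : S → ℝ) (θ : Fin m → S) (ε : ℝ) : Prop where
  out : ∀ n, |1 / (m : ℝ) * ∑ i, X.last (θ i) * M.h₁ (X.β (Fin.last B) (θ i) n) - X.out M μ n| ≤ ε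
  res : ∀ b j n, |1 / (m : ℝ) * ∑ i, X.hidden b (θ i) (θ j) * M.h₁ (X.β b.castSucc (θ i) n)
    - ∫ y, X.hidden b y (θ j) * M.h₁ (X.β b.castSucc y n) ∂μ| ≤ ε * s (θ j)
  back : ∀ b i n, |1 / (m : ℝ) * ∑ j, X.hidden b (θ i) (θ j) * X.backα M μ b (θ j) n
    - ∫ y, X.hidden b (θ i) y * X.backα M μ b y n ∂μ| ≤ ε * s (θ i)

section Comap

variable {N d B m : ℕ} {S : Type*} {s : S → ℝ} {c e : ℝ}

theorem State.Bdd.comap {X : State N d B S} (h : X.Bdd s c) (θ : Fin m → S) :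
    (X.comap θ).Bdd (s ∘ θ) c :=
  ⟨fun _ => h.last _, fun _ _ _ => h.hidden _ _ _⟩

theorem State.WeightsClose.comap {X X' : State N d B S} (h : WeightsClose s e X X')
    (θ : Fin m → S) : WeightsClose (s ∘ θ) e (X.comap θ) (X'.comap θ) :=
  ⟨fun _ => h.first _, fun _ _ _ => h.hidden _ _ _, fun _ => h.last _⟩

theorem State.FeaturesClose.comap {X X' : State N d B S} (h : FeaturesClose s e X X')
    (θ : Fin m → S) : FeaturesClose (s ∘ θ) e (X.comap θ) (X'.comap θ) :=
  ⟨fun _ _ _ => h.α _ _ _, fun _ _ _ => h.β _ _ _⟩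

theorem State.comap_meas (X : State N d B S) (θ : Fin m → S) : (X.comap θ).Meas where
  first _ := Measurable.of_discrete
  hidden _ := Measurable.of_discrete
  last := Measurable.of_discrete
  α _ _ := Measurable.of_discrete
  β _ _ := Measurable.of_discrete

end Comap

section Compare

variable {N d B m : ℕ} {Y S : Type*} [MeasurableSpace S] {M : Model N d Y} {μ : Measure S}
  {s : S → ℝ} {c e ε : ℝ} {θ : Fin m → S} {w : Weights d m B}

/-- A discrete network whose weights are close to those of a state along a sample has close
features, output and gradients. -/
theorem compare_net (hM : M.Tame c) (hs : IsWeight (unif m) (s ∘ θ) c) {X : State N d B S}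
    (hX : X.Forward M μ) (hb : X.Bdd s c) (hback : ∀ l x n, |X.back M μ l x n| ≤ c)
    (hc : Concentrated M μ X s θ ε) (hε : ε ≤ e) (he : 0 ≤ e) (he1 : outConst B c * e ≤ 1)
    (hw : WeightsClose (s ∘ θ) e (netState M w) (X.comap θ)) :
    FeaturesClose (s ∘ θ) (outConst B c * e) (netState M w) (X.comap θ) ∧
      (∀ n, |output M w n - X.out M μ n| ≤ outConst B c * e) ∧
      WeightsClose (s ∘ θ) (gradConst B c * e) ((netState M w).drift M (unif m))
        ((X.drift M μ).comap θ) := by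
  have c1 := hM.one_le
  have hcF := le_forwardConst B c1
  have hF1 : 1 ≤ forwardConst B c := c1.trans hcF
  have c3 : 1 ≤ c ^ 3 := one_le_pow₀ c1
  have hs0 : ∀ i, 0 ≤ (s ∘ θ) i := fun i => (hs.pos i).le
  have hFO : forwardConst B c * e ≤ outConst B c * e := by
    unfold outConst
    gcongr
    nlinarith
  have heF : e ≤ forwardConst B c * e := le_mul_of_one_le_left he hF1
  -- The flow restricted to the sample solves the empirical forward equations up to the sampling
  -- error, because it solves the exact ones.
  have hf := forward_stability hM hs he (netState_meas M w) (X.comap_meas θ) (hb.comap θ) hw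
    (netState_forward M w).zero (netState_forward M w).succ (netState_forward M w).res
    (fun x n => hX.zero _ _) (fun b x n => hX.succ _ _ _) (fun b j n => by
      have h1 := hc.res b j n
      rw [← hX.res, abs_sub_comm] at h1
      rw [integral_unif]
      exact h1.trans (mul_le_mul_of_nonneg_right hε (hs0 j)))
  change FeaturesClose _ (forwardConst B c * e) _ _ at hf
  have ho : ∀ n, |output M w n - X.out M μ n| ≤ outConst B c * e := fun n => by
    have h1 := out_stability hM hs (by positivity) (netState_meas M w) (X.comap_meas θ)
      (hb.comap θ) (hw.mono hs0 heF).last (hf.β _) n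
    have h2 := hc.out n
    rw [netState_out] at h1
    have h4 : |(X.comap θ).out M (unif m) n - X.out M μ n| ≤ ε := by
      rw [State.out, integral_unif]
      exact h2
    -- Of the factor `3` in `outConst`, two units come from `out_stability`; the third covers the
    -- sampling error of the output.
    have h3 : e ≤ c ^ 3 * (forwardConst B c * e) :=
      heF.trans (le_mul_of_one_le_left (by positivity) c3)
    refine (abs_sub_le _ _ _).trans ((add_le_add h1 h4).trans ?_)
    unfold outConst
    nlinarith
  have hf' := hf.mono hs0 hFO
  have hw' := hw.mono hs0 (heF.trans hFO)
  have ho' : ∀ n, |(netState M w).out M (unif m) n - X.out M μ n| ≤ outConst B c * e := fun n => by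
    rw [netState_out]
    exact ho n
  have hO0 : 0 ≤ outConst B c * e := by
    unfold outConst
    positivity
  refine ⟨hf', ho, ?_⟩
  -- The reference signal is the one of the flow, computed with `μ` and evaluated at the sample
  -- points. It satisfies the empirical backward equations up to the sampling error times the bound
  -- on the derivative of `M.h₁`.
  have hD := back_stability hM hs hO0 he1 (netState_meas M w) (X.comap_meas θ) (hb.comap θ) hw' hf'
    ho' (D := fun l i => X.back M μ l (θ i)) (fun _ _ => Measurable.of_discrete)
    (fun l i n => hback l _ n) (fun i n => X.back_last M μ (θ i) n) (fun b i n => by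
      rw [integral_unif, back_castSucc]
      have h1 := hc.back b i n
      have h2 := abs_mul_le_mul h1 (hM.dh₁_le (X.β b.castSucc (θ i) n))
      rw [← abs_neg] at h2
      refine (le_of_eq ?_).trans (h2.trans ?_)
      · congr 1
        simp only [State.backα, State.comap]
        ring
      · have : 0 ≤ s (θ i) := hs0 i
        have h3 : ε * c ≤ outConst B c * e := by
          have : ε * c ≤ e * forwardConst B c := by gcongr
          linarith
        calc ε * s (θ i) * c = ε * c * s (θ i) := by ring
          _ ≤ _ := by gcongr; rfl)
  have := grad_stability hM hs.one_le hO0 (one_le_backConst B c1) hf' ho'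
    (D := fun l i => X.back M μ l (θ i)) (fun l i n => hback l _ n) hD
    (G := (X.drift M μ).comap θ) (fun _ => rfl) (fun _ _ _ => rfl) (fun _ _ => rfl)
  exact this.mono hs0 (le_of_eq (by unfold gradConst; ring))

end Compare

section Descent

variable {N d B m : ℕ} {Y S : Type*} [MeasurableSpace S] {M : Model N d Y} {μ : Measure S}
  {T : ℝ} {X : ℝ → State N d B S} {s : S → ℝ} {c ε η : ℝ} {θ : Fin m → S} {w : Weights d m B}

/-- Growth rate of the error of gradient descent. -/
def rateConst (B : ℕ) (c : ℝ) : ℝ :=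
  gradConst B c * (1 + 2 * driftBound B c)
    + 3 * c ^ 3 * backConst B c * (2 * c ^ 3 * driftBound B c)

/-- Bound for the error of gradient descent. -/
def descentConst (B : ℕ) (c T : ℝ) : ℝ :=
  4 * outConst B c * (2 * Real.exp (rateConst B c * T) + 2 * driftBound B c)

/-- Local error of an Euler step: the new deviation is the old one minus the integral over the step
of `g` minus the drift. -/
theorem BddFlow.abs_step_sub_le [SFinite μ] (h : BddFlow M μ s c T X) (k : Comp N d B S)
    {t a g x y : ℝ} (hη : 0 ≤ η) (ht : t ∈ Icc 0 T) (ht' : t + η ∈ Icc 0 T)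
    (hx : |a - (X t).val k| ≤ x)
    (hy : ∀ r ∈ Icc t (t + η), |g - ((X r).drift M μ).val k| ≤ y) :
    |(a - η * g) - (X (t + η)).val k| ≤ x + y * η := by
  have h1 := h.val_sub_val k ht ht'
  have h2 : ∫ r in t..(t + η), (g - ((X r).drift M μ).val k)
      = η * g - ∫ r in t..(t + η), ((X r).drift M μ).val k := by
    rw [intervalIntegral.integral_sub intervalIntegrable_const (h.intervalIntegrable_drift k ht ht')]
    simp
  have h3 := intervalIntegral.norm_integral_le_of_norm_le_const (a := t) (b := t + η) (C := y)
    (f := fun r => g - ((X r).drift M μ).val k) fun r hr => by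
      rw [uIoc_of_le (by linarith)] at hr
      exact hy r ⟨hr.1.le, hr.2⟩
  rw [h2, add_sub_cancel_left, abs_of_nonneg hη, Real.norm_eq_abs] at h3
  have h4 : (a - η * g) - (X (t + η)).val k = (a - (X t).val k)
      - (η * g - ∫ r in t..(t + η), ((X r).drift M μ).val k) := by linarith
  rw [h4]
  exact (abs_sub _ _).trans (add_le_add hx h3)

/-- One step of gradient descent. -/
theorem BddFlow.step_close [SFinite μ] (h : BddFlow M μ s c T X) (h0 : (X 0).Forward M μ)
    (hθ : IsWeight (unif m) (s ∘ θ) c) (hd : 0 < d) (hm : 0 < m)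
    (conc : ∀ r ∈ Icc 0 T, ∃ τ ∈ Icc 0 T, |r - τ| ≤ ε ∧ Concentrated M μ (X τ) s θ ε)
    (hη : 0 < η) (hηε : η ≤ ε) {t A : ℝ} (ht : t ∈ Icc 0 T) (ht' : t + η ∈ Icc 0 T)
    (hA : ε ≤ A) (hA1 : outConst B c * (A + 2 * driftBound B c * ε) ≤ 1)
    (hw : WeightsClose (s ∘ θ) A (netState M w) ((X t).comap θ)) :
    WeightsClose (s ∘ θ) (A + rateConst B c * (A + ε) * η) (netState M (gdStep M w η))
      ((X (t + η)).comap θ) := by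
  have c1 := h.tame.one_le
  have D1 := one_le_driftBound B c1
  have F1 : 1 ≤ forwardConst B c := c1.trans (le_forwardConst B c1)
  have ε0 : 0 < ε := hη.trans_le hηε
  have B1 := one_le_backConst B c1
  have O0 : 0 ≤ outConst B c := by unfold outConst; positivity
  have G0 : 0 ≤ gradConst B c := by unfold gradConst; positivity
  have hs0 : ∀ i, 0 ≤ (s ∘ θ) i := fun i => (hθ.pos i).le
  -- Concentration is available only near `r`, at a time `τ`. The network is compared with the flow
  -- at `τ`, at distance at most `2 * ε` from `t`, and then the drift of the flow is moved from `τ`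
  -- to `r`.
  have drift : ∀ r ∈ Icc t (t + η), WeightsClose (s ∘ θ) (rateConst B c * (A + ε))
      ((netState M w).drift M (unif m)) (((X r).drift M μ).comap θ) := by
    intro r hr
    have hrT : r ∈ Icc 0 T := ⟨ht.1.trans hr.1, hr.2.trans ht'.2⟩
    obtain ⟨τ, hτ, hrτ, hc⟩ := conc r hrT
    have h1 : |t - τ| ≤ 2 * ε := by
      have h2 := abs_sub_le t r τ
      have h3 : |t - r| ≤ η := by
        rw [abs_sub_comm, abs_of_nonneg (by linarith [hr.1])]
        linarith [hr.2]
      linarith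
    have hw1 := hw.trans (((h.weightsClose_time hτ ht).comap θ).mono hs0
      (mul_le_mul_of_nonneg_left h1 (by positivity)))
    have hcmp := (compare_net h.tame hθ (h.forward h0 hτ) (h.bdd τ hτ) (h.back_le τ hτ) hc
      (by nlinarith) (by nlinarith) (le_of_eq_of_le (by ring) hA1) hw1).2.2
    have ht1 := h.drift_time (e := 2 * c ^ 3 * driftBound B c * ε) hrT hτ
      (by rw [abs_sub_comm]; gcongr) (by
        refine le_trans ?_ hA1
        have h5 : 2 * c ^ 3 ≤ outConst B c := by
          unfold outConst
          nlinarith [one_le_pow₀ c1 (n := 3)]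
        calc 2 * c ^ 3 * driftBound B c * ε = 2 * c ^ 3 * (driftBound B c * ε) := by ring
          _ ≤ outConst B c * (A + 2 * driftBound B c * ε) := by
            gcongr
            nlinarith)
    refine (hcmp.trans (ht1.comap θ)).mono hs0 ?_
    change _ + 3 * c ^ 3 * backConst B c * _ ≤ _
    unfold rateConst
    have h6 : 0 ≤ 3 * c ^ 3 * backConst B c * (2 * c ^ 3 * driftBound B c) := by positivity
    have h7 : 0 ≤ A := by linarith
    have h8 : 0 ≤ gradConst B c * driftBound B c := by positivity
    nlinarith [mul_nonneg h6 h7, mul_nonneg G0 ε0.le, mul_nonneg h8 h7]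
  refine ⟨fun j i => ?_, fun b i j => ?_, fun i => ?_⟩
  · have := h.abs_step_sub_le (.first (θ j) i) hη.le ht ht' (hw.first j i)
      fun r hr => (drift r hr).first j i
    refine (le_of_eq ?_).trans (this.trans_eq (by ring))
    simp only [netState, gdStep_apply w h.tame hd hm]
    rfl
  · have := h.abs_step_sub_le (.hidden b (θ i) (θ j)) hη.le ht ht' (hw.hidden b i j)
      fun r hr => (drift r hr).hidden b i j
    refine (le_of_eq ?_).trans (this.trans_eq (by ring))
    simp only [netState, gdStep_apply w h.tame hd hm]
    rfl
  · have := h.abs_step_sub_le (.last (θ i)) hη.le ht ht' (hw.last i)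
      fun r hr => (drift r hr).last i
    refine (le_of_eq ?_).trans (this.trans_eq (by ring))
    simp only [netState, gdStep_apply w h.tame hd hm]
    rfl

theorem gd_succ (η : ℝ) (k : ℕ) : gd M w η (k + 1) = gdStep M (gd M w η k) η := by
  simp only [gd, Function.iterate_succ_apply']

/-- Gradient descent stays close to the flow if the averages over the sample concentrate. -/
theorem BddFlow.gd_close [SFinite μ] (h : BddFlow M μ s c T X) (h0 : (X 0).Forward M μ)
    (hθ : IsWeight (unif m) (s ∘ θ) c) (hd : 0 < d) (hm : 0 < m)
    (conc : ∀ r ∈ Icc 0 T, ∃ τ ∈ Icc 0 T, |r - τ| ≤ ε ∧ Concentrated M μ (X τ) s θ ε)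
    (hη : 0 < η) (hηε : η ≤ ε) (hε : descentConst B c T * ε ≤ 1)
    (hw : WeightsClose (s ∘ θ) ε (netState M w) ((X 0).comap θ)) (k : ℕ) (hk : k * η ≤ T) :
    WeightsClose (s ∘ θ) (descentConst B c T * ε) (netState M (gd M w η k))
        ((X (k * η)).comap θ) ∧
      FeaturesClose (s ∘ θ) (descentConst B c T * ε) (netState M (gd M w η k))
        ((X (k * η)).comap θ) ∧
      ∀ n, |output M (gd M w η k) n - (X (k * η)).out M μ n| ≤ descentConst B c T * ε := by
  have c1 := h.tame.one_le
  have D1 := one_le_driftBound B c1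
  have F1 : 1 ≤ forwardConst B c := c1.trans (le_forwardConst B c1)
  have ε0 : 0 < ε := hη.trans_le hηε
  have B1 := one_le_backConst B c1
  have c3 : 1 ≤ c ^ 3 := one_le_pow₀ c1
  have O1 : 2 * c ^ 3 ≤ outConst B c := by
    unfold outConst
    nlinarith
  have O0 : 0 < outConst B c := by linarith
  have G0 : 0 ≤ gradConst B c := by unfold gradConst; positivity
  have R0 : 0 ≤ rateConst B c := by unfold rateConst; positivity
  have hs0 : ∀ i, 0 ≤ (s ∘ θ) i := fun i => (hθ.pos i).le
  have growth : ∀ k : ℕ, k * η ≤ T → (1 + rateConst B c * η) ^ k ≤ Real.exp (rateConst B c * T) := by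
    intro k hk
    calc (1 + rateConst B c * η) ^ k ≤ Real.exp (rateConst B c * η) ^ k := by
          gcongr
          linarith [Real.add_one_le_exp (rateConst B c * η)]
      _ = Real.exp (rateConst B c * (k * η)) := by
          rw [← Real.exp_nat_mul]
          ring_nf
      _ ≤ _ := by gcongr
  have hEε : outConst B c * (2 * Real.exp (rateConst B c * T) + 2 * driftBound B c) * ε ≤ 1 := by
    refine le_trans ?_ hε
    unfold descentConst
    gcongr
    linarith
  -- With rate `a`, the recursion of one step is `A ↦ A + a * (A + ε) * η`, so `A + ε` is multiplied
  -- by `1 + a * η`. Starting from `A = ε` it equals `2 * ε` times a power, which gives this closed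
  -- form.
  have weights : ∀ k : ℕ, k * η ≤ T →
      WeightsClose (s ∘ θ) (2 * ε * (1 + rateConst B c * η) ^ k - ε) (netState M (gd M w η k))
        ((X (k * η)).comap θ) := by
    intro k
    induction k with
    | zero =>
      intro _
      simp only [Nat.cast_zero, zero_mul, pow_zero]
      exact hw.mono hs0 (by linarith)
    | succ k ih =>
      intro hk
      have e1 : ((k + 1 : ℕ) : ℝ) * η = k * η + η := by push_cast; ring
      rw [e1] at hk ⊢
      have hk' : k * η ≤ T := by linarith
      have p1 : 1 ≤ (1 + rateConst B c * η) ^ k := one_le_pow₀ (by nlinarith)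
      have p2 := growth k hk'
      have kη : 0 ≤ k * η := by positivity
      have := h.step_close h0 hθ hd hm conc hη hηε ⟨kη, hk'⟩ ⟨by linarith, hk⟩ (by nlinarith)
        (le_trans ((mul_le_mul_of_nonneg_left (by nlinarith) O0.le).trans_eq
          (mul_assoc _ _ _).symm) hEε) (ih hk')
      rw [gd_succ]
      refine this.mono hs0 (le_of_eq ?_)
      rw [pow_succ]
      ring
  have p2 := growth k hk
  have kT : k * η ∈ Icc 0 T := ⟨by positivity, hk⟩
  -- Features and output are not iterated. They are read off from the weights at the end, through a
  -- nearby time at which the averages concentrate.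
  obtain ⟨τ, hτ, hrτ, hc⟩ := conc _ kT
  have hwk := (weights k hk).mono hs0
    (by nlinarith : _ ≤ 2 * Real.exp (rateConst B c * T) * ε)
  have x0 : 0 < Real.exp (rateConst B c * T) := Real.exp_pos _
  have x1 : 1 ≤ Real.exp (rateConst B c * T) :=
    (one_le_pow₀ (by nlinarith)).trans p2
  have hw1 := hwk.trans (((h.weightsClose_time hτ kT).comap θ).mono hs0
      (mul_le_mul_of_nonneg_left hrτ (by positivity)))
  have hle : outConst B c * (2 * Real.exp (rateConst B c * T) * ε + driftBound B c * ε)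
      ≤ outConst B c * (2 * Real.exp (rateConst B c * T) + 2 * driftBound B c) * ε :=
    (mul_le_mul_of_nonneg_left (by nlinarith) O0.le).trans_eq (mul_assoc _ _ _).symm
  obtain ⟨hf, ho, -⟩ := compare_net h.tame hθ (h.forward h0 hτ) (h.bdd τ hτ) (h.back_le τ hτ) hc
      (by nlinarith) (by positivity) (hle.trans hEε) hw1
  have hft := ((h.featuresClose_time kT hτ).comap θ).mono hs0
    (mul_le_mul_of_nonneg_left ((abs_sub_comm _ _).trans_le hrτ) (by positivity))
  have hot := fun n => h.abs_out_sub_le kT hτ n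
  have O2 : 1 ≤ outConst B c := by linarith
  have dε : driftBound B c * ε ≤ outConst B c * (driftBound B c * ε) :=
    le_mul_of_one_le_left (by positivity) O2
  have xε : Real.exp (rateConst B c * T) * ε
      ≤ outConst B c * (Real.exp (rateConst B c * T) * ε) :=
    le_mul_of_one_le_left (by positivity) O2
  have odε : 0 ≤ outConst B c * (driftBound B c * ε) := by positivity
  have oxε : 0 ≤ outConst B c * (Real.exp (rateConst B c * T) * ε) := by positivity
  refine ⟨hwk.mono hs0 ?_, (hf.trans hft).mono hs0 ?_, fun n => ?_⟩
  · unfold descentConst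
    nlinarith
  · unfold descentConst
    nlinarith
  · refine (abs_sub_le _ _ _).trans ((add_le_add (ho n) (hot n)).trans ?_)
    have : 2 * c ^ 3 * driftBound B c * |τ - k * η| ≤ outConst B c * (driftBound B c * ε) := by
      rw [mul_assoc, abs_sub_comm]
      gcongr
    unfold descentConst
    nlinarith

end Descent

end ResNet
end


/-! ### Sub-Gaussian concentration from a Gaussian moment of the weight -/

noncomputable section

namespace ResNet

open Set State

/-- The linear term has mean zero for a centred variable, so a bound on a moment of the square
suffices for the moment generating function near the origin. -/
theorem exp_le_add_exp_sq (x : ℝ) : Real.exp x ≤ x + Real.exp (x ^ 2) := by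
  have h := Real.add_one_le_exp (x ^ 2)
  rcases le_or_gt |x| 1 with hx | hx
  · have h1 := (abs_le.1 (Real.abs_exp_sub_one_sub_id_le hx)).2
    linarith
  · rcases lt_abs.1 hx with h1 | h1
    · have : Real.exp x ≤ Real.exp (x ^ 2) := Real.exp_le_exp.2 (by nlinarith)
      linarith
    · have : Real.exp x ≤ 1 := Real.exp_le_one_iff.2 (by linarith)
      nlinarith

/-- The chord bound of convexity. It plays the role of Jensen's inequality in passing from the one
exponent with a known moment to smaller ones. -/
theorem exp_mul_le {u : ℝ} (h0 : 0 ≤ u) (h1 : u ≤ 1) (z : ℝ) :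
    Real.exp (u * z) ≤ 1 + u * (Real.exp z - 1) := by
  have := convexOn_exp.2 (mem_univ 0) (mem_univ z) (sub_nonneg.2 h1) h0 (by ring)
  simp only [smul_eq_mul, mul_zero, zero_add, Real.exp_zero, mul_one] at this
  linarith

/-- A weight function with a Gaussian moment. -/
structure ExpWeight {S : Type*} [MeasurableSpace S] (μ : Measure S) (s : S → ℝ) (κ : ℝ) :
    Prop where
  pos : 0 < κ
  meas : Measurable s
  one_le : ∀ x, 1 ≤ s x
  integrable_exp : Integrable (fun x => Real.exp (κ * s x ^ 2)) μ
  exp_le : ∫ x, Real.exp (κ * s x ^ 2) ∂μ ≤ Real.exp 1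

namespace ExpWeight

variable {S : Type*} [MeasurableSpace S] {μ : Measure S} {s : S → ℝ} {κ K : ℝ}

theorem sq_le_exp (h : ExpWeight μ s κ) (x : S) : s x ^ 2 ≤ 1 / κ * Real.exp (κ * s x ^ 2) := by
  have hκ := h.pos
  have := Real.add_one_le_exp (κ * s x ^ 2)
  rw [one_div, inv_mul_eq_div, le_div_iff₀ hκ]
  linarith

theorem isWeight (h : ExpWeight μ s κ) : IsWeight μ s (3 / κ) := by
  have hκ := h.pos
  have hi : Integrable (fun x => s x ^ 2) μ :=
    (h.integrable_exp.const_mul (1 / κ)).mono' (h.meas.pow_const 2).aestronglyMeasurable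
      (Filter.Eventually.of_forall fun x => by
        rw [Real.norm_of_nonneg (sq_nonneg _)]
        exact h.sq_le_exp x)
  refine ⟨h.meas, h.one_le, hi, ?_⟩
  calc ∫ x, s x ^ 2 ∂μ ≤ ∫ x, 1 / κ * Real.exp (κ * s x ^ 2) ∂μ :=
        integral_mono hi (h.integrable_exp.const_mul _) h.sq_le_exp
    _ = 1 / κ * ∫ x, Real.exp (κ * s x ^ 2) ∂μ := integral_const_mul _ _
    _ ≤ 1 / κ * 3 := by
        gcongr
        exact h.exp_le.trans (by linarith [Real.exp_one_lt_d9])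
    _ = 3 / κ := by ring

/-- Young's inequality, balanced so that half of the available exponent `κ * s x ^ 2` is used. -/
theorem mul_le_add (h : ExpWeight μ s κ) (hK : 0 < K) {a : ℝ} {x : S} (ha : |a| ≤ K * s x)
    (t : ℝ) : t * a ≤ t ^ 2 * (K ^ 2 / κ) / 2 + κ * s x ^ 2 / 2 := by
  have hκ := h.pos
  have h1 : a ^ 2 ≤ (K * s x) ^ 2 := sq_le_sq' (by linarith [(abs_le.1 ha).1]) (abs_le.1 ha).2
  have h2 : κ / K ^ 2 * a ^ 2 ≤ κ * s x ^ 2 := by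
    calc κ / K ^ 2 * a ^ 2 ≤ κ / K ^ 2 * (K * s x) ^ 2 := by gcongr
      _ = κ * s x ^ 2 := by field_simp
  have h3 : 0 ≤ κ / K ^ 2 * (a - t * (K ^ 2 / κ)) ^ 2 := by positivity
  have h4 : κ / K ^ 2 * (a - t * (K ^ 2 / κ)) ^ 2
      = κ / K ^ 2 * a ^ 2 - 2 * (t * a) + t ^ 2 * (K ^ 2 / κ) := by
    field_simp
    ring
  linarith

/-- A centred function that is dominated by the weight is sub-Gaussian. -/
theorem hasSubgaussianMGF [IsProbabilityMeasure μ] (h : ExpWeight μ s κ) (hK : 0 < K) {g : S → ℝ}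
    (hg : Measurable g) (hgK : ∀ x, |g x| ≤ K * s x) (h0 : ∫ x, g x ∂μ = 0) :
    HasSubgaussianMGF g (Real.toNNReal (4 * K ^ 2 / κ)) μ := by
  have hκ := h.pos
  have hint : ∀ t : ℝ, Integrable (fun x => Real.exp (t * g x)) μ := fun t => by
    refine (h.integrable_exp.const_mul (Real.exp (t ^ 2 * (K ^ 2 / κ) / 2))).mono'
      (hg.const_mul t).exp.aestronglyMeasurable (Filter.Eventually.of_forall fun x => ?_)
    rw [Real.norm_of_nonneg (Real.exp_nonneg _), ← Real.exp_add]
    refine Real.exp_le_exp.2 ((h.mul_le_add hK (hgK x) t).trans ?_)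
    have : 0 ≤ κ * s x ^ 2 := by positivity
    linarith
  have hgi : Integrable g μ :=
    h.isWeight.integrable hg.aestronglyMeasurable fun x => (hgK x).trans
      (mul_le_mul_of_nonneg_left (h.isWeight.le_sq x) hK.le)
  have hE := h.exp_le
  have he := Real.exp_one_lt_d9
  refine ⟨hint, fun t => ?_⟩
  rw [Real.coe_toNNReal _ (by positivity)]
  have hu0 : 0 ≤ t ^ 2 * (K ^ 2 / κ) := by positivity
  have e1 : 4 * K ^ 2 / κ * t ^ 2 / 2 = 2 * (t ^ 2 * (K ^ 2 / κ)) := by ring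
  rw [e1, mgf]
  set u := t ^ 2 * (K ^ 2 / κ) with hu
  -- The target is `exp (2 * u)`. For `u ≤ 1` centring removes the linear term and the mean is at
  -- most `1 + 2 * u`. For `u > 1` Young's inequality, which ignores centring, gives `exp (u / 2 +
  -- 1)`, and this is small enough.
  rcases le_or_gt u 1 with hu1 | hu1
  · have hb : ∀ x, Real.exp (t * g x) ≤ t * g x + (1 - u + u * Real.exp (κ * s x ^ 2)) := by
      intro x
      have h1 := exp_le_add_exp_sq (t * g x)
      have h2 := exp_mul_le hu0 hu1 (κ * s x ^ 2)
      have h3 : (t * g x) ^ 2 ≤ u * (κ * s x ^ 2) := by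
        have h4 : g x ^ 2 ≤ (K * s x) ^ 2 :=
          sq_le_sq' (by linarith [(abs_le.1 (hgK x)).1]) (abs_le.1 (hgK x)).2
        calc (t * g x) ^ 2 = t ^ 2 * g x ^ 2 := by ring
          _ ≤ t ^ 2 * (K * s x) ^ 2 := by gcongr
          _ = _ := by rw [hu]; field_simp
      have h5 := Real.exp_le_exp.2 h3
      linarith
    have i1 : Integrable (fun x => t * g x) μ := hgi.const_mul t
    have i2 : Integrable (fun x => u * Real.exp (κ * s x ^ 2)) μ := h.integrable_exp.const_mul u
    have i3 : Integrable (fun x => 1 - u + u * Real.exp (κ * s x ^ 2)) μ :=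
      (integrable_const _).add i2
    calc ∫ x, Real.exp (t * g x) ∂μ
        ≤ ∫ x, t * g x + (1 - u + u * Real.exp (κ * s x ^ 2)) ∂μ :=
          integral_mono (hint t) (i1.add i3) hb
      _ = 1 - u + u * ∫ x, Real.exp (κ * s x ^ 2) ∂μ := by
          rw [integral_add i1 i3, integral_add (integrable_const _) i2, integral_const_mul,
            integral_const_mul, h0]
          simp
      _ ≤ 2 * u + 1 := by nlinarith
      _ ≤ _ := Real.add_one_le_exp _
  · have hb : ∀ x, Real.exp (t * g x)
        ≤ Real.exp (u / 2) * (1 / 2 + 1 / 2 * Real.exp (κ * s x ^ 2)) := by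
      intro x
      have h1 := Real.exp_le_exp.2 (h.mul_le_add hK (hgK x) t)
      rw [Real.exp_add] at h1
      refine h1.trans ?_
      gcongr
      have h2 := exp_mul_le (by norm_num) (by norm_num : (1 : ℝ) / 2 ≤ 1) (κ * s x ^ 2)
      rw [one_div_mul_eq_div] at h2
      linarith
    have i2 : Integrable (fun x => 1 / 2 * Real.exp (κ * s x ^ 2)) μ :=
      h.integrable_exp.const_mul _
    calc ∫ x, Real.exp (t * g x) ∂μ
        ≤ ∫ x, Real.exp (u / 2) * (1 / 2 + 1 / 2 * Real.exp (κ * s x ^ 2)) ∂μ :=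
          integral_mono (hint t) (((integrable_const _).add i2).const_mul _) hb
      _ = Real.exp (u / 2) * (1 / 2 + 1 / 2 * ∫ x, Real.exp (κ * s x ^ 2) ∂μ) := by
          rw [integral_const_mul, integral_add (integrable_const _) i2, integral_const_mul]
          simp
      _ ≤ Real.exp (u / 2) * Real.exp 1 := by
          gcongr
          linarith [Real.add_one_le_exp (1 : ℝ)]
      _ = Real.exp (u / 2 + 1) := (Real.exp_add _ _).symm
      _ ≤ _ := Real.exp_le_exp.2 (by linarith)

theorem measureReal_abs_sum_ge_le [IsProbabilityMeasure μ] (h : ExpWeight μ s κ) (hK : 0 < K)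
    {g : S → ℝ} (hg : Measurable g) (hgK : ∀ x, |g x| ≤ K * s x) (h0 : ∫ x, g x ∂μ = 0) (n : ℕ)
    {r : ℝ} (hr : 0 ≤ r) :
    (Measure.pi fun _ : Fin n => μ).real {φ | r ≤ |∑ i, g (φ i)|}
      ≤ 2 * Real.exp (-r ^ 2 / (2 * (n * (4 * K ^ 2 / κ)))) := by
  have hκ := h.pos
  have key : ∀ g : S → ℝ, Measurable g → (∀ x, |g x| ≤ K * s x) → ∫ x, g x ∂μ = 0 →
      (Measure.pi fun _ : Fin n => μ).real {φ | r ≤ ∑ i, g (φ i)}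
        ≤ Real.exp (-r ^ 2 / (2 * (n * (4 * K ^ 2 / κ)))) := by
    intro g hg hgK h0
    have h1 := HasSubgaussianMGF.measure_sum_ge_le_of_iIndepFun (s := Finset.univ)
      (iIndepFun_pi (μ := fun _ : Fin n => μ) (X := fun _ => g) fun _ => hg.aemeasurable)
      (c := fun _ => Real.toNNReal (4 * K ^ 2 / κ)) (fun i _ => by
        have h2 := h.hasSubgaussianMGF hK hg hgK h0
        rw [← (measurePreserving_eval (fun _ : Fin n => μ) i).map_eq] at h2
        exact h2.of_map (measurable_pi_apply i).aemeasurable) hr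
    refine h1.trans_eq ?_
    simp only [Finset.sum_const, Finset.card_univ, Fintype.card_fin, nsmul_eq_mul]
    push_cast
    rw [Real.coe_toNNReal _ (by positivity)]
  have hsub : {φ : Fin n → S | r ≤ |∑ i, g (φ i)|}
      ⊆ {φ | r ≤ ∑ i, g (φ i)} ∪ {φ | r ≤ ∑ i, (-g) (φ i)} := by
    intro φ hφ
    simp only [mem_ofPred_eq, mem_union, Pi.neg_apply, Finset.sum_neg_distrib] at hφ ⊢
    exact le_abs.1 hφ
  refine (measureReal_mono hsub).trans ((measureReal_union_le _ _).trans ?_)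
  have h1 := key g hg hgK h0
  have h2 := key (-g) hg.neg (fun x => by simpa using hgK x) (by simp [integral_neg, h0])
  linarith

/-- Concentration of the sum over a sample of a function that depends on one of its points. -/
theorem measure_abs_sum_gt_le [IsProbabilityMeasure μ] (h : ExpWeight μ s κ) (hK : 0 < K)
    {g : S → S → ℝ} (hg : Measurable fun q : S × S => g q.1 q.2)
    (hgK : ∀ x y, |g x y| ≤ K * s y) (h0 : ∀ x, ∫ y, g x y ∂μ = 0) {n : ℕ} (hn : 0 < n)
    (j : Fin (n + 1)) {u : ℝ} (hu : 0 ≤ u) :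
    (Measure.pi fun _ : Fin (n + 1) => μ)
        {θ | (n + 1 : ℕ) * u + |g (θ j) (θ j)| < |∑ i, g (θ j) (θ i)|}
      ≤ ENNReal.ofReal (2 * Real.exp (-((n + 1 : ℕ) * u ^ 2 / (8 * K ^ 2 / κ)))) := by
  have hκ := h.pos
  set r : ℝ := (n + 1 : ℕ) * u with hr
  have hr0 : 0 ≤ r := by positivity
  have hn' : (0 : ℝ) < n := by exact_mod_cast hn
  set A : Set (S × (Fin n → S)) := {q | r ≤ |∑ i, g q.1 (q.2 i)|} with hA
  have mA : MeasurableSet A := by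
    refine measurableSet_le measurable_const (Measurable.abs ?_)
    refine Finset.measurable_fun_sum _ fun i _ => ?_
    exact hg.comp (measurable_fst.prodMk ((measurable_pi_apply i).comp measurable_snd))
  -- Once the point `θ j` is split off, the other `n` points are independent of it and the function
  -- of one variable is fixed. The diagonal term is not centred, so it is moved into the threshold.
  have hsub : {θ : Fin (n + 1) → S | r + |g (θ j) (θ j)| < |∑ i, g (θ j) (θ i)|}
      ⊆ MeasurableEquiv.piFinSuccAbove (fun _ => S) j ⁻¹' A := by
    intro θ hθ
    simp only [mem_ofPred_eq] at hθ
    rw [Fin.sum_univ_succAbove _ j] at hθ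
    have h1 := abs_add_le (g (θ j) (θ j)) (∑ i, g (θ j) (θ (j.succAbove i)))
    change r ≤ |∑ i, g (θ j) (θ (j.succAbove i))|
    linarith
  refine (measure_mono hsub).trans ?_
  rw [(measurePreserving_piFinSuccAbove (fun _ : Fin (n + 1) => μ) j).measure_preimage
    mA.nullMeasurableSet, Measure.prod_apply mA]
  have hx : ∀ x, (Measure.pi fun _ : Fin n => μ) (Prod.mk x ⁻¹' A)
      ≤ ENNReal.ofReal (2 * Real.exp (-((n + 1 : ℕ) * u ^ 2 / (8 * K ^ 2 / κ)))) := by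
    intro x
    have h1 := h.measureReal_abs_sum_ge_le hK (hg.comp measurable_prodMk_left) (hgK x) (h0 x) n hr0
    rw [← ENNReal.ofReal_toReal (measure_ne_top (Measure.pi fun _ : Fin n => μ) _)]
    refine ENNReal.ofReal_le_ofReal (h1.trans ?_)
    gcongr
    rw [neg_div]
    refine neg_le_neg ?_
    -- Only `n` points are summed while the threshold scales with `n + 1`; the surplus factor `(n +
    -- 1) / n` only improves the exponent.
    have e1 : r ^ 2 / (2 * (n * (4 * K ^ 2 / κ)))
        = ((n + 1 : ℕ) * u ^ 2 / (8 * K ^ 2 / κ)) * ((n + 1 : ℕ) / n) := by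
      rw [hr]
      field_simp
      ring
    rw [e1]
    refine le_mul_of_one_le_right (by positivity) ?_
    rw [one_le_div hn']
    push_cast
    linarith
  refine (lintegral_mono hx).trans ?_
  simp

/-- Chernoff's bound at the exponent `κ`: the moment of the sum is at most `exp m`, and the
threshold contributes `exp (-2 * m)`. -/
theorem measure_sq_sum_gt_le [IsProbabilityMeasure μ] (h : ExpWeight μ s κ) (m : ℕ) :
    (Measure.pi fun _ : Fin m => μ) {θ | 2 / κ * m < ∑ i, s (θ i) ^ 2}
      ≤ ENNReal.ofReal (Real.exp (-m)) := by
  have hκ := h.pos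
  have hind := iIndepFun_pi (μ := fun _ : Fin m => μ) (X := fun _ x => s x ^ 2)
    fun _ => (h.meas.pow_const 2).aemeasurable
  have hmeas : ∀ i : Fin m, Measurable fun θ : Fin m → S => s (θ i) ^ 2 :=
    fun i => (h.meas.comp (measurable_pi_apply i)).pow_const 2
  have hi : ∀ i : Fin m, Integrable (fun θ : Fin m → S => Real.exp (κ * s (θ i) ^ 2))
      (Measure.pi fun _ => μ) := fun i =>
    (measurePreserving_eval (fun _ : Fin m => μ) i).integrable_comp_of_integrable h.integrable_exp
  have h1 := measure_ge_le_exp_mul_mgf (μ := Measure.pi fun _ : Fin m => μ)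
    (X := ∑ i, fun θ : Fin m → S => s (θ i) ^ 2) (2 / κ * m) hκ.le
    (hind.integrable_exp_mul_sum hmeas fun i _ => hi i)
  rw [hind.mgf_sum hmeas] at h1
  have h2 : ∀ i : Fin m, mgf (fun θ : Fin m → S => s (θ i) ^ 2) (Measure.pi fun _ => μ) κ
      ≤ Real.exp 1 := fun i => by
    have e1 := integral_map (μ := Measure.pi fun _ : Fin m => μ)
      (measurable_pi_apply i).aemeasurable (f := fun x => Real.exp (κ * s x ^ 2))
      ((h.meas.pow_const 2).const_mul κ).exp.aestronglyMeasurable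
    have e2 := (measurePreserving_eval (fun _ : Fin m => μ) i).map_eq
    unfold Function.eval at e2
    rw [e2] at e1
    exact e1.symm.trans_le h.exp_le
  have h3 : ∏ i : Fin m, mgf (fun θ : Fin m → S => s (θ i) ^ 2) (Measure.pi fun _ => μ) κ
      ≤ Real.exp m := by
    refine (Finset.prod_le_prod (fun i _ => mgf_nonneg) fun i _ => h2 i).trans_eq ?_
    rw [Finset.prod_const, ← Real.exp_nat_mul]
    simp
  have hsub : {θ : Fin m → S | 2 / κ * m < ∑ i, s (θ i) ^ 2}
      ⊆ {θ | 2 / κ * m ≤ (∑ i, fun θ : Fin m → S => s (θ i) ^ 2) θ} := by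
    intro θ hθ
    simp only [mem_ofPred_eq, Finset.sum_apply] at hθ ⊢
    exact hθ.le
  refine (measure_mono hsub).trans ?_
  rw [← ENNReal.ofReal_toReal (measure_ne_top (Measure.pi fun _ : Fin m => μ) _)]
  refine ENNReal.ofReal_le_ofReal (h1.trans ?_)
  calc _ ≤ Real.exp (-κ * (2 / κ * m)) * Real.exp m := by gcongr
    _ = Real.exp (-m) := by
      rw [← Real.exp_add]
      congr 1
      field_simp
      ring

/-- Markov's inequality for the Gaussian moment of one sample point. -/
theorem measure_sq_gt_le [IsProbabilityMeasure μ] (h : ExpWeight μ s κ) {m : ℕ} (i : Fin m)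
    (R : ℝ) : (Measure.pi fun _ : Fin m => μ) {θ | R < s (θ i) ^ 2}
      ≤ ENNReal.ofReal (Real.exp (1 - κ * R)) := by
  have hκ := h.pos
  have mA : MeasurableSet {x | R < s x ^ 2} := measurableSet_lt measurable_const
    (h.meas.pow_const 2)
  have h1 := (measurePreserving_eval (fun _ : Fin m => μ) i).measure_preimage mA.nullMeasurableSet
  change (Measure.pi fun _ : Fin m => μ) (Function.eval i ⁻¹' {x | R < s x ^ 2}) ≤ _
  rw [h1, ← ENNReal.ofReal_toReal (measure_ne_top μ _)]
  refine ENNReal.ofReal_le_ofReal ?_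
  have h2 := mul_meas_ge_le_integral_of_nonneg
    (Filter.Eventually.of_forall fun x => Real.exp_nonneg (κ * s x ^ 2)) h.integrable_exp
    (Real.exp (κ * R))
  have h3 : μ.real {x | R < s x ^ 2} ≤ μ.real {x | Real.exp (κ * R) ≤ Real.exp (κ * s x ^ 2)} := by
    refine measureReal_mono fun x hx => ?_
    simp only [mem_ofPred_eq, Real.exp_le_exp] at hx ⊢
    gcongr
  have h4 := h2.trans h.exp_le
  rw [sub_eq_add_neg, Real.exp_add, Real.exp_neg, ← div_eq_mul_inv,
    le_div_iff₀ (Real.exp_pos _), mul_comm]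
  refine le_trans ?_ h4
  exact mul_le_mul_of_nonneg_left h3 (Real.exp_nonneg _)

end ExpWeight

end ResNet
end


/-! ### Union bounds over data, units and times -/

noncomputable section

namespace ResNet

open Set State

section Union

variable {N d B n : ℕ} {Y S : Type*} [MeasurableSpace S] {M : Model N d Y} {μ : Measure S}
  {T : ℝ} {X : ℝ → State N d B S} {s : S → ℝ} {c ε κ : ℝ}

/-- The probability that a single average is not within `ε` of the integral. -/
def tail (c κ ε m : ℝ) : ℝ := 2 * Real.exp (-(m * (ε / 2) ^ 2 / (8 * (2 * c ^ 4) ^ 2 / κ)))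

theorem abs_mean_sub_le_of_abs_sum {m : ℕ} (hm : 0 < m) {f : Fin m → ℝ} {I a : ℝ}
    (h : |∑ i, (f i - I)| ≤ m * a) : |1 / (m : ℝ) * ∑ i, f i - I| ≤ a := by
  have hm' : (0 : ℝ) < m := by exact_mod_cast hm
  have e : 1 / (m : ℝ) * ∑ i, f i - I = 1 / (m : ℝ) * ∑ i, (f i - I) := by
    rw [Finset.sum_sub_distrib, mul_sub]
    simp
    field_simp
  rw [e, abs_mul, abs_of_pos (by positivity : (0 : ℝ) < 1 / m), one_div, inv_mul_le_iff₀ hm']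
  exact h

namespace BddFlow

variable [IsProbabilityMeasure μ] (h : BddFlow M μ s c T X)
include h

omit [IsProbabilityMeasure μ] in
theorem sub_integral_le {f : S → ℝ} {a : ℝ} (a0 : 0 ≤ a) (hf : ∀ y, |f y| ≤ a * s y) (y : S) :
    |f y - ∫ z, f z ∂μ| ≤ 2 * (a * c) * s y := by
  have c1 := h.tame.one_le
  have hsy := h.weight.one_le y
  have h1 : |∫ z, f z ∂μ| ≤ a * c := h.weight.abs_integral_le a0 fun z =>
    (hf z).trans (mul_le_mul_of_nonneg_left (h.weight.le_sq z) a0)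
  have h2 := (abs_sub (f y) (∫ z, f z ∂μ)).trans (add_le_add (hf y) h1)
  have h3 : a * s y ≤ a * c * s y := by
    have := le_mul_of_one_le_right (mul_nonneg a0 (by linarith : 0 ≤ s y)) c1
    linarith
  have h4 : a * c ≤ a * c * s y := le_mul_of_one_le_right (by positivity) hsy
  linarith

theorem integral_sub_integral {f : S → ℝ} {a : ℝ} (a0 : 0 ≤ a) (hf : ∀ y, |f y| ≤ a * s y)
    (hm : Measurable f) : ∫ y, (f y - ∫ z, f z ∂μ) ∂μ = 0 := by
  have := h.weight.integrable hm.aestronglyMeasurable fun z =>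
    (hf z).trans (mul_le_mul_of_nonneg_left (h.weight.le_sq z) a0)
  rw [integral_sub this (integrable_const _)]
  simp

variable (hκ : ExpWeight μ s κ)
include hκ

theorem measure_out_le {t : ℝ} (ht : t ∈ Icc 0 T) (hε : 0 ≤ ε) (k : Fin N) :
    (Measure.pi fun _ : Fin (n + 1) => μ) {θ | ¬ |1 / ((n + 1 : ℕ) : ℝ) * ∑ i, (X t).last (θ i)
        * M.h₁ ((X t).β (Fin.last B) (θ i) k) - (X t).out M μ k| ≤ ε}
      ≤ ENNReal.ofReal (tail c κ ε (n + 1 : ℕ)) := by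
  have c1 := h.tame.one_le
  have κ0 := hκ.pos
  set f : S → ℝ := fun y => (X t).last y * M.h₁ ((X t).β (Fin.last B) y k) with hf
  have hfm : Measurable f := (h.flow.meas t ht).last.mul ((h.flow.meas t ht).h₁ h.tame _ k)
  have hfb : ∀ y, |f y| ≤ c ^ 2 * s y := fun y =>
    (abs_mul_le_mul ((h.bdd t ht).last y) (h.tame.h₁_le _)).trans (by
      have := h.weight.one_le y
      nlinarith [mul_le_mul_of_nonneg_left this (by positivity : 0 ≤ c ^ 2)])
  -- There is no diagonal term in the output average; `ε / 2` is used so that the same `tail` bounds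
  -- all three kinds of averages.
  have h1 := hκ.measureReal_abs_sum_ge_le (K := 2 * c ^ 4) (by positivity)
    (g := fun y => f y - ∫ z, f z ∂μ) (hfm.sub_const _)
    (fun y => (h.sub_integral_le (by positivity) hfb y).trans (by
      have := h.weight.pos y
      have : c ^ 2 * c ≤ c ^ 4 := by
        rw [← pow_succ]
        exact pow_le_pow_right₀ c1 (by norm_num)
      gcongr))
    (h.integral_sub_integral (by positivity) hfb hfm) (n + 1)
    (r := (n + 1 : ℕ) * (ε / 2)) (by positivity)
  have hsub : {θ : Fin (n + 1) → S | ¬ |1 / ((n + 1 : ℕ) : ℝ) * ∑ i, f (θ i)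
      - ∫ z, f z ∂μ| ≤ ε}
      ⊆ {θ | (n + 1 : ℕ) * (ε / 2) ≤ |∑ i, (f (θ i) - ∫ z, f z ∂μ)|} := by
    intro θ hθ
    simp only [mem_ofPred_eq] at hθ ⊢
    by_contra hc
    refine hθ (abs_mean_sub_le_of_abs_sum (Nat.succ_pos n) ?_)
    refine (not_le.1 hc).le.trans ?_
    gcongr
    linarith
  refine (measure_mono hsub).trans ?_
  rw [← ENNReal.ofReal_toReal (measure_ne_top (Measure.pi fun _ : Fin (n + 1) => μ) _)]
  refine ENNReal.ofReal_le_ofReal (h1.trans_eq ?_)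
  unfold tail
  congr 2
  field_simp
  ring

theorem measure_res_le {t : ℝ} (ht : t ∈ Icc 0 T) (hε : 0 ≤ ε) (hn : 0 < n)
    (hnε : 4 * c ^ 4 ≤ (n + 1 : ℕ) * ε) (b : Fin B) (j : Fin (n + 1)) (k : Fin N) :
    (Measure.pi fun _ : Fin (n + 1) => μ) {θ | ¬ |1 / ((n + 1 : ℕ) : ℝ)
        * ∑ i, (X t).hidden b (θ i) (θ j) * M.h₁ ((X t).β b.castSucc (θ i) k)
        - ∫ y, (X t).hidden b y (θ j) * M.h₁ ((X t).β b.castSucc y k) ∂μ| ≤ ε * s (θ j)}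
      ≤ ENNReal.ofReal (tail c κ ε (n + 1 : ℕ)) := by
  have c1 := h.tame.one_le
  have κ0 := hκ.pos
  -- The weights grow with their target `x`, which is the fixed point here. Division by `s x` makes
  -- the function bounded uniformly in `x`.
  set f : S → S → ℝ := fun x y => (X t).hidden b y x * M.h₁ ((X t).β b.castSucc y k) / s x with hf
  have hfm : Measurable fun q : S × S => f q.1 q.2 :=
    ((((h.flow.meas t ht).hidden b).comp measurable_swap).mul
      (((h.flow.meas t ht).h₁ h.tame _ k).comp measurable_snd)).div
      (h.weight.meas.comp measurable_fst)
  have hfx : ∀ x, Measurable (f x) := fun x => hfm.comp measurable_prodMk_left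
  have hfb' : ∀ x y, |f x y| ≤ c ^ 2 := fun x y => by
    have hsx := h.weight.pos x
    rw [hf]
    simp only
    rw [abs_div, abs_of_pos hsx, div_le_iff₀ hsx]
    exact (abs_mul_le_mul ((h.bdd t ht).hidden b y x) (h.tame.h₁_le _)).trans_eq (by ring)
  have hfb : ∀ x y, |f x y| ≤ c ^ 2 * s y := fun x y =>
    (hfb' x y).trans (le_mul_of_one_le_right (by positivity) (h.weight.one_le y))
  have c3 : c ^ 2 * c ≤ c ^ 4 := by
    rw [← pow_succ]
    exact pow_le_pow_right₀ c1 (by norm_num)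
  have hI : ∀ x, |∫ z, f x z ∂μ| ≤ c ^ 2 * c := fun x =>
    h.weight.abs_integral_le (by positivity) fun z =>
      (hfb' x z).trans (le_mul_of_one_le_right (by positivity) (h.weight.one_le_sq z))
  -- Half of `ε` is spent on fluctuations. The other half covers the diagonal term, which is bounded
  -- and hence negligible by `hnε`.
  have h1 := hκ.measure_abs_sum_gt_le (K := 2 * c ^ 4) (by positivity)
    (g := fun x y => f x y - ∫ z, f x z ∂μ)
    (hfm.sub ((StronglyMeasurable.integral_prod_right (ν := μ)
      hfm.stronglyMeasurable).measurable.comp measurable_fst))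
    (fun x y => (h.sub_integral_le (by positivity) (hfb x) y).trans (by
      have := h.weight.pos y
      gcongr))
    (fun x => h.integral_sub_integral (by positivity) (hfb x) (hfx x)) hn j
    (u := ε / 2) (by positivity)
  refine (measure_mono fun θ hθ => ?_).trans h1
  simp only [mem_ofPred_eq] at hθ ⊢
  by_contra hc
  refine hθ ?_
  have hs := h.weight.pos (θ j)
  have e1 : ∀ y, (X t).hidden b y (θ j) * M.h₁ ((X t).β b.castSucc y k) = s (θ j) * f (θ j) y :=
    fun y => by
      rw [hf]
      field_simp
  simp only [e1, integral_const_mul, ← Finset.mul_sum]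
  rw [mul_left_comm, ← mul_sub, abs_mul, abs_of_pos hs, mul_comm ε]
  refine mul_le_mul_of_nonneg_left (abs_mean_sub_le_of_abs_sum (Nat.succ_pos n) ?_) hs.le
  refine (not_lt.1 hc).trans ?_
  have h5 := (abs_sub (f (θ j) (θ j)) (∫ z, f (θ j) z ∂μ)).trans
    (add_le_add (hfb' _ _) (hI (θ j)))
  have c2 : c ^ 2 ≤ c ^ 4 := pow_le_pow_right₀ c1 (by norm_num)
  linarith

/-- The averaged point is now the target, so the integrand is dominated by its weight uniformly in
the source, and no normalisation is needed. The factor `s (θ j)` in the tolerance is there for the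
diagonal term. -/
theorem measure_back_le {t : ℝ} (ht : t ∈ Icc 0 T) (hε : 0 ≤ ε) (hn : 0 < n)
    (hnε : 4 * c ^ 4 ≤ (n + 1 : ℕ) * ε) (b : Fin B) (j : Fin (n + 1)) (k : Fin N) :
    (Measure.pi fun _ : Fin (n + 1) => μ) {θ | ¬ |1 / ((n + 1 : ℕ) : ℝ)
        * ∑ i, (X t).hidden b (θ j) (θ i) * (X t).backα M μ b (θ i) k
        - ∫ y, (X t).hidden b (θ j) y * (X t).backα M μ b y k ∂μ| ≤ ε * s (θ j)}
      ≤ ENNReal.ofReal (tail c κ ε (n + 1 : ℕ)) := by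
  have c1 := h.tame.one_le
  have κ0 := hκ.pos
  set f : S → S → ℝ := fun x y => (X t).hidden b x y * (X t).backα M μ b y k with hf
  have hfm : Measurable fun q : S × S => f q.1 q.2 := ((h.flow.meas t ht).hidden b).mul
    (((h.flow.meas t ht).backα h.tame b k).comp measurable_snd)
  have hfx : ∀ x, Measurable (f x) := fun x => hfm.comp measurable_prodMk_left
  have hfb : ∀ x y, |f x y| ≤ c ^ 3 * s y := fun x y => h.abs_hidden_mul_backα_le ht b x y k
  have hgb : ∀ x y, |f x y - ∫ z, f x z ∂μ| ≤ 2 * c ^ 4 * s y := fun x y =>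
    (h.sub_integral_le (by positivity) (hfb x) y).trans_eq (by ring)
  have h1 := hκ.measure_abs_sum_gt_le (K := 2 * c ^ 4) (by positivity)
    (g := fun x y => f x y - ∫ z, f x z ∂μ)
    (hfm.sub ((StronglyMeasurable.integral_prod_right (ν := μ)
      hfm.stronglyMeasurable).measurable.comp measurable_fst)) hgb
    (fun x => h.integral_sub_integral (by positivity) (hfb x) (hfx x)) hn j
    (u := ε / 2) (by positivity)
  refine (measure_mono fun θ hθ => ?_).trans h1
  simp only [mem_ofPred_eq] at hθ ⊢
  by_contra hc
  refine hθ (abs_mean_sub_le_of_abs_sum (Nat.succ_pos n) ((not_lt.1 hc).trans ?_))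
  have hs := h.weight.one_le (θ j)
  have h5 := hgb (θ j) (θ j)
  have h6 : 2 * (2 * c ^ 4 * s (θ j)) ≤ (n + 1 : ℕ) * ε * s (θ j) := by
    have := mul_le_mul_of_nonneg_right hnε (by linarith : 0 ≤ s (θ j))
    linarith
  have h7 : (n + 1 : ℕ) * ε ≤ (n + 1 : ℕ) * ε * s (θ j) :=
    le_mul_of_one_le_right (by positivity) hs
  linarith

theorem measure_not_concentrated_le {t : ℝ} (ht : t ∈ Icc 0 T) (hε : 0 ≤ ε) (hn : 0 < n)
    (hnε : 4 * c ^ 4 ≤ (n + 1 : ℕ) * ε) :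
    (Measure.pi fun _ : Fin (n + 1) => μ) {θ | ¬ Concentrated M μ (X t) s θ ε}
      ≤ ENNReal.ofReal ((N + 2 * B * N) * (n + 1 : ℕ) * tail c κ ε (n + 1 : ℕ)) := by
  set E1 : Fin N → Set (Fin (n + 1) → S) := fun k => {θ | ¬ |1 / ((n + 1 : ℕ) : ℝ)
    * ∑ i, (X t).last (θ i) * M.h₁ ((X t).β (Fin.last B) (θ i) k) - (X t).out M μ k| ≤ ε}
  set E2 : Fin B × Fin (n + 1) × Fin N → Set (Fin (n + 1) → S) := fun q => {θ |
    ¬ |1 / ((n + 1 : ℕ) : ℝ) * ∑ i, (X t).hidden q.1 (θ i) (θ q.2.1)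
        * M.h₁ ((X t).β q.1.castSucc (θ i) q.2.2)
        - ∫ y, (X t).hidden q.1 y (θ q.2.1) * M.h₁ ((X t).β q.1.castSucc y q.2.2) ∂μ|
      ≤ ε * s (θ q.2.1)}
  set E3 : Fin B × Fin (n + 1) × Fin N → Set (Fin (n + 1) → S) := fun q => {θ |
    ¬ |1 / ((n + 1 : ℕ) : ℝ) * ∑ i, (X t).hidden q.1 (θ q.2.1) (θ i)
        * (X t).backα M μ q.1 (θ i) q.2.2
        - ∫ y, (X t).hidden q.1 (θ q.2.1) y * (X t).backα M μ q.1 y q.2.2 ∂μ|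
      ≤ ε * s (θ q.2.1)}
  have hsub : {θ : Fin (n + 1) → S | ¬ Concentrated M μ (X t) s θ ε}
      ⊆ (⋃ k, E1 k) ∪ ((⋃ q, E2 q) ∪ ⋃ q, E3 q) := by
    intro θ hθ
    by_contra hc
    simp only [mem_union, mem_iUnion, not_or, not_exists] at hc
    exact hθ ⟨fun k => not_not.1 (hc.1 k), fun b j k => not_not.1 (hc.2.1 (b, j, k)),
      fun b j k => not_not.1 (hc.2.2 (b, j, k))⟩
  have p0 : 0 ≤ tail c κ ε (n + 1 : ℕ) := by unfold tail; positivity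
  have hE1 : (Measure.pi fun _ : Fin (n + 1) => μ) (⋃ k, E1 k)
      ≤ ENNReal.ofReal (N * tail c κ ε (n + 1 : ℕ)) := by
    refine (measure_iUnion_fintype_le _ _).trans
      ((Finset.sum_le_sum fun k _ => h.measure_out_le hκ ht hε k).trans_eq ?_)
    rw [Finset.sum_const, Finset.card_univ, ← ENNReal.ofReal_nsmul, nsmul_eq_mul, Fintype.card_fin]
  have hq : ∀ E : Fin B × Fin (n + 1) × Fin N → Set (Fin (n + 1) → S),
      (∀ q, (Measure.pi fun _ : Fin (n + 1) => μ) (E q)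
        ≤ ENNReal.ofReal (tail c κ ε (n + 1 : ℕ))) →
      (Measure.pi fun _ : Fin (n + 1) => μ) (⋃ q, E q)
        ≤ ENNReal.ofReal (B * ((n + 1 : ℕ) * N) * tail c κ ε (n + 1 : ℕ)) := by
    intro E hE
    refine (measure_iUnion_fintype_le _ _).trans ((Finset.sum_le_sum fun q _ => hE q).trans_eq ?_)
    rw [Finset.sum_const, Finset.card_univ, ← ENNReal.ofReal_nsmul, nsmul_eq_mul]
    simp [Fintype.card_prod]
  refine (measure_mono hsub).trans ((measure_union_le _ _).trans ((add_le_add hE1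
    ((measure_union_le _ _).trans (add_le_add
      (hq E2 fun q => h.measure_res_le hκ ht hε hn hnε q.1 q.2.1 q.2.2)
      (hq E3 fun q => h.measure_back_le hκ ht hε hn hnε q.1 q.2.1 q.2.2)))).trans ?_))
  rw [← ENNReal.ofReal_add (by positivity) (by positivity),
    ← ENNReal.ofReal_add (by positivity) (by positivity)]
  refine ENNReal.ofReal_le_ofReal ?_
  have h1 : (N : ℝ) * tail c κ ε (n + 1 : ℕ) ≤ N * (n + 1 : ℕ) * tail c κ ε (n + 1 : ℕ) := by
    gcongr
    refine le_mul_of_one_le_right (by positivity) ?_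
    push_cast
    linarith [(Nat.cast_nonneg n : (0 : ℝ) ≤ n)]
  linarith

/-- The sample is good: averages concentrate at a net of times, the empirical second moment of the
weight is bounded, and so are the weights of all points of the sample. -/
structure _root_.ResNet.GoodSample (M : Model N d Y) (μ : Measure S) (X : ℝ → State N d B S)
    (s : S → ℝ) (T κ ε R : ℝ) {m : ℕ} (θ : Fin m → S) : Prop where
  conc : ∀ r ∈ Icc 0 T, ∃ τ ∈ Icc 0 T, |r - τ| ≤ ε ∧ Concentrated M μ (X τ) s θ ε
  weight : IsWeight (unif m) (s ∘ θ) (2 / κ)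
  le : ∀ i, s (θ i) ^ 2 ≤ R

/-- Only the multiples of `ε` in `[0, T]` have to be controlled, at most `T / ε + 1` of them: any
time has such a multiple within `ε` below it. The remaining summands bound the failure of the
empirical second moment and of the pointwise bound on the weights. -/
theorem measure_not_goodSample_le (hT : 0 ≤ T) (hε : 0 < ε) (hn : 0 < n)
    (hnε : 4 * c ^ 4 ≤ (n + 1 : ℕ) * ε) (R : ℝ) :
    (Measure.pi fun _ : Fin (n + 1) => μ) {θ | ¬ GoodSample M μ X s T κ ε R θ}
      ≤ ENNReal.ofReal ((T / ε + 1) * ((N + 2 * B * N) * (n + 1 : ℕ) * tail c κ ε (n + 1 : ℕ))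
        + (Real.exp (-(n + 1 : ℕ)) + (n + 1 : ℕ) * Real.exp (1 - κ * R))) := by
  set E1 : Fin (⌊T / ε⌋₊ + 1) → Set (Fin (n + 1) → S) :=
    fun a => {θ | ¬ Concentrated M μ (X (a * ε)) s θ ε}
  set E2 : Set (Fin (n + 1) → S) := {θ | 2 / κ * (n + 1 : ℕ) < ∑ i, s (θ i) ^ 2}
  set E3 : Fin (n + 1) → Set (Fin (n + 1) → S) := fun i => {θ | R < s (θ i) ^ 2}
  have hTε : 0 ≤ T / ε := by positivity
  have net : ∀ a : ℕ, a ≤ ⌊T / ε⌋₊ → (a * ε : ℝ) ∈ Icc 0 T := fun a ha => by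
    refine ⟨by positivity, ?_⟩
    rw [← le_div_iff₀ hε]
    exact (Nat.le_floor_iff hTε).1 ha
  have hsub : {θ : Fin (n + 1) → S | ¬ GoodSample M μ X s T κ ε R θ}
      ⊆ (⋃ a, E1 a) ∪ (E2 ∪ ⋃ i, E3 i) := by
    intro θ hθ
    by_contra hc
    simp only [mem_union, mem_iUnion, not_or, not_exists] at hc
    refine hθ ⟨fun r hr => ?_, ⟨Measurable.of_discrete, fun i => h.weight.one_le _,
      Integrable.of_finite, ?_⟩, fun i => not_lt.1 (hc.2.2 i)⟩
    · have h1 : ⌊r / ε⌋₊ ≤ ⌊T / ε⌋₊ := Nat.floor_mono (by gcongr; exact hr.2)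
      refine ⟨(⌊r / ε⌋₊ : ℝ) * ε, net _ h1, ?_,
        not_not.1 (hc.1 ⟨⌊r / ε⌋₊, Nat.lt_succ_of_le h1⟩)⟩
      have h2 := Nat.floor_le (div_nonneg hr.1 hε.le)
      have h3 := Nat.lt_floor_add_one (r / ε)
      rw [le_div_iff₀ hε] at h2
      rw [div_lt_iff₀ hε] at h3
      rw [abs_of_nonneg (by linarith)]
      linarith
    · rw [integral_unif, one_div, inv_mul_le_iff₀ (by positivity), mul_comm]
      exact not_lt.1 hc.2.1
  have p0 : 0 ≤ tail c κ ε (n + 1 : ℕ) := by unfold tail; positivity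
  have hE1 : (Measure.pi fun _ : Fin (n + 1) => μ) (⋃ a, E1 a) ≤ ENNReal.ofReal
      ((T / ε + 1) * ((N + 2 * B * N) * (n + 1 : ℕ) * tail c κ ε (n + 1 : ℕ))) := by
    have hE : ∀ a, (Measure.pi fun _ : Fin (n + 1) => μ) (E1 a)
        ≤ ENNReal.ofReal ((N + 2 * B * N) * (n + 1 : ℕ) * tail c κ ε (n + 1 : ℕ)) := fun a =>
      h.measure_not_concentrated_le hκ (net a (Nat.le_of_lt_succ a.2)) hε.le hn hnε
    refine (measure_iUnion_fintype_le _ _).trans ((Finset.sum_le_sum fun a _ => hE a).trans ?_)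
    rw [Finset.sum_const, Finset.card_univ, ← ENNReal.ofReal_nsmul, nsmul_eq_mul, Fintype.card_fin]
    refine ENNReal.ofReal_le_ofReal (mul_le_mul_of_nonneg_right ?_ (by positivity))
    push_cast
    linarith [Nat.floor_le hTε]
  have hE3 : (Measure.pi fun _ : Fin (n + 1) => μ) (⋃ i, E3 i)
      ≤ ENNReal.ofReal ((n + 1 : ℕ) * Real.exp (1 - κ * R)) := by
    refine (measure_iUnion_fintype_le _ _).trans
      ((Finset.sum_le_sum fun i _ => hκ.measure_sq_gt_le i R).trans_eq ?_)
    rw [Finset.sum_const, Finset.card_univ, ← ENNReal.ofReal_nsmul, nsmul_eq_mul, Fintype.card_fin]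
  refine (measure_mono hsub).trans ((measure_union_le _ _).trans ((add_le_add hE1
    ((measure_union_le _ _).trans (add_le_add (hκ.measure_sq_sum_gt_le (n + 1)) hE3))).trans_eq ?_))
  rw [← ENNReal.ofReal_add (by positivity) (by positivity),
    ← ENNReal.ofReal_add (by positivity) (by positivity)]

end BddFlow

end Union

end ResNet
end


noncomputable section

namespace ResNet

open Set State

/-! ### The flow over the support of the path measure -/

/-- The restriction of the path measure to its support. -/
abbrev supportMeasure {d N B : ℕ} (p : Measure (Path d N B)) : Measure p.support :=
  p.comap Subtype.val

section Support

variable {d N B : ℕ} {Y : Type*} {M : Model N d Y} {p : Measure (Path d N B)}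

theorem measurableSet_support (p : Measure (Path d N B)) : MeasurableSet p.support :=
  Measure.isClosed_support.measurableSet

theorem restrict_support (p : Measure (Path d N B)) : p.restrict p.support = p :=
  Measure.restrict_eq_self_of_ae_mem Measure.support_mem_ae

theorem map_supportMeasure (p : Measure (Path d N B)) :
    (supportMeasure p).map Subtype.val = p := by
  rw [supportMeasure, map_comap_subtype_coe (measurableSet_support p), restrict_support]

instance [IsProbabilityMeasure p] : IsProbabilityMeasure (supportMeasure p) := by
  have : IsProbabilityMeasure ((supportMeasure p).map Subtype.val) := by
    rw [map_supportMeasure]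
    infer_instance
  exact Measure.isProbabilityMeasure_of_map (μ := supportMeasure p) (f := Subtype.val)

/-- This permits reading all recursions of the trajectory over the subtype `p.support`, the only
place where the flow is known to be measurable and to solve its equations. -/
theorem integral_support (p : Measure (Path d N B)) (f : Path d N B → ℝ) :
    ∫ Θ, f Θ ∂p = ∫ x : p.support, f x ∂(supportMeasure p) := by
  rw [supportMeasure, integral_subtype_comap (measurableSet_support p), restrict_support]

/-- The trajectory at time `t`, as a state over the support. -/
def Trajectory.state (Φ : Trajectory d N B) (p : Measure (Path d N B)) (t : ℝ) :
    State N d B p.support where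
  first x := Φ.first x t
  hidden b x y := Φ.hidden b x y t
  last x := Φ.last x t
  α b x := Φ.α b x t
  β l x := Φ.β l x t

variable (Φ : Trajectory d N B) (t : ℝ)

theorem out_state (n : Fin N) :
    (Φ.state p t).out M (supportMeasure p) n = flowOutput M p Φ t n := by
  rw [flowOutput, integral_support]
  rfl

theorem back_state (l : Fin (B + 1)) (x : p.support) (n : Fin N) :
    (Φ.state p t).back M (supportMeasure p) l x n = backβ M p Φ t l x n := by
  induction l using Fin.reverseInduction generalizing x with
  | last =>
    rw [back_last, out_state]
    simp [backβ, backOutput, Trajectory.state]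
  | cast b ih =>
    have e : backβ M p Φ t b.castSucc x n = backβ M p Φ t b.succ x n
        + (∫ Θ', Φ.hidden b x Θ' t * (backβ M p Φ t b.succ Θ' n * deriv M.h₂ (Φ.α b Θ' t n)) ∂p)
          * deriv M.h₁ (Φ.β b.castSucc x t n) := by
      simp [backβ]
    rw [back_castSucc, e, integral_support]
    simp only [State.backα, ih]
    rfl

theorem backα_state (b : Fin B) (x : p.support) (n : Fin N) :
    (Φ.state p t).backα M (supportMeasure p) b x n = ResNet.backα M p Φ t b x n := by
  simp only [State.backα, ResNet.backα, back_state]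
  rfl

theorem gradLast_state (x : p.support) :
    (Φ.state p t).gradLast M (supportMeasure p) x = driftLast M p Φ t x := by
  simp only [gradLast, driftLast, out_state]
  rfl

theorem gradHidden_state (b : Fin B) (x y : p.support) :
    (Φ.state p t).gradHidden M (supportMeasure p) b x y = driftHidden M p Φ t b x y := by
  simp only [gradHidden, driftHidden, backα_state]
  rfl

theorem gradFirst_state (x : p.support) (i : Fin d) :
    (Φ.state p t).gradFirst M (supportMeasure p) x i = driftFirst M p Φ t x i := by
  simp only [gradFirst, driftFirst, back_state]

theorem driftαFrom_state (b : Fin B) {g : p.support → Fin N → ℝ} {g' : Path d N B → Fin N → ℝ}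
    (hg : ∀ x n, g x n = g' x n) (x : p.support) (n : Fin N) :
    (Φ.state p t).driftαFrom M (supportMeasure p) b g x n
      = ResNet.driftαFrom M p Φ t b g' x n := by
  rw [ResNet.driftαFrom, integral_support, integral_support]
  simp only [State.driftαFrom, gradHidden_state, hg]
  rfl

theorem driftβ_state (l : Fin (B + 1)) (x : p.support) (n : Fin N) :
    (Φ.state p t).driftβ M (supportMeasure p) l x n = ResNet.driftβ M p Φ t l x n := by
  induction l using Fin.induction generalizing x n with
  | zero =>
    simp only [driftβ_zero, gradFirst_state]
    simp [ResNet.driftβ]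
  | succ b ih =>
    have e : ResNet.driftβ M p Φ t b.succ x n = ResNet.driftβ M p Φ t b.castSucc x n
        + ResNet.driftαFrom M p Φ t b (ResNet.driftβ M p Φ t b.castSucc) x n
          * deriv M.h₂ (Φ.α b x t n) := by
      simp [ResNet.driftβ]
    rw [driftβ_succ, e, State.driftα, driftαFrom_state Φ t b ih, ih]
    rfl

theorem driftα_state (b : Fin B) (x : p.support) (n : Fin N) :
    (Φ.state p t).driftα M (supportMeasure p) b x n = ResNet.driftα M p Φ t b x n :=
  driftαFrom_state Φ t b (driftβ_state Φ t b.castSucc) x n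

end Support

section Initial

variable {d N B : ℕ} {Y : Type*} {M : Model N d Y} {p : Measure (Path d N B)}
  {v : ContWeights d N B} {T : ℝ} {Φ : Trajectory d N B}

theorem IsNeuralFeatureFlow.flow (h : IsNeuralFeatureFlow M p v T Φ) (hT : 0 ≤ T) :
    Flow M (supportMeasure p) T (Φ.state p) where
  meas t ht :=
    { first := fun i => (measurable_pi_apply i).comp (h.meas_first t ht)
      hidden := h.meas_hidden t ht
      last := h.meas_last t ht
      α := fun b n => (measurable_pi_apply n).comp (h.meas_α t ht b)
      β := fun l n => (measurable_pi_apply n).comp (h.meas_β t ht l) }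
  cont k := by
    cases k with
    | first x i => exact continuousOn_pi.1 (h.cont_first x x.2) i
    | hidden b x y => exact h.cont_hidden b x x.2 y y.2
    | last x => exact h.cont_last x x.2
    | α b x n => exact continuousOn_pi.1 (h.cont_α b x x.2) n
    | β l x n => exact continuousOn_pi.1 (h.cont_β l x x.2) n
  eq k t ht := by
    have h0 : (0 : ℝ) ∈ Icc 0 T := ⟨le_rfl, hT⟩
    cases k with
    | first x i =>
      have e0 := h.eq_first 0 h0 x x.2 i
      rw [intervalIntegral.integral_same, sub_zero] at e0
      simp only [State.val, State.drift, gradFirst_state]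
      exact (h.eq_first t ht x x.2 i).trans (by rw [← e0]; rfl)
    | hidden b x y =>
      have e0 := h.eq_hidden 0 h0 b x x.2 y y.2
      rw [intervalIntegral.integral_same, sub_zero] at e0
      simp only [State.val, State.drift, gradHidden_state]
      exact (h.eq_hidden t ht b x x.2 y y.2).trans (by rw [← e0]; rfl)
    | last x =>
      have e0 := h.eq_last 0 h0 x x.2
      rw [intervalIntegral.integral_same, sub_zero] at e0
      simp only [State.val, State.drift, gradLast_state]
      exact (h.eq_last t ht x x.2).trans (by rw [← e0]; rfl)
    | α b x n =>
      have e0 := h.eq_α 0 h0 b x x.2 n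
      rw [intervalIntegral.integral_same, sub_zero] at e0
      simp only [State.val, State.drift, driftα_state]
      exact (h.eq_α t ht b x x.2 n).trans (by rw [← e0]; rfl)
    | β l x n =>
      have e0 := h.eq_β 0 h0 l x x.2 n
      rw [intervalIntegral.integral_same, sub_zero] at e0
      simp only [State.val, State.drift, driftβ_state]
      exact (h.eq_β t ht l x x.2 n).trans (by rw [← e0]; rfl)

variable (h : IsNeuralFeatureFlow M p v T Φ) (hT : 0 ≤ T)
include h hT

theorem IsNeuralFeatureFlow.first_zero (x : p.support) (i : Fin d) :
    Φ.first x 0 i = x.1.1 i := by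
  simpa using h.eq_first 0 ⟨le_rfl, hT⟩ x x.2 i

theorem IsNeuralFeatureFlow.hidden_zero (b : Fin B) (x y : p.support) :
    Φ.hidden b x y 0 = v.hidden b x y := by
  simpa using h.eq_hidden 0 ⟨le_rfl, hT⟩ b x x.2 y y.2

theorem IsNeuralFeatureFlow.last_zero (x : p.support) : Φ.last x 0 = v.last x := by
  simpa using h.eq_last 0 ⟨le_rfl, hT⟩ x x.2

theorem IsNeuralFeatureFlow.α_zero (b : Fin B) (x : p.support) (n : Fin N) :
    Φ.α b x 0 n = x.1.2 b n := by
  simpa using h.eq_α 0 ⟨le_rfl, hT⟩ b x x.2 n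

theorem IsNeuralFeatureFlow.β_zero (l : Fin (B + 1)) (x : p.support) (n : Fin N) :
    Φ.β l x 0 n = pathFeature M l x n := by
  simpa using h.eq_β 0 ⟨le_rfl, hT⟩ l x x.2 n

theorem IsNeuralFeatureFlow.forward_zero (hv : IsContResNet M p v) :
    (Φ.state p 0).Forward M (supportMeasure p) where
  zero x n := by
    change Φ.β 0 x 0 n = 1 / (d : ℝ) * ∑ i, M.X n i * Φ.first x 0 i
    rw [h.β_zero hT]
    simp [pathFeature, h.first_zero hT]
  succ b x n := by
    change Φ.β b.succ x 0 n = M.h₂ (Φ.α b x 0 n) + Φ.β b.castSucc x 0 n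
    rw [h.β_zero hT, h.β_zero hT, h.α_zero hT]
    -- Going from `b.castSucc` to `b.succ` adds exactly the residual layer `b` to the sum.
    have e : Finset.univ.filter (fun b' : Fin B => b'.succ ≤ b.succ)
        = insert b (Finset.univ.filter fun b' : Fin B => b'.succ ≤ b.castSucc) := by
      ext b'
      simp only [Finset.mem_filter, Finset.mem_univ, true_and, Finset.mem_insert, Fin.le_def,
        Fin.ext_iff, Fin.val_succ, Fin.val_castSucc]
      omega
    rw [pathFeature, pathFeature, e, Finset.sum_insert]
    · ring
    · simp [Fin.le_def]
  res b x n := by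
    change Φ.α b x 0 n = ∫ y : p.support, Φ.hidden b y x 0 * M.h₁ (Φ.β b.castSucc y 0 n) ∂_
    rw [h.α_zero hT, hv x x.2 b n, integral_support]
    simp only [h.hidden_zero hT, h.β_zero hT]

theorem IsNeuralFeatureFlow.bdd_zero {σ C₅ C₆ C₇ C₈ c : ℝ} (hv : InitRegular p v σ C₅ C₆ C₇ C₈)
    (h5 : C₅ ≤ c) (h7 : C₇ ≤ c) : (Φ.state p 0).Bdd (fun x => 1 + ‖x.1‖) c where
  last x := by
    change |Φ.last x 0| ≤ c
    rw [h.last_zero hT]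
    exact (hv.last_bound x x.2).trans h7
  hidden b x y := by
    change |Φ.hidden b x y 0| ≤ c * (1 + ‖y.1‖)
    rw [h.hidden_zero hT]
    exact (hv.growth b x x.2 y y.2).trans (by gcongr)

end Initial

/-! ### Gaussian moments of the path norm -/

section Moment

variable {d N B : ℕ} {p : Measure (Path d N B)} {σ : ℝ}

/-- A bound for the Gaussian moment of the path norm. -/
def momentBound (d N B : ℕ) : ℝ := 1 + (d + B * N) * Real.exp 1

/-- The exponent in the Gaussian moment of the weight function. -/
def momentRate (d N B : ℕ) (σ : ℝ) : ℝ := 1 / (2 * (1 + σ ^ 2 * momentBound d N B))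

/-- The norm is a maximum of coordinates, so its exponential is one of the summands. The leading `1`
keeps the logarithm nonnegative. -/
theorem exp_norm_sq_le (hσ : 0 < σ) (Θ : Path d N B) :
    Real.exp (‖Θ‖ ^ 2 / σ ^ 2) ≤ 1 + (∑ i, Real.exp (Θ.1 i ^ 2 / σ ^ 2)
      + ∑ q : Fin B × Fin N, Real.exp (Θ.2 q.1 q.2 ^ 2 / σ ^ 2)) := by
  set W := 1 + (∑ i, Real.exp (Θ.1 i ^ 2 / σ ^ 2)
      + ∑ q : Fin B × Fin N, Real.exp (Θ.2 q.1 q.2 ^ 2 / σ ^ 2)) with hW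
  have p1 : 0 ≤ ∑ i, Real.exp (Θ.1 i ^ 2 / σ ^ 2) := Finset.sum_nonneg fun _ _ => Real.exp_nonneg _
  have p2 : 0 ≤ ∑ q : Fin B × Fin N, Real.exp (Θ.2 q.1 q.2 ^ 2 / σ ^ 2) :=
    Finset.sum_nonneg fun _ _ => Real.exp_nonneg _
  have W1 : 1 ≤ W := by linarith
  have coord : ∀ x : ℝ, Real.exp (x ^ 2 / σ ^ 2) ≤ W → ‖x‖ ≤ σ * √(Real.log W) := by
    intro x hx
    have h1 := (Real.le_log_iff_exp_le (by linarith)).2 hx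
    rw [div_le_iff₀ (by positivity)] at h1
    rw [Real.norm_eq_abs, ← Real.sqrt_sq hσ.le, ← Real.sqrt_mul (sq_nonneg σ)]
    refine Real.abs_le_sqrt ?_
    linarith
  have h0 : 0 ≤ σ * √(Real.log W) := by positivity
  have hn : ‖Θ‖ ≤ σ * √(Real.log W) := by
    rw [Prod.norm_def]
    refine max_le ((pi_norm_le_iff_of_nonneg h0).2 fun i => coord _ ?_)
      ((pi_norm_le_iff_of_nonneg h0).2 fun b => (pi_norm_le_iff_of_nonneg h0).2 fun n => coord _ ?_)
    · have := Finset.single_le_sum (f := fun i => Real.exp (Θ.1 i ^ 2 / σ ^ 2))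
        (fun _ _ => Real.exp_nonneg _) (Finset.mem_univ i)
      linarith
    · have := Finset.single_le_sum
        (f := fun q : Fin B × Fin N => Real.exp (Θ.2 q.1 q.2 ^ 2 / σ ^ 2))
        (fun _ _ => Real.exp_nonneg _) (Finset.mem_univ (b, n))
      linarith
  rw [← Real.le_log_iff_exp_le (by linarith), div_le_iff₀ (by positivity)]
  calc ‖Θ‖ ^ 2 ≤ (σ * √(Real.log W)) ^ 2 := by gcongr
    _ = Real.log W * σ ^ 2 := by
      rw [mul_pow, Real.sq_sqrt (Real.log_nonneg W1)]
      ring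

theorem SubGaussian.lintegral_first (h : SubGaussian p σ) (i : Fin d) :
    ∫⁻ Θ, ENNReal.ofReal (Real.exp (Θ.1 i ^ 2 / σ ^ 2)) ∂p ≤ ENNReal.ofReal (Real.exp 1) := by
  classical
  have := h (Pi.single i 1, 0) (by simp [Path.dot, Pi.single_apply])
  simpa [Path.dot, Pi.single_apply] using this

theorem SubGaussian.lintegral_residual (h : SubGaussian p σ) (b : Fin B) (n : Fin N) :
    ∫⁻ Θ, ENNReal.ofReal (Real.exp (Θ.2 b n ^ 2 / σ ^ 2)) ∂p ≤ ENNReal.ofReal (Real.exp 1) := by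
  classical
  have e : ∀ Θ : Path d N B, Path.dot (0, Pi.single b (Pi.single n 1)) Θ = Θ.2 b n := by
    intro Θ
    simp only [Path.dot, Pi.zero_apply, zero_mul, Finset.sum_const_zero, zero_add]
    rw [Finset.sum_eq_single b (fun b' _ hb => by simp [hb]) (by simp),
      Finset.sum_eq_single n (fun n' _ hn => by simp [hn]) (by simp)]
    simp
  have := h (0, Pi.single b (Pi.single n 1)) (by rw [e]; simp)
  simpa only [e] using this

theorem SubGaussian.lintegral_norm [IsProbabilityMeasure p] (h : SubGaussian p σ) (hσ : 0 < σ) :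
    ∫⁻ Θ, ENNReal.ofReal (Real.exp (‖Θ‖ ^ 2 / σ ^ 2)) ∂p
      ≤ ENNReal.ofReal (momentBound d N B) := by
  have hm1 : ∀ i, Measurable fun Θ : Path d N B => ENNReal.ofReal (Real.exp (Θ.1 i ^ 2 / σ ^ 2)) :=
    fun i => by fun_prop
  have hm2 : ∀ q : Fin B × Fin N, Measurable fun Θ : Path d N B =>
      ENNReal.ofReal (Real.exp (Θ.2 q.1 q.2 ^ 2 / σ ^ 2)) := fun q => by fun_prop
  calc ∫⁻ Θ, ENNReal.ofReal (Real.exp (‖Θ‖ ^ 2 / σ ^ 2)) ∂p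
      ≤ ∫⁻ Θ, 1 + (∑ i, ENNReal.ofReal (Real.exp (Θ.1 i ^ 2 / σ ^ 2))
        + ∑ q : Fin B × Fin N, ENNReal.ofReal (Real.exp (Θ.2 q.1 q.2 ^ 2 / σ ^ 2))) ∂p := by
        refine lintegral_mono fun Θ => (ENNReal.ofReal_le_ofReal (exp_norm_sq_le hσ Θ)).trans_eq ?_
        have p1 : 0 ≤ ∑ i, Real.exp (Θ.1 i ^ 2 / σ ^ 2) :=
          Finset.sum_nonneg fun _ _ => Real.exp_nonneg _
        have p2 : 0 ≤ ∑ q : Fin B × Fin N, Real.exp (Θ.2 q.1 q.2 ^ 2 / σ ^ 2) :=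
          Finset.sum_nonneg fun _ _ => Real.exp_nonneg _
        rw [ENNReal.ofReal_add zero_le_one (by positivity), ENNReal.ofReal_add p1 p2,
          ENNReal.ofReal_one, ENNReal.ofReal_sum_of_nonneg fun _ _ => Real.exp_nonneg _,
          ENNReal.ofReal_sum_of_nonneg fun _ _ => Real.exp_nonneg _]
    _ ≤ 1 + (∑ i : Fin d, ENNReal.ofReal (Real.exp 1)
        + ∑ q : Fin B × Fin N, ENNReal.ofReal (Real.exp 1)) := by
        rw [lintegral_add_left measurable_const, lintegral_add_left
          (Finset.measurable_fun_sum _ fun i _ => hm1 i), lintegral_finsetSum _ fun i _ => hm1 i,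
          lintegral_finsetSum _ fun i _ => hm2 i]
        gcongr with i _ q _
        · simp
        · exact h.lintegral_first i
        · exact h.lintegral_residual q.1 q.2
    _ = _ := by
        rw [Finset.sum_const, Finset.sum_const, ← ENNReal.ofReal_nsmul, ← ENNReal.ofReal_nsmul,
          ← ENNReal.ofReal_one, ← ENNReal.ofReal_add (by positivity) (by positivity),
          ← ENNReal.ofReal_add (by positivity) (by positivity)]
        congr 1
        simp [momentBound, Fintype.card_prod]
        ring

theorem one_le_momentBound (d N B : ℕ) : 1 ≤ momentBound d N B := by
  unfold momentBound
  have : (0 : ℝ) ≤ (d + B * N) * Real.exp 1 := by positivity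
  linarith

theorem momentRate_pos (d N B : ℕ) (σ : ℝ) : 0 < momentRate d N B σ := by
  have := one_le_momentBound d N B
  unfold momentRate
  positivity

/-- Lowering the exponent from `1 / σ ^ 2` shrinks the moment: by the chord bound the mean is at
most `1 + 2 * κ * σ ^ 2 * Q` times the factor `exp (2 * κ)` that comes from `(1 + z) ^ 2 ≤ 2 + 2 * z
^ 2`. -/
theorem SubGaussian.expWeight [IsProbabilityMeasure p] (h : SubGaussian p σ) (hσ : 0 < σ) :
    ExpWeight (supportMeasure p) (fun x => 1 + ‖x.1‖) (momentRate d N B σ) := by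
  have Q1 := one_le_momentBound d N B
  have κ0 := momentRate_pos d N B σ
  set Q := momentBound d N B with hQ
  set κ := momentRate d N B σ with hκ
  -- The defining property of the rate: the two contributions to the exponent add up to exactly one,
  -- hence the bound `exp 1`.
  have hκQ : 2 * κ + 2 * κ * σ ^ 2 * Q = 1 := by
    rw [hκ, momentRate, ← hQ]
    field_simp
  have hl : ∫⁻ x : p.support, ENNReal.ofReal (Real.exp (‖x.1‖ ^ 2 / σ ^ 2)) ∂(supportMeasure p)
      ≤ ENNReal.ofReal Q := by
    rw [← lintegral_map (f := fun Θ => ENNReal.ofReal (Real.exp (‖Θ‖ ^ 2 / σ ^ 2)))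
      (by fun_prop) measurable_subtype_coe, map_supportMeasure]
    exact h.lintegral_norm hσ
  have hm : Measurable fun x : p.support => ‖x.1‖ := measurable_subtype_coe.norm
  have hi : Integrable (fun x : p.support => Real.exp (‖x.1‖ ^ 2 / σ ^ 2)) (supportMeasure p) := by
    refine ⟨((hm.pow_const 2).div_const _).exp.aestronglyMeasurable, ?_⟩
    rw [hasFiniteIntegral_iff_ofReal (Filter.Eventually.of_forall fun _ => Real.exp_nonneg _)]
    exact hl.trans_lt ENNReal.ofReal_lt_top
  have hI : ∫ x : p.support, Real.exp (‖x.1‖ ^ 2 / σ ^ 2) ∂(supportMeasure p) ≤ Q := by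
    rw [integral_eq_lintegral_of_nonneg_ae
      (Filter.Eventually.of_forall fun _ => Real.exp_nonneg _) hi.1]
    exact ENNReal.toReal_le_of_le_ofReal (by linarith) hl
  have hu1 : 2 * κ * σ ^ 2 ≤ 1 := by
    have : 2 * κ * σ ^ 2 * 1 ≤ 2 * κ * σ ^ 2 * Q := by gcongr
    linarith
  have hb : ∀ x : p.support, Real.exp (κ * (1 + ‖x.1‖) ^ 2)
      ≤ Real.exp (2 * κ) * (1 - 2 * κ * σ ^ 2 + 2 * κ * σ ^ 2 * Real.exp (‖x.1‖ ^ 2 / σ ^ 2)) := by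
    intro x
    have h1 := exp_mul_le (by positivity) hu1 (‖x.1‖ ^ 2 / σ ^ 2)
    have h2 : κ * (1 + ‖x.1‖) ^ 2 ≤ 2 * κ + 2 * κ * σ ^ 2 * (‖x.1‖ ^ 2 / σ ^ 2) := by
      have : 2 * κ * σ ^ 2 * (‖x.1‖ ^ 2 / σ ^ 2) = κ * (2 * ‖x.1‖ ^ 2) := by field_simp
      rw [this]
      nlinarith [mul_nonneg κ0.le (sq_nonneg (1 - ‖x.1‖))]
    refine (Real.exp_le_exp.2 h2).trans ?_
    rw [Real.exp_add]
    gcongr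
    linarith
  have i2 : Integrable (fun x : p.support => 2 * κ * σ ^ 2 * Real.exp (‖x.1‖ ^ 2 / σ ^ 2))
      (supportMeasure p) := hi.const_mul _
  have i3 := ((integrable_const (μ := supportMeasure p) (1 - 2 * κ * σ ^ 2)).add i2).const_mul
    (Real.exp (2 * κ))
  have hms : Measurable fun x : p.support => 1 + ‖x.1‖ := hm.const_add 1
  have i4 : Integrable (fun x : p.support => Real.exp (κ * (1 + ‖x.1‖) ^ 2)) (supportMeasure p) :=
    i3.mono' ((hms.pow_const 2).const_mul κ).exp.aestronglyMeasurable
      (Filter.Eventually.of_forall fun x => by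
        rw [Real.norm_of_nonneg (Real.exp_nonneg _)]
        exact hb x)
  refine ⟨κ0, hms, fun x => by linarith [norm_nonneg x.1], i4, ?_⟩
  refine (integral_mono i4 i3 hb).trans ?_
  simp only [Pi.add_apply]
  rw [integral_const_mul, integral_add (integrable_const _) i2, integral_const_mul]
  simp only [integral_const, probReal_univ, one_smul]
  have h5 : 1 - 2 * κ * σ ^ 2 + 2 * κ * σ ^ 2
      * ∫ x : p.support, Real.exp (‖x.1‖ ^ 2 / σ ^ 2) ∂(supportMeasure p)
      ≤ Real.exp (1 - 2 * κ) := by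
    have h6 : 2 * κ * σ ^ 2 * ∫ x : p.support, Real.exp (‖x.1‖ ^ 2 / σ ^ 2) ∂(supportMeasure p)
        ≤ 2 * κ * σ ^ 2 * Q := by gcongr
    have h7 : 0 ≤ 2 * κ * σ ^ 2 := by positivity
    linarith [Real.add_one_le_exp (1 - 2 * κ)]
  calc _ ≤ Real.exp (2 * κ) * Real.exp (1 - 2 * κ) := by gcongr
    _ = Real.exp 1 := by
      rw [← Real.exp_add]
      ring_nf

end Moment

end ResNet
end


noncomputable section

namespace ResNet

open Set State

/-! ### The sample size -/

section SampleSize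

/-- The sample size, up to `ε⁻²` and logarithms, for which all averages concentrate. -/
def sampleConst (A T c κ : ℝ) : ℝ :=
  2 / (κ / (128 * c ^ 8)) * (6 * (T + 1) * A + 3 + |Real.log (2 / (κ / (128 * c ^ 8)))|)

theorem log_le_mul_sub_one_add_log {a z : ℝ} (ha : 0 < a) (hz : 0 < z) :
    Real.log z ≤ a * z - 1 + Real.log (1 / a) := by
  have h := Real.log_le_sub_one_of_pos (mul_pos ha hz)
  rw [Real.log_mul ha.ne' hz.ne'] at h
  rw [one_div, Real.log_inv]
  linarith

/-- Half of the exponent `a * (m * ε ^ 2)` absorbs the logarithm of `m * ε ^ 2`, by a tangent line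
of the logarithm. The other half exceeds the remaining terms; replacing `m * ε ^ 2` by `m` costs `-2
* log ε`, whence three multiples of `log (1 / (ε * δ))`. -/
theorem sample_exponent_le {a H ε δ m : ℝ} (ha : 0 < a) (hH : 0 ≤ H) (hε : 0 < ε) (hε1 : ε ≤ 1)
    (hδ : 0 < δ) (hδ1 : δ ≤ 1) (hm : 0 < m)
    (h : 2 / a * (H + 3 + |Real.log (2 / a)|) * ε⁻¹ ^ 2 * (1 + Real.log (1 / (ε * δ))) ≤ m) :
    H + Real.log (1 / (ε * δ)) + Real.log m ≤ a * (m * ε ^ 2) := by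
  have l1 : Real.log (1 / (ε * δ)) = -Real.log ε - Real.log δ := by
    rw [one_div, Real.log_inv, Real.log_mul hε.ne' hδ.ne']
    ring
  have l2 := Real.log_nonpos hε.le hε1
  have l3 := Real.log_nonpos hδ.le hδ1
  set l := Real.log (1 / (ε * δ)) with hl
  have l0 : 0 ≤ l := by linarith
  have hz := log_le_mul_sub_one_add_log (half_pos ha) (by positivity : 0 < m * ε ^ 2)
  have e1 : 1 / (a / 2) = 2 / a := by field_simp
  rw [e1, Real.log_mul hm.ne' (by positivity), Real.log_pow] at hz
  have h2 : (H + 3 + |Real.log (2 / a)|) * (1 + l) ≤ a / 2 * (m * ε ^ 2) := by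
    calc (H + 3 + |Real.log (2 / a)|) * (1 + l)
        = a / 2 * ((2 / a * (H + 3 + |Real.log (2 / a)|) * ε⁻¹ ^ 2 * (1 + l)) * ε ^ 2) := by
          field_simp
      _ ≤ _ := by gcongr
  have h3 : 0 ≤ (H + |Real.log (2 / a)|) * l := by positivity
  have h4 := le_abs_self (Real.log (2 / a))
  push_cast at hz
  nlinarith

theorem tail_eq (c κ ε m : ℝ) (hc : 0 < c) :
    tail c κ ε m = 2 * Real.exp (-(κ / (128 * c ^ 8) * (m * ε ^ 2))) := by
  rw [tail]
  congr 3
  field_simp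
  ring

/-- Each of the three sources of failure receives `δ / 3`. The level `(1 + log (3 * m / δ)) / κ` is
chosen so that the last one is met with equality. -/
theorem failure_bound_le {A T c κ ε δ m : ℝ} (hA : 0 ≤ A) (hT : 0 ≤ T) (hc : 0 < c) (hκ : 0 < κ)
    (hε : 0 < ε) (hε1 : ε ≤ 1) (hδ : 0 < δ) (hδ1 : δ ≤ 1)
    (hm : sampleConst A T c κ * ε⁻¹ ^ 2 * (1 + Real.log (1 / (ε * δ))) ≤ m)
    (hm2 : 2 * ε⁻¹ ^ 2 * (1 + Real.log (1 / (ε * δ))) ≤ m) :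
    (T / ε + 1) * (A * m * tail c κ ε m)
      + (Real.exp (-m) + m * Real.exp (1 - κ * ((1 + Real.log (3 * m / δ)) / κ))) ≤ δ := by
  have l1 : Real.log (1 / (ε * δ)) = -Real.log ε - Real.log δ := by
    rw [one_div, Real.log_inv, Real.log_mul hε.ne' hδ.ne']
    ring
  have l2 := Real.log_nonpos hε.le hε1
  have l3 := Real.log_nonpos hδ.le hδ1
  have i1 : 1 ≤ ε⁻¹ ^ 2 := one_le_pow₀ ((one_le_inv₀ hε).2 hε1)
  have hm3 : 2 - Real.log δ ≤ m := by
    have : 2 * 1 * (1 + Real.log (1 / (ε * δ))) ≤ 2 * ε⁻¹ ^ 2 * (1 + Real.log (1 / (ε * δ))) := by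
      have : 0 ≤ 1 + Real.log (1 / (ε * δ)) := by linarith
      gcongr
    linarith
  have hm0 : 0 < m := by linarith
  have h1 : (T / ε + 1) * (A * m * tail c κ ε m) ≤ δ / 3 := by
    -- With this `H` the whole prefactor of the union bound becomes `H * exp (-H) ≤ 1` times `δ /
    -- 3`.
    set H := 6 * (T + 1) * A with hH
    have H0 : 0 ≤ H := by positivity
    have k := sample_exponent_le (a := κ / (128 * c ^ 8)) (by positivity) H0 hε hε1 hδ hδ1 hm0 hm
    have e1 : Real.exp (-(κ / (128 * c ^ 8) * (m * ε ^ 2))) ≤ Real.exp (-H) * (ε * δ) / m := by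
      have : Real.exp (-H) * (ε * δ) / m
          = Real.exp (-(H + Real.log (1 / (ε * δ)) + Real.log m)) := by
        rw [neg_add, neg_add, Real.exp_add, Real.exp_add, Real.exp_neg (Real.log m),
          Real.exp_log hm0, one_div, Real.log_inv, neg_neg, Real.exp_log (by positivity)]
        rfl
      rw [this]
      exact Real.exp_le_exp.2 (neg_le_neg k)
    have e2 : H * Real.exp (-H) ≤ 1 := by
      rw [Real.exp_neg, ← div_eq_mul_inv, div_le_one (Real.exp_pos _)]
      linarith [Real.add_one_le_exp H]
    have e3 : T / ε + 1 ≤ (T + 1) / ε := by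
      rw [add_div]
      gcongr
      rw [le_div_iff₀ hε]
      linarith
    rw [tail_eq c κ ε m hc]
    calc (T / ε + 1) * (A * m * (2 * Real.exp (-(κ / (128 * c ^ 8) * (m * ε ^ 2)))))
        ≤ (T + 1) / ε * (A * m * (2 * (Real.exp (-H) * (ε * δ) / m))) := by gcongr
      _ = H * Real.exp (-H) * (δ / 3) := by
        rw [hH]
        field_simp
        ring
      _ ≤ δ / 3 := mul_le_of_le_one_left (by positivity) e2
  have h2 : Real.exp (-m) ≤ δ / 3 := by
    have : Real.exp (-m) ≤ Real.exp (-2 + Real.log δ) := Real.exp_le_exp.2 (by linarith)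
    rw [Real.exp_add, Real.exp_log hδ, Real.exp_neg 2] at this
    have h3 : (Real.exp 2)⁻¹ ≤ 3⁻¹ := by
      gcongr
      linarith [Real.add_one_le_exp (2 : ℝ)]
    calc _ ≤ (Real.exp 2)⁻¹ * δ := this
      _ ≤ 3⁻¹ * δ := by gcongr
      _ = δ / 3 := by ring
  have h3 : m * Real.exp (1 - κ * ((1 + Real.log (3 * m / δ)) / κ)) = δ / 3 := by
    have : 1 - κ * ((1 + Real.log (3 * m / δ)) / κ) = -Real.log (3 * m / δ) := by
      field_simp
      ring
    rw [this, Real.exp_neg, Real.exp_log (by positivity)]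
    field_simp
  linarith

theorem weight_bound_le {κ ε δ m : ℝ} (hκ : 0 < κ) (hε : 0 < ε) (hε1 : ε ≤ 1) (hδ : 0 < δ)
    (hδ1 : δ ≤ 1) (hm : 1 ≤ m) :
    (1 + Real.log (3 * m / δ)) / κ ≤ 3 / κ * (1 + Real.log (m / (ε * δ))) := by
  have hm0 : 0 < m := by linarith
  have h0 : 0 ≤ Real.log (m / (ε * δ)) := by
    refine Real.log_nonneg ((one_le_div (by positivity)).2 ?_)
    calc ε * δ ≤ 1 * 1 := by gcongr
      _ ≤ m := by linarith
  have h1 : Real.log (3 * m / δ) ≤ 2 + Real.log (m / (ε * δ)) := by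
    rw [mul_div_assoc, Real.log_mul (by norm_num) (by positivity)]
    have h2 := Real.log_le_sub_one_of_pos (by norm_num : (0 : ℝ) < 3)
    have h3 : Real.log (m / δ) ≤ Real.log (m / (ε * δ)) := by
      refine Real.log_le_log (by positivity) ?_
      gcongr
      exact mul_le_of_le_one_left hδ.le hε1
    linarith
  rw [div_mul_eq_mul_div]
  gcongr
  linarith

end SampleSize

/-! ### Sampling from the support -/

section Sampling

variable {d N B m : ℕ} {p : Measure (Path d N B)} [IsProbabilityMeasure p] {Ω : Type*}
  [MeasurableSpace Ω] {P : Measure Ω} [IsProbabilityMeasure P] {v : ContWeights d N B}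
  {Θ : Fin m → Ω → Path d N B} {w : Ω → Weights d m B} {ε : ℝ}

/-- The i.i.d. paths of an independent initialization are a.s. samples of `supportMeasure p`. -/
theorem IsIndependentInit.exists_sample (h : IsIndependentInit P p v Θ w ε) :
    ∃ θ : Ω → Fin m → p.support, Measurable θ
      ∧ P.map θ = Measure.pi (fun _ => supportMeasure p)
      ∧ ∀ᵐ ω ∂P, ∀ i, (θ ω i : Path d N B) = Θ i ω := by
  have hne : Nonempty p.support :=
    (Measure.nonempty_support (IsProbabilityMeasure.ne_zero p)).to_subtype
  -- A measurable retraction onto the support: it makes the paths take values in the support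
  -- everywhere, and it changes them only on a null set.
  obtain ⟨ρ, hρ, hρv⟩ := (MeasurableEmbedding.subtype_coe
    (measurableSet_support p)).exists_measurable_extend measurable_id fun _ => hne
  have hmap : p.map ρ = supportMeasure p := by
    rw [← congrArg (Measure.map ρ) (map_supportMeasure p), Measure.map_map hρ
      measurable_subtype_coe, hρv, Measure.map_id]
  have hi := h.indep.comp (fun _ => ρ) fun _ => hρ
  have hm : ∀ i, Measurable (ρ ∘ Θ i) := fun i => hρ.comp (h.meas i)
  refine ⟨fun ω i => ρ (Θ i ω), measurable_pi_lambda _ hm, ?_, ?_⟩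
  · have := (iIndepFun_iff_map_fun_eq_pi_map fun i => (hm i).aemeasurable).1 hi
    refine this.trans ?_
    congr 1
    funext i
    rw [← Measure.map_map hρ (h.meas i), h.law, hmap]
  · refine ae_all_iff.2 fun i => ?_
    have hs : ∀ᵐ y ∂(P.map (Θ i)), y ∈ p.support := by
      rw [h.law]
      exact Measure.support_mem_ae
    filter_upwards [ae_of_ae_map (h.meas i).aemeasurable hs] with ω hω
    have := congrFun hρv ⟨Θ i ω, hω⟩
    exact congrArg Subtype.val this

end Sampling

/-! ### The comparison on good samples -/

section Comparison

variable {N d B m : ℕ} {Y : Type*} {M : Model N d Y} {p : Measure (Path d N B)}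
  {v : ContWeights d N B} {Φ : Trajectory d N B}
  {T c κ ε η R r K : ℝ} {w : Weights d m B} {θ : Fin m → p.support}

theorem weightsClose_zero (hΦ : IsNeuralFeatureFlow M p v T Φ) (hT : 0 ≤ T) (hε : 0 ≤ ε)
    (first : ∀ j, ‖(fun i : Fin d => w (.first i j)) - (θ j).1.1‖ ≤ (1 + ‖(θ j).1‖) * ε)
    (hidden : ∀ b i j, |w (.hidden b i j) - v.hidden b (θ i) (θ j)|
      ≤ (1 + ‖(θ i).1‖ + ‖(θ j).1‖) * ε)
    (last : ∀ i, |w (.last i) - v.last (θ i)| ≤ (1 + ‖(θ i).1‖) * ε) :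
    WeightsClose ((fun x : p.support => 1 + ‖x.1‖) ∘ θ) ε (netState M w)
      ((Φ.state p 0).comap θ) where
  first j i := by
    change |w (.first i j) - Φ.first (θ j) 0 i| ≤ ε * (1 + ‖(θ j).1‖)
    rw [hΦ.first_zero hT, mul_comm]
    exact (norm_le_pi_norm ((fun i : Fin d => w (.first i j)) - (θ j).1.1) i).trans (first j)
  hidden b i j := by
    change |w (.hidden b i j) - Φ.hidden b (θ i) (θ j) 0| ≤ ε * (1 + ‖(θ i).1‖ + (1 + ‖(θ j).1‖))
    rw [hΦ.hidden_zero hT]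
    linarith [hidden b i j]
  last i := by
    change |w (.last i) - Φ.last (θ i) 0| ≤ ε * (1 + ‖(θ i).1‖)
    rw [hΦ.last_zero hT, mul_comm]
    exact last i

/-- From `1 ≤ s` one gets `s ≤ s ^ 2 ≤ R`, so the bound on squared weights serves directly and no
square root is taken. The factor `2` is for hidden edges, whose error carries the weights of both
endpoints. -/
theorem processesClose_of_close {e t : ℝ} (h : WeightsClose ((fun x : p.support => 1 + ‖x.1‖) ∘ θ) e
      (netState M w) ((Φ.state p t).comap θ))
    (h' : FeaturesClose ((fun x : p.support => 1 + ‖x.1‖) ∘ θ) e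
      (netState M w) ((Φ.state p t).comap θ))
    (he : 0 ≤ e) (hR : ∀ i, (1 + ‖(θ i).1‖) ^ 2 ≤ R) (hr0 : 0 ≤ r) (hr : 2 * e * R ≤ r) :
    ProcessesClose M Φ (fun i => (θ i).1) w t r := by
  have hs : ∀ i, 1 + ‖(θ i).1‖ ≤ R := fun i => by
    nlinarith [hR i, norm_nonneg (θ i).1]
  have h1 : ∀ i, e * (1 + ‖(θ i).1‖) ≤ r := fun i => by
    nlinarith [mul_le_mul_of_nonneg_left (hs i) he, mul_nonneg he (norm_nonneg (θ i).1)]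
  refine ⟨fun j => (pi_norm_le_iff_of_nonneg hr0).2 fun i => (h.first j i).trans (h1 j),
    fun b i j => (h.hidden b i j).trans ?_, fun i => (h.last i).trans (h1 i),
    fun b i => (pi_norm_le_iff_of_nonneg hr0).2 fun n => (h'.α b i n).trans (h1 i),
    fun l i => (pi_norm_le_iff_of_nonneg hr0).2 fun n => (h'.β l i n).trans (h1 i)⟩
  change e * (1 + ‖(θ i).1‖ + (1 + ‖(θ j).1‖)) ≤ r
  nlinarith [mul_le_mul_of_nonneg_left (hs i) he, mul_le_mul_of_nonneg_left (hs j) he]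

theorem abs_loss_sub_le {e t : ℝ} (hM : M.Tame c) (he : 0 ≤ e)
    (h : ∀ n, |output M w n - flowOutput M p Φ t n| ≤ e) :
    |loss M w - flowLoss M p Φ t| ≤ c * e := by
  have c0 : 0 ≤ c := zero_le_one.trans hM.one_le
  exact abs_mean_sub_le (by positivity) fun n => (hM.φ_lip _ _ _).trans (by gcongr; exact h n)

end Comparison

end ResNet
end


/-! ### Assembly of the theorem -/

noncomputable section

namespace ResNet

open Set State

section Main

variable {N d B n : ℕ} {Y : Type*} {M : Model N d Y} {p : Measure (Path d N B)}
  [IsProbabilityMeasure p] {v : ContWeights d N B} {Φ : Trajectory d N B} {T c κ ε δ η : ℝ}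

/-- The comparison of gradient descent and the neural feature flow, from bounds of the flow. -/
theorem measure_not_close_le (hv : IsContResNet M p v) (hΦ : IsNeuralFeatureFlow M p v T Φ)
    (hb : BddFlow M (supportMeasure p) (fun x => 1 + ‖x.1‖) c T (Φ.state p))
    (hκ : ExpWeight (supportMeasure p) (fun x => 1 + ‖x.1‖) κ) (hκc : 2 / κ ≤ c)
    (hT : 0 ≤ T) (hd : 0 < d) {C : ℝ}
    (hC2 : 2 + 4 * c ^ 4 + |sampleConst (N + 2 * B * N) T c κ| ≤ C)
    (hCE : 6 / κ * |descentConst B c T| + c * |descentConst B c T| ≤ C)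
    (hε : 0 < ε) (hε1 : ε * (1 + |descentConst B c T|) ≤ 1) (hδ : 0 < δ) (hδ1 : δ ≤ 1)
    (hη : 0 < η) (hηε : η ≤ ε / C) {m : ℕ}
    (hm : C * ε⁻¹ ^ 2 * (1 + Real.log (1 / (ε * δ))) ≤ m)
    {Ω : Type*} [MeasurableSpace Ω] {P : Measure Ω} [IsProbabilityMeasure P]
    {Θ : Fin m → Ω → Path d N B} {w : Ω → Weights d m B} (hw : IsIndependentInit P p v Θ w ε) :
    P {ω | ¬ ∀ k : ℕ, k * η ≤ T →
        ProcessesClose M Φ (fun i => Θ i ω) (gd M (w ω) η k) (k * η)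
          (C * ε * (1 + Real.log (m / (ε * δ)))) ∧
        |loss M (gd M (w ω) η k) - flowLoss M p Φ (k * η)| ≤ C * ε}
      ≤ ENNReal.ofReal δ := by
  have κ0 := hκ.pos
  have c1 := hb.tame.one_le
  have c0 : 0 < c := by linarith
  set E := |descentConst B c T| with hE
  have E0 : 0 ≤ E := abs_nonneg _
  have hεle : ε ≤ 1 := by nlinarith
  have l1 : Real.log (1 / (ε * δ)) = -Real.log ε - Real.log δ := by
    rw [one_div, Real.log_inv, Real.log_mul hε.ne' hδ.ne']
    ring
  have l2 := Real.log_nonpos hε.le hεle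
  have l3 := Real.log_nonpos hδ.le hδ1
  have l0 : 1 ≤ 1 + Real.log (1 / (ε * δ)) := by linarith
  have S0 := abs_nonneg (sampleConst (N + 2 * B * N) T c κ)
  have hmono : ∀ x, x ≤ C → x * ε⁻¹ ^ 2 * (1 + Real.log (1 / (ε * δ))) ≤ m := fun x hx =>
    hm.trans' (by gcongr)
  have c40 : 0 < c ^ 4 := by positivity
  have hC1 : 1 ≤ C := by linarith
  have i1 : 1 ≤ ε⁻¹ := (one_le_inv₀ hε).2 hεle
  have hm2 : (2 : ℝ) ≤ m := by
    refine (hmono 2 (by linarith)).trans' ?_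
    have : 1 ≤ ε⁻¹ ^ 2 * (1 + Real.log (1 / (ε * δ))) := one_le_mul_of_one_le_of_one_le
      (one_le_pow₀ i1) l0
    linarith
  have hmε : 4 * c ^ 4 ≤ m * ε := by
    have h1 : 4 * c ^ 4 ≤ 4 * c ^ 4 * ε⁻¹ ^ 2 * (1 + Real.log (1 / (ε * δ))) * ε := by
      have : 4 * c ^ 4 * ε⁻¹ ^ 2 * (1 + Real.log (1 / (ε * δ))) * ε
          = 4 * c ^ 4 * (ε⁻¹ * (1 + Real.log (1 / (ε * δ)))) := by
        field_simp
      rw [this]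
      exact le_mul_of_one_le_right (by positivity) (one_le_mul_of_one_le_of_one_le i1 l0)
    exact h1.trans (mul_le_mul_of_nonneg_right (hmono _ (by linarith)) hε.le)
  have hsample := failure_bound_le (A := N + 2 * B * N) (by positivity) hT c0 κ0 hε hεle hδ hδ1
    (hmono _ (by linarith [le_abs_self (sampleConst (N + 2 * B * N) T c κ)]))
    (hmono 2 (by linarith))
  have hweight := weight_bound_le κ0 hε hεle hδ hδ1 (by linarith : (1 : ℝ) ≤ m)
  set R := (1 + Real.log (3 * m / δ)) / κ with hR
  -- The concentration estimates single out one sample point and need at least one more; the summand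
  -- `2` in `C` ensures `m ≥ 2`.
  obtain ⟨n, rfl⟩ : ∃ n, m = n + 1 := ⟨m - 1, by
    have : 2 ≤ m := by exact_mod_cast hm2
    omega⟩
  have hn : 0 < n := by
    have : 2 ≤ n + 1 := by exact_mod_cast hm2
    omega
  have hpi := (hb.measure_not_goodSample_le hκ hT hε hn hmε R).trans
    (ENNReal.ofReal_le_ofReal hsample)
  obtain ⟨θ, hθ, hlaw, hae⟩ := hw.exists_sample
  rw [← hlaw] at hpi
  -- Neither the failure event nor the set of bad samples is known to be measurable.
  -- `Measure.le_map_apply` holds for arbitrary sets and has the required direction.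
  refine le_trans (measure_mono_ae ?_) ((Measure.le_map_apply hθ.aemeasurable _).trans hpi)
  filter_upwards [hae, hw.close_first, hw.close_hidden, hw.close_last] with ω h0 h1 h2 h3
  refine fun hbad => show ¬ GoodSample _ _ _ _ _ _ _ _ _ from fun good => hbad fun k hk => ?_
  have hD : |descentConst B c T| * ε ≤ 1 := by linarith
  have hw0 : WeightsClose ((fun x : p.support => 1 + ‖x.1‖) ∘ θ ω) ε (netState M (w ω))
      ((Φ.state p 0).comap (θ ω)) :=
    weightsClose_zero hΦ hT hε.le (fun j => by rw [h0]; exact h1 j)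
      (fun b i j => by rw [h0, h0]; exact h2 b i j) fun i => by rw [h0]; exact h3 i
  have hηε' : η ≤ ε := hηε.trans (div_le_self hε.le hC1)
  obtain ⟨hW, hF, hO⟩ := hb.gd_close (hΦ.forward_zero hT hv) (good.weight.mono hκc) hd n.succ_pos
    good.conc hη hηε' ((mul_le_mul_of_nonneg_right (le_abs_self _) hε.le).trans hD) hw0 k hk
  have hDE : descentConst B c T * ε ≤ E * ε :=
    mul_le_mul_of_nonneg_right (le_abs_self _) hε.le
  have hs : ∀ i, 0 ≤ ((fun x : p.support => 1 + ‖x.1‖) ∘ θ ω) i := fun i => by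
    change 0 ≤ 1 + ‖(θ ω i).1‖
    positivity
  have hl : 0 ≤ 1 + Real.log ((n + 1 : ℕ) / (ε * δ)) := by
    have h4 : ε * δ ≤ 1 * 1 := by gcongr
    have := Real.log_nonneg ((one_le_div (by positivity : 0 < ε * δ)).2
      (by linarith : ε * δ ≤ (n + 1 : ℕ)))
    linarith
  have hCE' : 6 / κ * E ≤ C := by nlinarith
  have e0 : (fun i => Θ i ω) = fun i => (θ ω i).1 := funext fun i => (h0 i).symm
  rw [e0]
  refine ⟨processesClose_of_close (hW.mono hs hDE) (hF.mono hs hDE) (by positivity) good.le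
    (by positivity) ?_, ?_⟩
  · calc 2 * (E * ε) * R
        ≤ 2 * (E * ε) * (3 / κ * (1 + Real.log ((n + 1 : ℕ) / (ε * δ)))) := by gcongr
      _ = 6 / κ * E * ε * (1 + Real.log ((n + 1 : ℕ) / (ε * δ))) := by ring
      _ ≤ _ := by gcongr
  · refine (abs_loss_sub_le hb.tame (mul_nonneg E0 hε.le) fun n' => ?_).trans ?_
    · rw [← out_state]
      exact (hO n').trans hDE
    · rw [← mul_assoc]
      refine mul_le_mul_of_nonneg_right ?_ hε.le
      have : 0 ≤ 6 / κ * E := by positivity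
      linarith

end Main

end ResNet
end

theorem mainTheorem2 (N d B : ℕ) (hN : 0 < N) (hd : 0 < d) (hB : 0 < B)
    (T σ L₁ L₂ L₃ L₄ L₅ C₅ C₆ C₇ C₈ Cx : ℝ) (hT : 0 < T) (hσ : 0 < σ) :
    ∃ (C ε₀ : ℝ) (q : ℕ), 0 < C ∧ 0 < ε₀ ∧ ε₀ ≤ 1 ∧
      ∀ (Y : Type*) (M : ResNet.Model N d Y),
        (∀ n i, |M.X n i| ≤ Cx) →
        M.Regular L₁ L₂ L₃ L₄ L₅ →
        ∀ (p : Measure (ResNet.Path d N B)) [IsProbabilityMeasure p]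
          (v : ResNet.ContWeights d N B),
          ResNet.IsContResNet M p v →
          ResNet.InitRegular p v σ C₅ C₆ C₇ C₈ →
          ∀ Φ : ResNet.Trajectory d N B,
            ResNet.IsNeuralFeatureFlow M p v T Φ →
            ∀ (ε₁ δ η : ℝ) (m : ℕ),
              0 < ε₁ → ε₁ ≤ ε₀ → 0 < δ → δ ≤ 1 → 0 < η → η ≤ ε₁ / C →
              C * ε₁⁻¹ ^ 2 * (1 + Real.log (1 / (ε₁ * δ))) ^ q ≤ m →
              ∀ (Ω : Type*) [MeasurableSpace Ω] (P : Measure Ω) [IsProbabilityMeasure P]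
                (Θ : Fin m → Ω → ResNet.Path d N B) (w : Ω → ResNet.Weights d m B),
                ResNet.IsIndependentInit P p v Θ w ε₁ →
                P {ω | ¬ ∀ k : ℕ, k * η ≤ T →
                    ResNet.ProcessesClose M Φ (fun i => Θ i ω) (ResNet.gd M (w ω) η k) (k * η)
                      (C * ε₁ * (1 + Real.log (m / (ε₁ * δ))) ^ q) ∧
                    |ResNet.loss M (ResNet.gd M (w ω) η k) - ResNet.flowLoss M p Φ (k * η)|
                      ≤ C * ε₁}
                  ≤ ENNReal.ofReal δ := by
  obtain ⟨κ, hκ⟩ : ∃ x, x = ResNet.momentRate d N B σ := ⟨_, rfl⟩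
  have κ0 : 0 < κ := hκ ▸ ResNet.momentRate_pos d N B σ
  -- Absolute values are taken because the constants carry no sign assumption. The summand `|T|`
  -- bounds the time horizon, and `3 / κ` is the second moment of the weight under `p`.
  obtain ⟨c₀, hc₀⟩ : ∃ x, x = 1 + (|T| + |L₁| + |L₂| + |L₃| + |L₄| + |L₅| + |C₅| + |C₇| + |Cx| + 3 / κ) := ⟨_, rfl⟩
  have a0 : 0 < 3 / κ := by positivity
  have aT := abs_nonneg T
  have a1 := abs_nonneg L₁
  have a2 := abs_nonneg L₂
  have a3 := abs_nonneg L₃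
  have a4 := abs_nonneg L₄
  have a5 := abs_nonneg L₅
  have a6 := abs_nonneg C₅
  have a7 := abs_nonneg C₇
  have a8 := abs_nonneg Cx
  have hc₁ : 1 ≤ c₀ := by linarith
  -- The enlarged constant produced by `Flow.bddFlow`, valid along the whole flow.
  obtain ⟨c, hc⟩ : ∃ x, x = 2 * ResNet.backBound B c₀ * c₀ ^ 3 := ⟨_, rfl⟩
  obtain ⟨E, hE⟩ : ∃ x, x = |ResNet.descentConst B c T| := ⟨_, rfl⟩
  obtain ⟨S, hS⟩ : ∃ x, x = |ResNet.sampleConst (N + 2 * B * N) T c κ| := ⟨_, rfl⟩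
  have E0 : 0 ≤ E := hE ▸ abs_nonneg _
  have S0 : 0 ≤ S := hS ▸ abs_nonneg _
  have hcc : c₀ ≤ c := by
    have k1 := ResNet.one_le_backBound B hc₁
    have k2 : 1 ≤ c₀ ^ 2 := one_le_pow₀ hc₁
    calc c₀ = 1 * 1 * c₀ := by ring
      _ ≤ 2 * ResNet.backBound B c₀ * c₀ ^ 2 * c₀ := by
        gcongr
        · nlinarith
      _ = c := by rw [hc]; ring
  have c0 : 0 < c := by linarith
  -- The first three summands of `C` are for the sample size. Then `6 / κ * E` bounds the processes,
  -- being twice the factor `3 / κ` in the bound on squared weights, and `c * E` bounds the loss.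
  -- The threshold `1 / (1 + E)` keeps `descentConst * ε₁` at most one, and first powers of the
  -- logarithms suffice, so `q = 1`.
  refine ⟨2 + 4 * c ^ 4 + S + (6 / κ * E + c * E), 1 / (1 + E), 1, by positivity, by positivity,
    (div_le_one (by positivity)).2 (by linarith), ?_⟩
  intro Y M hX hM p _ v hv hinit Φ hΦ ε₁ δ η m hε hε₀ hδ hδ1 hη hηε hm Ω _ P _ Θ w hw
  rw [pow_one] at hm ⊢
  have hexp := hinit.subGaussian.expWeight hσ
  rw [← hκ] at hexp
  have hb := (hΦ.flow hT.le).bddFlow (c := c₀)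
    (hM.tame hX hc₁ (by linarith [le_abs_self L₁]) (by linarith [le_abs_self L₂])
      (by linarith [le_abs_self L₃]) (by linarith [le_abs_self L₄]) (by linarith [le_abs_self L₅])
      (by linarith [le_abs_self Cx]))
    (by linarith [le_abs_self T]) (hexp.isWeight.mono (by linarith))
    (hΦ.bdd_zero hT.le hinit (by linarith [le_abs_self C₅]) (by linarith [le_abs_self C₇]))
  rw [← hc] at hb
  refine ResNet.measure_not_close_le hv hΦ hb hexp ?_ hT.le hd ?_ ?_ hε ?_ hδ hδ1 hη hηε hm hw
  · have : 2 / κ ≤ 3 / κ := by gcongr; norm_num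
    linarith
  · have : 0 ≤ 6 / κ * E + c * E := by positivity
    rw [← hS]
    linarith
  · have : 0 ≤ 2 + 4 * c ^ 4 + S := by positivity
    rw [← hE]
    linarith
  · rw [← hE]
    rwa [le_div_iff₀ (by positivity)] at hε₀
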